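/- **Setting.** Let $G$ be a connected simple graph on the nodes $1,\dots,N$, with adjacency sets $N(i)$ and symmetric weights $\omega_{ij}=\omega_{ji}$, $\widetilde\omega_{ij}=\widetilde\omega_{ji}$ that are positive on the edges. Let $\mathbb V\in\mathbb R^N$, let $\mathbb W\in\mathbb R^{N\times N}$ be symmetric, and let $\beta>0$. For $\rho\in(0,\infty)^N$ and $S\in\mathbb R^N$ put $$\mathcal H(\rho,S)=\frac14\sum_{i}\sum_{j\in N(i)}\omega_{ij}(S_i-S_j)^2\,\frac{\rho_i+\rho_j}{2}+\beta I(\rho)+\mathcal V(\rho)+\mathcal W(\rho),$$ $$I(\rho)=\frac12\sum_i\sum_{j\in N(i)}\widetilde\omega_{ij}\,|\log\rho_i-\log\rho_j|^2\,\theta^L(\rho_i,\rho_j),\qquad \mathcal V(\rho)=\sum_i\mathbb V_i\rho_i,\qquad \mathcal W(\rho)=\frac12\sum_{i,j}\mathbb W_{ij}\rho_i\rho_j,$$ where $\theta^L(x,y)=\frac{x-y}{\log x-\log y}$ for $x\ne y$ and $\theta^L(x,x)=x$. Let $\mathcal P(G)$ be the set of probability vectors on the nodes and $\mathcal P_o(G)$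 the set of strictly positive ones. Write $y=(\rho,S)$ (with the sup norm) and $f(y)=(\partial_S\mathcal H,-\partial_\rho\mathcal H)$; the Fisher-regularized Wasserstein–Hamiltonian system is $\dot y=f(y)$. Let $(a_{ij},b_i)_{i,j\le s}$ be the coefficients of a Runge–Kutta method with $b_ia_{ij}+b_ja_{ji}=b_ib_j$ for all $i,j$ and $\sum_ib_i=1$. A *step* of size $\tau\in\mathbb R$ from $y^0$ to $y^1$ means that there are stages $Y^1,\dots,Y^s$ with positive densities such that $$Y^i=y^0+\tau\sum_j a_{ij}f(Y^j),\qquad y^1=y^0+\tau\sum_j b_jf(Y^j).$$ It is a *$\delta$-step* if moreover $\|Y^i-y^0\|\le\delta$ for all $i$. A (numerical) solution is a sequence $y^n=(\rho^n,S^n)$ in which consecutive members are joined by steps of size $\tau$. **Theorem.** The scheme is locally well posed: each $y_0=(\rho_0,S_0)$ with $\rho_0>0$ has an open neighbourhood $U$ and $\delta,\tau_0>0$ such that for $|\tau|\le\tau_0$ and $y\in U$ there is exactly one system of stages with positive densities within distance $\delta$ of $y$ for a step of size $\tau$ from $y$, and it is a $C^\infty$ function of $y\in U$. Moreover: 1.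 **Mass.** Every numerical solution satisfies $\sum_i\rho_i^n=\sum_i\rho_i^0$. 2. **Symplecticity.** $d\rho^n\wedge dS^n=d\rho^0\wedge dS^0$: if numerical solutions depend on a parameter in a real normed space in such a way that the initial value and the stages of the first $n$ steps are differentiable at a point $e$ (the steps being valid for all parameters near $e$), then $y^n$ is differentiable at $e$, and the pullbacks at $e$ of $\sum_id\rho_i\wedge dS_i$ by $y^n$ and by $y^0$ coincide. 3. **Time reversibility.** Suppose the scheme is symmetric, i.e. for all $\tau,y,z$ there is a step of size $\tau$ from $y$ to $z$ if and only if there is a step of size $-\tau$ from $z$ to $y$. If $(\rho^n,S^n)$, $n_1\le n\le n_2$ (integers), is a numerical solution, then so is $(\rho^{-n},-S^{-n})$, $-n_2\le n\le -n_1$. 4. **Gauge invariance.** Let $\alpha\in\mathbb R$. If $(\rho^n,S^n)$ is a numerical solution, then $(\rho^n,S^n+\alpha n\tau)$ is a numerical solution for the system with linear potential $\mathbb V-\alpha$. 5. **Stationary solutions.** Let $\rho^*\in\mathcal P_o(G)$ and, for $v\in\mathbb R$, let $S^{*n}=-vn\tau$ (the same value on all nodes). Consider the condition that, for all $n\ge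 0$, $(\rho^*,S^{*n})$ is a critical point of $\mathcal H$ on $\mathcal P_o(G)\times\mathbb R^N$ (all derivatives in directions $(\sigma,\eta)$ with $\sum_i\sigma_i=0$ vanish) and $$v=\mathcal H(\rho^*,S^{*n})+\frac12\sum_{i,j}\mathbb W_{ij}\rho^*_i\rho^*_j.$$ There are $\delta,\tau_0>0$ (depending on $\rho^*$ but not on $v$) such that for $0<|\tau|\le\tau_0$ and all $v$, the sequence $(\rho^*,S^{*n})_{n\ge0}$ is a numerical solution consisting of $\delta$-steps if and only if this condition holds. For every $\tau\in\mathbb R$ and $v$, the condition implies that the sequence is a numerical solution. 6. **Near-conservation of energy.** For $y_0=(\rho_0,S_0)$ put $M=\mathcal H(\rho_0,S_0)-\min_{\rho\in\mathcal P(G)}(\mathcal V(\rho)+\mathcal W(\rho))$. Let the method have order $r\ge1$ (local error $O(\tau^{r+1})$ for all smooth ordinary differential equations). For all $\varepsilon,T_0>0$ there are $\delta,\tau_0>0$ and $C$ such that the following holds for all $\rho_0\in\mathcal P_o(G)$ and $S_0\in\mathbb R^N$ with $M/\beta\le\varepsilon$ and all $0<\tau\le\tau_0$. There is a solution by $\delta$-steps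 of size $\tau$ starting from $(\rho_0,S_0)$ and defined as long as $n\tau\le T_0\tau^{-r}$, and every such solution satisfies, as long as $n\tau\le T_0\tau^{-r}$, $$\rho^n\in\mathcal P_o(G),\qquad |\mathcal H(\rho^n,S^n)-\mathcal H(\rho_0,S_0)|\le C\tau^r .$$ -/

import Mathlib

open scoped Topology ContDiff

/-! ### Wasserstein–Hamiltonian systems on a finite graph -/

/-- The data of a Fisher-regularized Wasserstein–Hamiltonian system on the nodes `Fin N`: a connected
simple graph, symmetric positive edge weights `w` and Fisher edge weights `wF`, a linear potential `V`,
a symmetric interaction potential `W` and a regularization parameter `β > 0`.  Only the values of `w`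
and `wF` on the edges are ever used. -/
structure WHSystem (N : ℕ) where
  graph : SimpleGraph (Fin N)
  connected : graph.Connected
  w : Fin N → Fin N → ℝ
  w_symm : ∀ i j, w i j = w j i
  w_pos : ∀ i j, graph.Adj i j → 0 < w i j
  wF : Fin N → Fin N → ℝ
  wF_symm : ∀ i j, wF i j = wF j i
  wF_pos : ∀ i j, graph.Adj i j → 0 < wF i j
  V : Fin N → ℝ
  W : Fin N → Fin N → ℝ
  W_symm : ∀ i j, W i j = W j i
  β : ℝ
  β_pos : 0 < β

/-- Phase space: pairs `(ρ, S)` of a density and a potential on the nodes (with the sup norm). -/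
abbrev Phase (N : ℕ) : Type := (Fin N → ℝ) × (Fin N → ℝ)

/-- The set of strictly positive probability densities, i.e. the interior of the probability simplex. -/
def interiorSimplex (N : ℕ) : Set (Fin N → ℝ) :=
  {ρ | (∀ i, 0 < ρ i) ∧ ∑ i, ρ i = 1}

/-- The part of phase space where all densities are strictly positive (the domain of the Hamiltonian). -/
def positivePhase (N : ℕ) : Set (Phase N) := {y | ∀ i, 0 < y.1 i}

/-- The average probability weight. -/
noncomputable def averageWeight (x y : ℝ) : ℝ := (x + y) / 2

/-- The logarithmic probability weight, extended by continuity to the diagonal. -/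
noncomputable def logWeight (x y : ℝ) : ℝ :=
  if x = y then x else (x - y) / (Real.log x - Real.log y)

namespace WHSystem

variable {N : ℕ} (sys : WHSystem N)

open Classical in
/-- The adjacency set of a node. -/
noncomputable def nbr (i : Fin N) : Finset (Fin N) :=
  Finset.univ.filter (fun j => sys.graph.Adj i j)

/-- The graph gradient of a function on the nodes. -/
noncomputable def grad (S : Fin N → ℝ) (i j : Fin N) : ℝ :=
  Real.sqrt (sys.w i j) * (S i - S j)

/-- The inner product of two vector fields, with the average weight of `ρ`; every edge is counted in both
directions. -/
noncomputable def edgeInner (ρ : Fin N → ℝ) (u v : Fin N → Fin N → ℝ) : ℝ :=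
  1 / 2 * ∑ i, ∑ j ∈ sys.nbr i, u i j * v i j * averageWeight (ρ i) (ρ j)

/-- Kinetic energy. -/
noncomputable def kinetic (ρ S : Fin N → ℝ) : ℝ :=
  1 / 2 * sys.edgeInner ρ (sys.grad S) (sys.grad S)

/-- Discrete Fisher information, with the logarithmic weight. -/
noncomputable def fisher (ρ : Fin N → ℝ) : ℝ :=
  1 / 2 * ∑ i, ∑ j ∈ sys.nbr i,
    sys.wF i j * |Real.log (ρ i) - Real.log (ρ j)| ^ 2 * logWeight (ρ i) (ρ j)

/-- Total linear potential. -/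
noncomputable def linPot (ρ : Fin N → ℝ) : ℝ := ∑ i, sys.V i * ρ i

/-- Total interaction potential. -/
noncomputable def intPot (ρ : Fin N → ℝ) : ℝ := 1 / 2 * ∑ i, ∑ j, sys.W i j * ρ i * ρ j

/-- The Hamiltonian, as a function of the density `ρ` and the potential `S`. -/
noncomputable def ham (ρ S : Fin N → ℝ) : ℝ :=
  sys.kinetic ρ S + (sys.β * sys.fisher ρ + sys.linPot ρ + sys.intPot ρ)

/-- The partial derivative of the Hamiltonian with respect to `ρ i`. -/
noncomputable def dHdρ (ρ S : Fin N → ℝ) (i : Fin N) : ℝ :=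
  deriv (fun x => sys.ham (Function.update ρ i x) S) (ρ i)

/-- The partial derivative of the Hamiltonian with respect to `S i`. -/
noncomputable def dHdS (ρ S : Fin N → ℝ) (i : Fin N) : ℝ :=
  deriv (fun x => sys.ham ρ (Function.update S i x)) (S i)

/-- The Wasserstein–Hamiltonian vector field: `dρ/dt = ∂H/∂S`, `dS/dt = -∂H/∂ρ`. -/
noncomputable def field (y : Phase N) : Phase N :=
  (sys.dHdS y.1 y.2, fun i => - sys.dHdρ y.1 y.2 i)

/-- The same system with the linear potential `V` replaced by `V - α`. -/
def shiftPotential (α : ℝ) : WHSystem N := { sys with V := fun i => sys.V i - α }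

/-- `(ρ, S)` is a critical point of the Hamiltonian on (positive probability densities) × (potentials):
the derivative vanishes along every line in a tangent direction, i.e. the density increment sums to zero. -/
def IsCritical (y : Phase N) : Prop :=
  y.1 ∈ interiorSimplex N ∧ ∀ σ η : Fin N → ℝ, ∑ i, σ i = 0 →
    HasDerivAt (fun t : ℝ => sys.ham (y.1 + t • σ) (y.2 + t • η)) 0 0

/-- The constant `M`: the initial energy minus the minimum of the total potential over all
probability densities (closed simplex). -/
noncomputable def excessEnergy (y : Phase N) : ℝ :=
  sys.ham y.1 y.2 - sInf ((fun ρ => sys.linPot ρ + sys.intPot ρ) '' stdSimplex ℝ (Fin N))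

end WHSystem

/-- The symplectic form `∑ i, dρ i ∧ dS i` evaluated on two tangent vectors of phase space. -/
def sympForm {N : ℕ} (x y : Phase N) : ℝ := ∑ i, (x.1 i * y.2 i - y.1 i * x.2 i)

/-! ### Runge–Kutta methods -/

/-- The coefficients of an `s`-stage (in general implicit) Runge–Kutta method. -/
structure RKMethod (s : ℕ) where
  a : Fin s → Fin s → ℝ
  b : Fin s → ℝ

namespace RKMethod

variable {s : ℕ} (m : RKMethod s)

/-- The symplecticity condition on the coefficients. -/
def IsSymplectic : Prop := ∀ i j, m.b i * m.a i j + m.b j * m.a j i = m.b i * m.b j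

section
variable {E : Type*} [AddCommGroup E] [Module ℝ E]

/-- `Y` is a system of internal stages, with values in the set `D`, for a step of size `τ` of the
method applied to `y' = f y`, starting at `y₀`. -/
def IsStages (f : E → E) (D : Set E) (τ : ℝ) (y₀ : E) (Y : Fin s → E) : Prop :=
  ∀ i, Y i ∈ D ∧ Y i = y₀ + τ • ∑ j, m.a i j • f (Y j)

/-- The value after one step, computed from the stages. -/
def update (f : E → E) (τ : ℝ) (y₀ : E) (Y : Fin s → E) : E :=
  y₀ + τ • ∑ j, m.b j • f (Y j)

/-- `y₁` is obtained from `y₀` by one step of size `τ`, with internal stages in `D`. -/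
def IsStep (f : E → E) (D : Set E) (τ : ℝ) (y₀ y₁ : E) : Prop :=
  ∃ Y : Fin s → E, m.IsStages f D τ y₀ Y ∧ y₁ = m.update f τ y₀ Y

/-- The method is symmetric (for the given equation): exchanging `y₀ ↔ y₁` and `τ ↔ -τ` leaves the
scheme unaltered, i.e. the step of size `-τ` inverts the step of size `τ`. -/
def IsSymmetric (f : E → E) (D : Set E) : Prop :=
  ∀ (τ : ℝ) (y₀ y₁ : E), m.IsStep f D τ y₀ y₁ ↔ m.IsStep f D (-τ) y₁ y₀

end

/-- The method has order (at least) `r`: for every smooth ordinary differential equation on an open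
subset of a finite-dimensional space, the local error is `O(τ ^ (r + 1))`.  The numerical value is
computed from any stages that tend to the initial value as `τ → 0`. -/
def HasOrder (r : ℕ) : Prop :=
  ∀ (E : Type) [NormedAddCommGroup E] [NormedSpace ℝ E] [FiniteDimensional ℝ E]
    (U : Set E) (f : E → E), IsOpen U → ContDiffOn ℝ ∞ f U → ∀ y₀ ∈ U,
    ∀ y : ℝ → E, y 0 = y₀ → (∀ᶠ t in 𝓝 (0 : ℝ), HasDerivAt y (f (y t)) t) →
    ∀ Y : ℝ → Fin s → E, (∀ᶠ τ in 𝓝 (0 : ℝ), m.IsStages f U τ y₀ (Y τ)) →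
      Filter.Tendsto Y (𝓝 0) (𝓝 (fun _ => y₀)) →
      (fun τ => m.update f τ y₀ (Y τ) - y τ) =O[𝓝 (0 : ℝ)] (fun τ => τ ^ (r + 1))

/-- One step of the method for the Wasserstein–Hamiltonian system; the internal stages have positive
densities. -/
def Step {N : ℕ} (sys : WHSystem N) (τ : ℝ) (y₀ y₁ : Phase N) : Prop :=
  m.IsStep sys.field (positivePhase N) τ y₀ y₁

/-- One step of the method for the Wasserstein–Hamiltonian system, whose internal stages have positive
densities and lie within distance `δ` of the starting value `y₀`. -/
def StepNear {N : ℕ} (sys : WHSystem N) (δ τ : ℝ) (y₀ y₁ : Phase N) : Prop :=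
  m.IsStep sys.field (positivePhase N ∩ Metric.closedBall y₀ δ) τ y₀ y₁

end RKMethod

/-- The candidate stationary solution: density `ρ` and potential `-v n τ` on all nodes. -/
def stationaryState {N : ℕ} (ρ : Fin N → ℝ) (v τ : ℝ) (n : ℕ) : Phase N :=
  (ρ, fun _ => -(v * n * τ))

/-! Items 1–5 rest on the symmetries of the energy, which is unchanged by adding a constant to `S`
(the gauge) and by `S ↦ -S`. In the symplectic structure `symplJ`, the total mass generates the
gauge (`symplJ_massFun`, `massFun_symplJ`), so gauge invariance of the energy makes mass a linear
invariant of the vector field, and Runge–Kutta methods conserve linear invariants. They also commute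
with affine symmetries, which gives reversibility and gauge invariance of the scheme. The symplectic
form is a bilinear invariant of the variational equation, and the condition on the coefficients
conserves such invariants (`IsSymplectic.bilin_eq`). By Euler's identity, the condition in item 5
says that the vector field at `(ρ, 0)` is the constant gauge direction of speed `-v`
(`WHSystem.stationary_iff`). The scheme then moves along this direction; conversely, a small step
whose displacement is pure gauge forces the field to be pure gauge (`exists_field_eq_of_step`).

Item 6 is backward error analysis to finite order. The step maps form a smooth family of symplectic
maps, equal to the identity at step size zero, so their pullback `σ` is a Poisson endomorphism of
the smooth functions on time × phase space, congruent to the identity modulo the time `t`. Suppose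
`σ` agrees with `exp {·, h}` modulo `t ^ k`. The leading coefficient of the difference is a
derivation of both the product and the bracket, hence `{·, g}` for some `g`, and `h + t ^ k g` is
right to one more order (`exists_correction`). For `h = t H` an order `r` method gives agreement
modulo `t ^ (r + 1)`. Iteration yields `K = H + O(t ^ r)` with `σ K = K + O(t ^ (n + 1))`. With `n =
2r`, the at most `T₀ τ ^ (-r - 1)` steps change `K` by `O(τ ^ r)` in total, so no analyticity and no
exponentially small remainder is needed.

The constants must be uniform although phase space is not compact. The excess energy bounds the
kinetic energy and the Fisher information. Since the graph is connected, the Fisher information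
keeps densities away from zero, and then the kinetic energy bounds the oscillation of `S`. Only the
gauge direction stays unbounded. All corrections Poisson-commute with the mass, so `K` is gauge
invariant and bounds on a compact slice suffice. An induction on the steps closes the argument: the
energy drift stays below `β`, so the solution never leaves the region where the bounds hold and
where the Hamiltonian agrees with a globally defined, gauge invariant cut-off. -/

/-! ### Modified Hamiltonians: the algebraic part -/

/-- A commutative Poisson algebra over `ℝ` with a regular Casimir element `t`, an evaluation `ev` at
`t = 0`, and a Poisson endomorphism `σ` that is the identity modulo `t`.  Every Poisson derivation of the
functions independent of `t` is assumed to be Hamiltonian. -/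
structure PoissonDeformation (B : Type*) [CommRing B] [Algebra ℝ B] where
  br : B →ₗ[ℝ] B →ₗ[ℝ] B
  t : B
  ev : B →ₐ[ℝ] B
  σ : B →ₐ[ℝ] B
  br_skew : ∀ a b, br a b = -br b a
  br_mul : ∀ a b c, br (a * b) c = a * br b c + br a c * b
  br_jacobi : ∀ a b c, br (br a b) c = br (br a c) b + br a (br b c)
  br_t : ∀ c, br t c = 0
  ev_idem : ∀ a, ev (ev a) = ev a
  ev_br : ∀ a b, ev (br a b) = br (ev a) (ev b)
  ev_t : ev t = 0
  dvd_of_ev : ∀ a, ev a = 0 → t ∣ a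
  t_reg : ∀ a b, t * a = t * b → a = b
  σ_br : ∀ a b, σ (br a b) = br (σ a) (σ b)
  σ_t : σ t = t
  ev_σ : ∀ a, ev (σ a) = ev a
  hamiltonian : ∀ d : B →ₗ[ℝ] B, (∀ a, ev (d a) = d a) →
    (∀ a b, ev a = a → ev b = b → d (a * b) = a * d b + d a * b) →
    (∀ a b, ev a = a → ev b = b → d (br a b) = br a (d b) + br (d a) b) →
    ∃ h, ev h = h ∧ ∀ a, ev a = a → d a = br a h

/-- The `n`-th divided power of a derivation of a bilinear operation satisfies the Leibniz formula. -/
theorem dividedPower_leibniz {B : Type*} [AddCommGroup B] [Module ℝ B] (P : B →ₗ[ℝ] B →ₗ[ℝ] B)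
    (D : B →ₗ[ℝ] B) (hD : ∀ a b, D (P a b) = P a (D b) + P (D a) b) (n : ℕ) (a b : B) :
    ((n.factorial : ℝ)⁻¹ • (D ^ n)) (P a b) = ∑ p ∈ Finset.HasAntidiagonal.antidiagonal n,
      P (((p.1.factorial : ℝ)⁻¹ • (D ^ p.1)) a) (((p.2.factorial : ℝ)⁻¹ • (D ^ p.2)) b) := by
  have hs : ∀ (k : ℕ) (c : B), D (((k.factorial : ℝ)⁻¹ • (D ^ k)) c) =
      ((k + 1 : ℕ) : ℝ) • ((((k + 1).factorial : ℝ)⁻¹ • (D ^ (k + 1))) c) := by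
    intro k c
    have h1 : ((k + 1 : ℕ) : ℝ) ≠ 0 := by positivity
    have h2 : (k.factorial : ℝ) ≠ 0 := by positivity
    rw [LinearMap.smul_apply, LinearMap.smul_apply, smul_smul, map_smul, pow_succ', Nat.factorial_succ,
      Module.End.mul_apply]
    congr 1
    push_cast at h1 ⊢
    field_simp
  generalize hf : (fun (k : ℕ) => ((k.factorial : ℝ)⁻¹ • (D ^ k))) = f at *
  have hf' : ∀ k : ℕ, ((k.factorial : ℝ)⁻¹ • (D ^ k)) = f k := fun k => by rw [← hf]
  simp only [hf'] at hs ⊢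
  induction n with
  | zero => simp [← hf]
  | succ n ih =>
    have hn : ((n + 1 : ℕ) : ℝ) ≠ 0 := by positivity
    -- Proved after multiplication by `n + 1`: applying `D` to the formula for `n` gives each term
    -- with indices `i + j = n + 1` once with weight `j` and once with weight `i`.
    have key : ((n + 1 : ℕ) : ℝ) • f (n + 1) (P a b) = ((n + 1 : ℕ) : ℝ) •
        ∑ p ∈ Finset.HasAntidiagonal.antidiagonal (n + 1), P (f p.1 a) (f p.2 b) := by
      rw [← hs, ih, map_sum]
      simp only [hD, hs, Finset.sum_add_distrib]
      have e : ((n + 1 : ℕ) : ℝ) • ∑ p ∈ Finset.HasAntidiagonal.antidiagonal (n + 1), P (f p.1 a) (f p.2 b) =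
          ∑ p ∈ Finset.HasAntidiagonal.antidiagonal (n + 1), (p.2 : ℝ) • P (f p.1 a) (f p.2 b) +
          ∑ p ∈ Finset.HasAntidiagonal.antidiagonal (n + 1), (p.1 : ℝ) • P (f p.1 a) (f p.2 b) := by
        rw [Finset.smul_sum, ← Finset.sum_add_distrib]
        refine Finset.sum_congr rfl fun p hp => ?_
        rw [← add_smul, ← Finset.HasAntidiagonal.mem_antidiagonal.mp hp]
        push_cast
        ring_nf
      rw [e, Finset.Nat.sum_antidiagonal_succ' (n := n) (f := fun p => (p.2 : ℝ) • P (f p.1 a) (f p.2 b)),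
        Finset.Nat.sum_antidiagonal_succ (n := n) (f := fun p => (p.1 : ℝ) • P (f p.1 a) (f p.2 b))]
      simp
    exact smul_right_injective B hn key

namespace PoissonDeformation

variable {B : Type*} [CommRing B] [Algebra ℝ B] (X : PoissonDeformation B)

/-- The exponential series of `{·, h}`, truncated after the `n`-th term. -/
noncomputable def expTrunc (n : ℕ) (h : B) : B →ₗ[ℝ] B :=
  ∑ j ∈ Finset.range (n + 1), ((j.factorial : ℝ)⁻¹ • (X.br.flip h) ^ j)

theorem br_mul_right (a b c : B) : X.br a (b * c) = b * X.br a c + X.br a b * c := by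
  rw [X.br_skew, X.br_mul, X.br_skew c a, X.br_skew b a]; ring

theorem br_t_right (a : B) : X.br a X.t = 0 := by rw [X.br_skew, X.br_t, neg_zero]

theorem br_tmul (a c : B) : X.br (X.t * a) c = X.t * X.br a c := by
  rw [X.br_mul, X.br_t]; ring

theorem br_tmul_right (a c : B) : X.br a (X.t * c) = X.t * X.br a c := by
  rw [X.br_mul_right, X.br_t_right]; ring

theorem br_self (a : B) : X.br a a = 0 := by
  have h := X.br_skew a a
  have h2 : (2 : ℝ) • X.br a a = 0 := by rw [two_smul]; nth_rw 1 [h]; simp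
  exact (smul_eq_zero.mp h2).resolve_left two_ne_zero

theorem tpow_reg (k : ℕ) (a b : B) (h : X.t ^ k * a = X.t ^ k * b) : a = b := by
  induction k with
  | zero => simpa using h
  | succ k ih => exact ih (X.t_reg _ _ (by rw [← mul_assoc, ← mul_assoc, ← pow_succ', h]))

theorem mapTpow (P : B →ₗ[ℝ] B) (hP : ∀ a, P (X.t * a) = X.t * P a) (k : ℕ) (a : B) :
    P (X.t ^ k * a) = X.t ^ k * P a := by
  induction k with
  | zero => simp
  | succ k ih => rw [pow_succ', mul_assoc, hP, ih, mul_assoc]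

theorem br_tpow (k : ℕ) (a c : B) : X.br (X.t ^ k * a) c = X.t ^ k * X.br a c :=
  X.mapTpow (X.br.flip c) (fun a => X.br_tmul a c) k a

theorem br_tpow_right (k : ℕ) (a c : B) : X.br a (X.t ^ k * c) = X.t ^ k * X.br a c :=
  X.mapTpow (X.br a) (fun c => X.br_tmul_right a c) k c

theorem dvd_ad {h : B} (hh : X.t ∣ h) (b : B) : X.t ∣ X.br.flip h b := by
  obtain ⟨c, rfl⟩ := hh
  exact ⟨X.br b c, by rw [LinearMap.flip_apply, X.br_tmul_right]⟩

/-- Since `t` is a Casimir element, every bracket with a multiple of `t` contributes a factor `t`.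
The exponential series thus converges `t`-adically, and truncating after the `n`-th term costs `t ^
(n + 1)`. -/
theorem ad_pow_dvd {h : B} (hh : X.t ∣ h) (j : ℕ) (b : B) : X.t ^ j ∣ ((X.br.flip h) ^ j) b := by
  induction j with
  | zero => simp
  | succ j ih =>
    obtain ⟨c, hc⟩ := ih
    rw [pow_succ' (X.br.flip h), Module.End.mul_apply, hc, LinearMap.flip_apply, X.br_tpow, pow_succ]
    exact mul_dvd_mul_left _ (X.dvd_ad hh c)

theorem ad_mul (h a b : B) :
    X.br.flip h (a * b) = a * X.br.flip h b + X.br.flip h a * b := by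
  simp only [LinearMap.flip_apply, X.br_mul]

theorem ad_br (h a b : B) :
    X.br.flip h (X.br a b) = X.br a (X.br.flip h b) + X.br (X.br.flip h a) b := by
  simp only [LinearMap.flip_apply]; rw [X.br_jacobi, add_comm]

theorem expTrunc_apply (n : ℕ) (h b : B) : X.expTrunc n h b =
    ∑ j ∈ Finset.range (n + 1), ((j.factorial : ℝ)⁻¹ • (X.br.flip h) ^ j) b := by
  simp [expTrunc]

theorem expTrunc_of_br_eq_zero (n : ℕ) {h b : B} (hb : X.br b h = 0) : X.expTrunc n h b = b := by
  rw [expTrunc_apply, Finset.sum_range_succ', Finset.sum_eq_zero]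
  · simp
  · intro j _
    rw [LinearMap.smul_apply, pow_succ, Module.End.mul_apply, LinearMap.flip_apply, hb]; simp

theorem dvd_expTrunc_sub (n : ℕ) {h : B} (hh : X.t ∣ h) (b : B) : X.t ∣ X.expTrunc n h b - b := by
  rw [expTrunc_apply, Finset.sum_range_succ']
  simp only [Nat.factorial_zero, Nat.cast_one, inv_one, pow_zero, one_smul, Module.End.one_apply,
    add_sub_cancel_right]
  refine Finset.dvd_sum fun j _ => ?_
  rw [LinearMap.smul_apply]
  exact (Dvd.dvd.trans (dvd_pow_self _ (Nat.succ_ne_zero j)) (X.ad_pow_dvd hh (j + 1) b)).trans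
    ⟨algebraMap ℝ B (((j + 1).factorial : ℝ)⁻¹), by rw [Algebra.smul_def, mul_comm]⟩

theorem dvd_smul_of_dvd {a b : B} (h : a ∣ b) (c : ℝ) : a ∣ c • b := by
  rw [Algebra.smul_def]; exact h.mul_left _

theorem expTrunc_tmul (n : ℕ) (h b : B) : X.expTrunc n h (X.t * b) = X.t * X.expTrunc n h b := by
  rw [expTrunc_apply, expTrunc_apply, Finset.mul_sum]
  refine Finset.sum_congr rfl fun j _ => ?_
  rw [LinearMap.smul_apply, LinearMap.smul_apply, mul_smul_comm]
  congr 1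
  clear * -
  induction j with
  | zero => simp
  | succ j ih => rw [pow_succ', Module.End.mul_apply, ih, Module.End.mul_apply, LinearMap.flip_apply,
      LinearMap.flip_apply, X.br_tmul]

/-- A truncated exponential is compatible with each bilinear operation of which `{·, h}` is a
derivation, up to the truncation order. -/
theorem dvd_expTrunc_bilin (P : B →ₗ[ℝ] B →ₗ[ℝ] B) (hP1 : ∀ a b, P (X.t * a) b = X.t * P a b)
    (hP2 : ∀ a b, P a (X.t * b) = X.t * P a b) (n : ℕ) {h : B} (hh : X.t ∣ h)
    (hD : ∀ a b, X.br.flip h (P a b) = P a (X.br.flip h b) + P (X.br.flip h a) b) (a b : B) :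
    X.t ^ (n + 1) ∣ X.expTrunc n h (P a b) - P (X.expTrunc n h a) (X.expTrunc n h b) := by
  set f : ℕ → B →ₗ[ℝ] B := fun j => ((j.factorial : ℝ)⁻¹ • (X.br.flip h) ^ j) with hf
  have hdvd : ∀ j c, X.t ^ j ∣ f j c := fun j c => by
    rw [hf]; exact dvd_smul_of_dvd (X.ad_pow_dvd hh j c) _
  have hPd : ∀ i j c d, X.t ^ i ∣ c → X.t ^ j ∣ d → X.t ^ (i + j) ∣ P c d := by
    rintro i j _ _ ⟨c, rfl⟩ ⟨d, rfl⟩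
    have h1 := X.mapTpow (P.flip (X.t ^ j * d)) (fun a => hP1 a _) i c
    rw [LinearMap.flip_apply, LinearMap.flip_apply] at h1
    rw [h1, X.mapTpow (P c) (hP2 c) j d, ← mul_assoc, ← pow_add]
    exact dvd_mul_right _ _
  have e1 : P (X.expTrunc n h a) (X.expTrunc n h b) =
      ∑ p ∈ Finset.range (n + 1) ×ˢ Finset.range (n + 1), P (f p.1 a) (f p.2 b) := by
    rw [expTrunc_apply, expTrunc_apply, map_sum P, LinearMap.sum_apply, Finset.sum_product]
    exact Finset.sum_congr rfl fun i _ => by rw [map_sum]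
  -- The Leibniz formula identifies the left side with the terms of total degree at most `n` in the
  -- product of the two series; each remaining term carries `t` to its total degree.
  have e2 : X.expTrunc n h (P a b) =
      ∑ p ∈ (Finset.range (n + 1) ×ˢ Finset.range (n + 1)).filter (fun p => p.1 + p.2 < n + 1),
        P (f p.1 a) (f p.2 b) := by
    rw [expTrunc_apply, ← Finset.sum_fiberwise_of_maps_to (t := Finset.range (n + 1))
      (g := fun p : ℕ × ℕ => p.1 + p.2) (by simp)]
    refine Finset.sum_congr rfl fun j hj => ?_
    rw [dividedPower_leibniz P _ hD]
    refine Finset.sum_congr ?_ fun _ _ => rfl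
    ext p
    simp only [Finset.HasAntidiagonal.mem_antidiagonal, Finset.mem_filter, Finset.mem_product, Finset.mem_range] at hj ⊢
    omega
  rw [e1, e2, ← Finset.sum_filter_add_sum_filter_not (Finset.range (n + 1) ×ˢ Finset.range (n + 1))
    (fun p => p.1 + p.2 < n + 1) (fun p => P (f p.1 a) (f p.2 b)), sub_add_cancel_left, dvd_neg]
  refine Finset.dvd_sum fun p hp => ?_
  simp only [Finset.mem_filter, not_lt] at hp
  exact (pow_dvd_pow _ hp.2).trans (hPd _ _ _ _ (hdvd _ _) (hdvd _ _))

/-- The added term already has the factor `t ^ k`. In a power of exponent at least two it is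
accompanied by another bracket with a multiple of `t`, so only the first power notices it modulo `t
^ (k + 1)`. -/
theorem ad_add_pow {h : B} (hh : X.t ∣ h) (g : B) {k : ℕ} (hk : 1 ≤ k) (j : ℕ) (b : B) :
    X.t ^ (k + 1) ∣ ((X.br.flip (h + X.t ^ k * g)) ^ (j + 1)) b - ((X.br.flip h) ^ (j + 1)) b -
      (if j = 0 then X.t ^ k * X.br b g else 0) := by
  have e : ∀ x, X.br.flip (h + X.t ^ k * g) x = X.br.flip h x + X.t ^ k * X.br x g := by
    intro x; simp [X.br_tpow_right]
  have hh' : X.t ∣ h + X.t ^ k * g := dvd_add hh ((dvd_pow_self _ (by omega)).mul_right _)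
  induction j with
  | zero => simp [X.br_tpow_right]
  | succ j ih =>
    obtain ⟨c, hc⟩ := ih
    have hw : ∃ w, ((X.br.flip (h + X.t ^ k * g)) ^ (j + 1)) b =
        ((X.br.flip h) ^ (j + 1)) b + X.t ^ k * w := by
      split_ifs at hc with h0
      · exact ⟨X.br b g + X.t * c, by linear_combination hc⟩
      · exact ⟨X.t * c, by linear_combination hc⟩
    obtain ⟨w, hw⟩ := hw
    obtain ⟨u, hu⟩ := X.ad_pow_dvd hh (j + 1) b
    obtain ⟨z, hz⟩ := X.dvd_ad hh' w
    rw [if_neg (Nat.succ_ne_zero j), sub_zero, pow_succ' _ (j + 1), Module.End.mul_apply, hw, map_add,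
      pow_succ' (X.br.flip h) (j + 1), Module.End.mul_apply, e]
    have e3 : X.br.flip (h + X.t ^ k * g) (X.t ^ k * w) = X.t ^ k * (X.t * z) := by
      rw [LinearMap.flip_apply, X.br_tpow, ← LinearMap.flip_apply X.br, hz]
    have e4 : X.br (((X.br.flip h) ^ (j + 1)) b) g = X.t ^ (j + 1) * X.br u g := by
      rw [hu, X.br_tpow]
    rw [e3, e4]
    exact ⟨X.t ^ j * X.br u g + z, by ring⟩

theorem expTrunc_add {h : B} (hh : X.t ∣ h) (g : B) {k n : ℕ} (hk : 1 ≤ k) (hn : 1 ≤ n) (b : B) :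
    X.t ^ (k + 1) ∣ X.expTrunc n (h + X.t ^ k * g) b - X.expTrunc n h b - X.t ^ k * X.br b g := by
  obtain ⟨n, rfl⟩ : ∃ m, n = m + 1 := ⟨n - 1, by omega⟩
  have : X.expTrunc (n + 1) (h + X.t ^ k * g) b - X.expTrunc (n + 1) h b - X.t ^ k * X.br b g =
      ∑ j ∈ Finset.range (n + 1), (((j + 1).factorial : ℝ)⁻¹ •
        (((X.br.flip (h + X.t ^ k * g)) ^ (j + 1)) b - ((X.br.flip h) ^ (j + 1)) b -
          (if j = 0 then X.t ^ k * X.br b g else 0))) := by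
    simp only [smul_sub, Finset.sum_sub_distrib, expTrunc_apply]
    rw [Finset.sum_range_succ' _ (n + 1), Finset.sum_range_succ' _ (n + 1)]
    simp
  rw [this]
  exact Finset.dvd_sum fun j _ => dvd_smul_of_dvd (X.ad_add_pow hh g hk j b) _

theorem dvd_sub_ev (a : B) : X.t ∣ a - X.ev a :=
  X.dvd_of_ev _ (by rw [map_sub, X.ev_idem, sub_self])

theorem ev_eq_of_dvd {a b : B} (h : X.t ∣ a - b) : X.ev a = X.ev b := by
  obtain ⟨c, hc⟩ := h
  rw [← sub_eq_zero, ← map_sub, hc, map_mul, X.ev_t, zero_mul]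

/-- Write `b = ev b + t c`. Both maps commute with multiplication by `t`, so agreement modulo `t ^
j` on `c` becomes agreement modulo `t ^ (j + 1)` on `t c`. -/
theorem dvd_extend {k n : ℕ} {h : B}
    (S : ∀ b, X.ev b = b → X.t ^ k ∣ X.σ b - X.expTrunc n h b) (b : B) :
    X.t ^ k ∣ X.σ b - X.expTrunc n h b := by
  have : ∀ j ≤ k, ∀ b, X.t ^ j ∣ X.σ b - X.expTrunc n h b := by
    intro j
    induction j with
    | zero => simp
    | succ j ih =>
      intro hj b
      obtain ⟨c, hc⟩ := X.dvd_sub_ev b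
      have hb : b = X.ev b + X.t * c := by rw [← hc]; ring
      have h1 := (pow_dvd_pow X.t hj).trans (S (X.ev b) (X.ev_idem _))
      rw [hb, map_add, map_add, map_mul, X.σ_t, expTrunc_tmul]
      have h2 := mul_dvd_mul_left X.t (ih (by omega) c)
      rw [← pow_succ'] at h2
      convert dvd_add h1 h2 using 1
      ring
  exact this k le_rfl b

/-- If `σ` agrees with `exp {·, h}` modulo `t ^ k`, then `h` can be corrected by a multiple of `t ^ k` so
that they agree modulo `t ^ (k + 1)`; conserved quantities of both are kept. -/
theorem exists_correction {k n : ℕ} (hk : 1 ≤ k) (hkn : k ≤ n) {h : B} (hh : X.t ∣ h)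
    (S : ∀ b, X.t ^ k ∣ X.σ b - X.expTrunc n h b) {m : B} (hm : X.ev m = m) (hσ : X.σ m = m)
    (hmh : X.br m h = 0) :
    ∃ g, X.br m g = 0 ∧ ∀ b, X.t ^ (k + 1) ∣ X.σ b - X.expTrunc n (h + X.t ^ k * g) b := by
  choose G hG using S
  have hadd : ∀ a b, G (a + b) = G a + G b := fun a b => X.tpow_reg k _ _ (by
    rw [mul_add, ← hG, ← hG, ← hG, map_add, map_add]; ring)
  have hsmul : ∀ (c : ℝ) a, G (c • a) = c • G a := fun c a => X.tpow_reg k _ _ (by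
    rw [mul_smul_comm, ← hG, ← hG, map_smul, map_smul, smul_sub])
  have hevE : ∀ a, X.ev (X.expTrunc n h a) = X.ev a := fun a => X.ev_eq_of_dvd (X.dvd_expTrunc_sub n hh a)
  -- One argument for the product and for the bracket: for either operation `P`, the leading error
  -- `ev ∘ G` is a derivation on time-independent elements.
  have hbil : ∀ P : B →ₗ[ℝ] B →ₗ[ℝ] B, (∀ a b, P (X.t * a) b = X.t * P a b) →
      (∀ a b, P a (X.t * b) = X.t * P a b) →
      (∀ a b, X.br.flip h (P a b) = P a (X.br.flip h b) + P (X.br.flip h a) b) →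
      (∀ a b, X.σ (P a b) = P (X.σ a) (X.σ b)) → (∀ a b, X.ev (P a b) = P (X.ev a) (X.ev b)) →
      ∀ a b, X.ev a = a → X.ev b = b → X.ev (G (P a b)) = P a (X.ev (G b)) + P (X.ev (G a)) b := by
    intro P hP1 hP2 hD hs he a b ha hb
    obtain ⟨c, hc⟩ := X.dvd_expTrunc_bilin P hP1 hP2 n hh hD a b
    -- Telescoping of `σ a · σ b - exp a · exp b`, divided by `t ^ k`. As `k ≤ n`, the truncation
    -- error `t ^ (n + 1)` keeps a factor `t` and disappears under `ev`, which also turns `σ` and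
    -- the exponential into the identity.
    have key : G (P a b) = P (X.expTrunc n h a) (G b) + P (G a) (X.σ b) - X.t * (X.t ^ (n - k) * c) := by
      refine X.tpow_reg k _ _ ?_
      have e1 : X.t ^ k * P (X.expTrunc n h a) (G b) = P (X.expTrunc n h a) (X.σ b - X.expTrunc n h b) := by
        rw [hG, X.mapTpow _ (hP2 _)]
      have e2 : X.t ^ k * P (G a) (X.σ b) = P (X.σ a - X.expTrunc n h a) (X.σ b) := by
        rw [hG]
        exact (X.mapTpow (P.flip (X.σ b)) (fun a => hP1 a _) k (G a)).symm
      have e3 : X.t ^ (n + 1) = X.t ^ k * (X.t * X.t ^ (n - k)) := by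
        rw [← pow_succ', ← pow_add]; congr 1; omega
      rw [mul_sub, mul_add, e1, e2, ← hG, hs, map_sub, map_sub, LinearMap.sub_apply]
      rw [e3] at hc
      linear_combination (-1 : B) * hc
    rw [key, map_sub, map_add, map_mul, X.ev_t, zero_mul, sub_zero, he, he, hevE, X.ev_σ, ha, hb]
  let d : B →ₗ[ℝ] B :=
    { toFun := fun b => X.ev (G b)
      map_add' := fun a b => by rw [hadd, map_add]
      map_smul' := fun c a => by rw [hsmul, map_smul, RingHom.id_apply] }
  obtain ⟨g, hg, hdg⟩ := X.hamiltonian d (fun a => X.ev_idem _)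
    (hbil (LinearMap.mul ℝ B) (fun a b => by simp [mul_assoc]) (fun a b => by simp [mul_left_comm])
      (fun a b => X.ad_mul h a b) (fun a b => by simp) (fun a b => by simp))
    (hbil X.br X.br_tmul X.br_tmul_right (X.ad_br h) X.σ_br X.ev_br)
  -- Both maps fix `m`, so their difference has no leading coefficient at `m`, and the new
  -- correction commutes with `m`.
  have hG0 : G m = 0 := X.tpow_reg k _ _ (by
    rw [← hG, hσ, X.expTrunc_of_br_eq_zero n hmh]; ring)
  refine ⟨g, ?_, fun b => ?_⟩
  · rw [← hdg m hm]
    change X.ev (G m) = 0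
    rw [hG0, map_zero]
  · have h1 := X.expTrunc_add hh g hk (hk.trans hkn) b
    have hdb : X.ev (G b) = X.br (X.ev b) g := by
      rw [← hdg _ (X.ev_idem b)]
      obtain ⟨c, hc⟩ := X.dvd_sub_ev b
      have hb : b = X.ev b + X.t * c := by rw [← hc]; ring
      have hGt : G (X.t * c) = X.t * G c := X.tpow_reg k _ _ (by
        rw [mul_left_comm, ← hG, ← hG, map_mul, X.σ_t, expTrunc_tmul]; ring)
      change X.ev (G b) = X.ev (G (X.ev b))
      conv_lhs => rw [hb]
      rw [hadd, hGt, map_add, map_mul, X.ev_t, zero_mul, add_zero]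
    have h2 : X.t ^ (k + 1) ∣ X.t ^ k * (G b - X.br b g) := by
      rw [pow_succ]
      refine mul_dvd_mul_left _ (X.dvd_of_ev _ ?_)
      rw [map_sub, X.ev_br, hg, hdb, sub_self]
    convert dvd_sub h2 h1 using 1
    linear_combination hG b

/-- **Existence of a modified Hamiltonian.**  If `σ` agrees with `exp {·, t H}` modulo `t ^ (r + 1)`, then
there is a perturbation of `H` of size `t ^ r` that is invariant under `σ` modulo `t ^ (n + 1)`. -/
theorem exists_modified_hamiltonian {r n : ℕ} (hrn : r ≤ n) {H m : B}
    (hm : X.ev m = m) (hσ : X.σ m = m) (hmH : X.br m H = 0)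
    (S : ∀ b, X.ev b = b → X.t ^ (r + 1) ∣ X.σ b - X.expTrunc n (X.t * H) b) :
    ∃ K, X.t ^ r ∣ K - H ∧ X.br m K = 0 ∧ X.t ^ (n + 1) ∣ X.σ K - K := by
  have main : ∀ k, r + 1 ≤ k → k ≤ n + 1 → ∃ K, X.t ^ r ∣ K - H ∧ X.br m K = 0 ∧
      ∀ b, X.t ^ k ∣ X.σ b - X.expTrunc n (X.t * K) b := by
    intro k hk
    induction k, hk using Nat.le_induction with
    | base => exact fun _ => ⟨H, by simp, hmH, X.dvd_extend S⟩
    | succ k hk ih =>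
      intro hkn
      obtain ⟨K, hK, hmK, SK⟩ := ih (by omega)
      obtain ⟨g, hmg, hg⟩ := X.exists_correction (by omega) (by omega : k ≤ n) (dvd_mul_right _ _) SK hm hσ
        (by rw [X.br_tmul_right, hmK, mul_zero])
      have e : X.t * K + X.t ^ k * g = X.t * (K + X.t ^ (k - 1) * g) := by
        rw [mul_add, ← mul_assoc, ← pow_succ', Nat.sub_add_cancel (by omega)]
      rw [e] at hg
      refine ⟨_, ?_, ?_, hg⟩
      · rw [add_sub_right_comm]
        exact dvd_add hK ((pow_dvd_pow _ (by omega)).mul_right _)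
      · rw [map_add, X.br_tpow_right, hmK, hmg]; simp
  obtain ⟨K, hK, hmK, SK⟩ := main (n + 1) (by omega) le_rfl
  -- `K` commutes with `t K`, so the truncated exponential fixes `K`.
  refine ⟨K, hK, hmK, ?_⟩
  have := SK K
  rwa [X.expTrunc_of_br_eq_zero n (by rw [X.br_tmul_right, X.br_self, mul_zero])] at this

end PoissonDeformation

/-! ### Smooth functions: parametric integrals, Hadamard's lemma, Poisson brackets -/

section Hadamard

theorem hasFDerivAt_parametric_integral {F V : Type} [NormedAddCommGroup F] [NormedSpace ℝ F]
    [FiniteDimensional ℝ F] [NormedAddCommGroup V] [NormedSpace ℝ V]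
    {G : F × ℝ → V} (hG : ContDiff ℝ 1 G) (x : F) :
    HasFDerivAt (fun x => ∫ s in (0 : ℝ)..1, G (x, s))
      (∫ s in (0 : ℝ)..1, (fderiv ℝ G (x, s)).comp (ContinuousLinearMap.inl ℝ F ℝ)) x := by
  have hc : Continuous fun p : F × ℝ => (fderiv ℝ G p).comp (ContinuousLinearMap.inl ℝ F ℝ) :=
    (hG.continuous_fderiv one_ne_zero).clm_comp continuous_const
  obtain ⟨C, hC⟩ := ((isCompact_closedBall x 1).prod (isCompact_Icc (a := (0 : ℝ)) (b := 1))).exists_bound_of_continuousOn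
    hc.continuousOn
  have hcx : ∀ y, Continuous fun s : ℝ => (fderiv ℝ G (y, s)).comp (ContinuousLinearMap.inl ℝ F ℝ) :=
    fun y => hc.comp (by fun_prop)
  have hGx : ∀ y, Continuous fun s : ℝ => G (y, s) := fun y => hG.continuous.comp (by fun_prop)
  refine (intervalIntegral.hasFDerivAt_integral_of_dominated_of_fderiv_le
    (F' := fun y s => (fderiv ℝ G (y, s)).comp (ContinuousLinearMap.inl ℝ F ℝ))
    (bound := fun _ => C) (Metric.closedBall_mem_nhds x one_pos) ?_ ?_ ?_ ?_ ?_ ?_)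
  · exact Filter.Eventually.of_forall fun y => (hGx y).aestronglyMeasurable
  · exact (hGx x).intervalIntegrable _ _
  · exact (hcx x).aestronglyMeasurable
  · refine Filter.Eventually.of_forall fun s hs y hy => hC (y, s) ⟨hy, ?_⟩
    rw [Set.uIoc_of_le zero_le_one] at hs
    exact ⟨hs.1.le, hs.2⟩
  · exact intervalIntegrable_const
  · refine Filter.Eventually.of_forall fun s _ y _ => ?_
    have h1 := (hG.differentiable one_ne_zero (y, s)).hasFDerivAt
    exact h1.comp y (hasFDerivAt_prodMk_left y s)

theorem contDiff_parametric_integral {F V : Type} [NormedAddCommGroup F] [NormedSpace ℝ F]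
    [FiniteDimensional ℝ F] [NormedAddCommGroup V] [NormedSpace ℝ V]
    {G : F × ℝ → V} (hG : ContDiff ℝ ∞ G) :
    ContDiff ℝ ∞ (fun x => ∫ s in (0 : ℝ)..1, G (x, s)) := by
  -- The codomain varies in the induction because the derivative is again a parametric integral,
  -- with operator values.
  have main : ∀ (n : ℕ) (V : Type) [NormedAddCommGroup V] [NormedSpace ℝ V] (G : F × ℝ → V),
      ContDiff ℝ ∞ G → ContDiff ℝ n (fun x => ∫ s in (0 : ℝ)..1, G (x, s)) := by
    intro n
    induction n with
    | zero =>
      intro V _ _ G hG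
      exact contDiff_zero.mpr (Differentiable.continuous (𝕜 := ℝ) fun x =>
        (hasFDerivAt_parametric_integral (hG.of_le (by simp)) x).differentiableAt)
    | succ n ih =>
      intro V _ _ G hG
      have hd := hasFDerivAt_parametric_integral (hG.of_le (by simp))
      push_cast
      refine contDiff_succ_iff_fderiv.mpr ⟨fun x => (hd x).differentiableAt, by simp, ?_⟩
      rw [funext fun x => (hd x).fderiv]
      exact ih _ (fun p => (fderiv ℝ G p).comp (ContinuousLinearMap.inl ℝ F ℝ))
        ((hG.fderiv_right (m := ∞) (by simp)).clm_comp contDiff_const)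
  exact contDiff_infty.mpr fun n => main n V G hG

/-- **Hadamard's lemma**, for the difference of the values at a point and at a base point. -/
theorem hadamard_lemma {F : Type} [NormedAddCommGroup F] [NormedSpace ℝ F] [FiniteDimensional ℝ F]
    {g : F → ℝ} {p : F → F} (hg : ContDiff ℝ ∞ g) (hp : ContDiff ℝ ∞ p) :
    ∃ Q : F → F →L[ℝ] ℝ, ContDiff ℝ ∞ Q ∧ ∀ x, g x - g (p x) = Q x (x - p x) := by
  have hd : ContDiff ℝ ∞ (fderiv ℝ g) := hg.fderiv_right (by simp)
  have hS : ContDiff ℝ ∞ fun q : F × ℝ => fderiv ℝ g (p q.1 + q.2 • (q.1 - p q.1)) := by fun_prop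
  refine ⟨fun x => ∫ s in (0 : ℝ)..1, fderiv ℝ g (p x + s • (x - p x)),
    contDiff_parametric_integral hS, fun x => ?_⟩
  have hc : Continuous fun s : ℝ => fderiv ℝ g (p x + s • (x - p x)) :=
    hS.continuous.comp (f := fun s : ℝ => (x, s)) (by fun_prop)
  rw [ContinuousLinearMap.intervalIntegral_apply (hc.intervalIntegrable _ _)]
  have hder : ∀ s ∈ Set.uIcc (0 : ℝ) 1, HasDerivAt (fun s : ℝ => g (p x + s • (x - p x)))
      (fderiv ℝ g (p x + s • (x - p x)) (x - p x)) s := by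
    intro s _
    refine HasFDerivAt.comp_hasDerivAt (l := g) s (hg.differentiable (by simp) _).hasFDerivAt ?_
    simpa using ((hasDerivAt_id s).smul_const (x - p x)).const_add (p x)
  rw [intervalIntegral.integral_eq_sub_of_hasDerivAt hder
    ((hc.clm_apply continuous_const).intervalIntegrable _ _)]
  simp

end Hadamard

/-- The algebra of smooth functions. -/
def smoothFun (F : Type) [NormedAddCommGroup F] [NormedSpace ℝ F] : Subalgebra ℝ (F → ℝ) where
  carrier := {g | ContDiff ℝ ∞ g}
  mul_mem' := fun {_ _} (ha : ContDiff ℝ ∞ _) (hb : ContDiff ℝ ∞ _) => ha.mul hb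
  add_mem' := fun {_ _} (ha : ContDiff ℝ ∞ _) (hb : ContDiff ℝ ∞ _) => ha.add hb
  algebraMap_mem' := fun c => by
    change ContDiff ℝ ∞ (fun _ : F => c)
    exact contDiff_const

/-- The type of smooth functions. -/
abbrev SmoothFun (F : Type) [NormedAddCommGroup F] [NormedSpace ℝ F] : Type := smoothFun F

namespace SmoothFun

variable {F : Type} [NormedAddCommGroup F] [NormedSpace ℝ F]

theorem contDiff (g : SmoothFun F) : ContDiff ℝ ∞ (g : F → ℝ) := g.2

theorem differentiable (g : SmoothFun F) : Differentiable ℝ (g : F → ℝ) :=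
  g.contDiff.differentiable (by simp)

theorem contDiff_fderiv (g : SmoothFun F) : ContDiff ℝ ∞ (fderiv ℝ (g : F → ℝ)) :=
  g.contDiff.fderiv_right (by simp)

theorem fderiv_symm (g : SmoothFun F) (x u v : F) :
    fderiv ℝ (fderiv ℝ (g : F → ℝ)) x u v = fderiv ℝ (fderiv ℝ (g : F → ℝ)) x v u := by
  have : IsSymmSndFDerivAt ℝ (g : F → ℝ) x := by
    refine (g.contDiff.contDiffAt (x := x)).isSymmSndFDerivAt ?_
    rw [minSmoothness_of_isRCLikeNormedField]
    exact WithTop.coe_le_coe.mpr (le_top : (2 : ℕ∞) ≤ ⊤)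
  exact this u v

@[simp] theorem coe_add_apply (a b : SmoothFun F) (x : F) :
    ((a + b : SmoothFun F) : F → ℝ) x = (a : F → ℝ) x + (b : F → ℝ) x := rfl
@[simp] theorem coe_sub_apply (a b : SmoothFun F) (x : F) :
    ((a - b : SmoothFun F) : F → ℝ) x = (a : F → ℝ) x - (b : F → ℝ) x := rfl
@[simp] theorem coe_neg_apply (a : SmoothFun F) (x : F) :
    ((-a : SmoothFun F) : F → ℝ) x = -(a : F → ℝ) x := rfl
@[simp] theorem coe_mul_apply (a b : SmoothFun F) (x : F) :
    ((a * b : SmoothFun F) : F → ℝ) x = (a : F → ℝ) x * (b : F → ℝ) x := rfl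
@[simp] theorem coe_smul_apply (c : ℝ) (a : SmoothFun F) (x : F) :
    ((c • a : SmoothFun F) : F → ℝ) x = c * (a : F → ℝ) x := rfl
@[simp] theorem coe_zero_apply (x : F) : ((0 : SmoothFun F) : F → ℝ) x = 0 := rfl
@[simp] theorem coe_one_apply (x : F) : ((1 : SmoothFun F) : F → ℝ) x = 1 := rfl

theorem ext_apply {a b : SmoothFun F} (h : ∀ x, (a : F → ℝ) x = (b : F → ℝ) x) : a = b :=
  Subtype.ext (funext h)

theorem fderiv_coe_add (a b : SmoothFun F) (x : F) : fderiv ℝ ((a + b : SmoothFun F) : F → ℝ) x =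
    fderiv ℝ (a : F → ℝ) x + fderiv ℝ (b : F → ℝ) x :=
  fderiv_add (a.differentiable x) (b.differentiable x)

theorem fderiv_coe_smul (c : ℝ) (a : SmoothFun F) (x : F) : fderiv ℝ ((c • a : SmoothFun F) : F → ℝ) x =
    c • fderiv ℝ (a : F → ℝ) x :=
  fderiv_const_smul (a.differentiable x) c

theorem fderiv_coe_mul (a b : SmoothFun F) (x : F) : fderiv ℝ ((a * b : SmoothFun F) : F → ℝ) x =
    (a : F → ℝ) x • fderiv ℝ (b : F → ℝ) x + (b : F → ℝ) x • fderiv ℝ (a : F → ℝ) x :=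
  fderiv_mul (a.differentiable x) (b.differentiable x)

variable (T : (F →L[ℝ] ℝ) →L[ℝ] F)

/-- The bracket of smooth functions defined by a constant Poisson tensor. -/
noncomputable def bracket : SmoothFun F →ₗ[ℝ] SmoothFun F →ₗ[ℝ] SmoothFun F :=
  LinearMap.mk₂ ℝ
    (fun g h => ⟨fun x => fderiv ℝ (g : F → ℝ) x (T (fderiv ℝ (h : F → ℝ) x)),
      g.contDiff_fderiv.clm_apply (T.contDiff.comp h.contDiff_fderiv)⟩)
    (fun a b c => ext_apply fun x => by
      simp only [coe_add_apply, fderiv_coe_add, add_apply])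
    (fun r a b => ext_apply fun x => by
      simp only [coe_smul_apply, fderiv_coe_smul, smul_apply, smul_eq_mul])
    (fun a b c => ext_apply fun x => by
      simp only [coe_add_apply, fderiv_coe_add, map_add])
    (fun r a b => ext_apply fun x => by
      simp only [coe_smul_apply, fderiv_coe_smul, map_smul, smul_eq_mul])

@[simp] theorem bracket_apply (g h : SmoothFun F) (x : F) : (bracket T g h : F → ℝ) x =
    fderiv ℝ (g : F → ℝ) x (T (fderiv ℝ (h : F → ℝ) x)) := rfl

variable {T}

theorem bracket_skew (hT : ∀ α β : F →L[ℝ] ℝ, α (T β) = -β (T α))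
    (a b : SmoothFun F) : bracket T a b = -bracket T b a :=
  ext_apply fun x => by simp [hT (fderiv ℝ (a : F → ℝ) x)]

theorem fderiv_bracket (hT : ∀ α β : F →L[ℝ] ℝ, α (T β) = -β (T α))
    (g h : SmoothFun F) (x u : F) :
    fderiv ℝ (bracket T g h : F → ℝ) x u =
      fderiv ℝ (fderiv ℝ (g : F → ℝ)) x u (T (fderiv ℝ (h : F → ℝ) x)) -
      fderiv ℝ (fderiv ℝ (h : F → ℝ)) x u (T (fderiv ℝ (g : F → ℝ) x)) := by
  have hg := (g.contDiff_fderiv.differentiable (by simp) x).hasFDerivAt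
  have hh := (h.contDiff_fderiv.differentiable (by simp) x).hasFDerivAt
  have h1 := hg.clm_apply (T.hasFDerivAt.comp x hh)
  have h2 : fderiv ℝ (bracket T g h : F → ℝ) x = _ := h1.fderiv
  rw [h2]
  simp only [add_apply, ContinuousLinearMap.comp_apply,
    ContinuousLinearMap.flip_apply, Function.comp]
  rw [hT (fderiv ℝ (g : F → ℝ) x)]
  ring

/-- The Poisson tensor is constant, so every term is a second derivative evaluated on two
Hamiltonian vectors. The terms cancel in pairs by skewness and the symmetry of second derivatives.
-/
theorem bracket_jacobi (hT : ∀ α β : F →L[ℝ] ℝ, α (T β) = -β (T α))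
    (a b c : SmoothFun F) :
    bracket T (bracket T a b) c = bracket T (bracket T a c) b + bracket T a (bracket T b c) := by
  rw [bracket_skew hT a (bracket T b c)]
  refine ext_apply fun x => ?_
  simp only [coe_add_apply, coe_neg_apply, bracket_apply _ (bracket T _ _), fderiv_bracket hT]
  rw [a.fderiv_symm x (T (fderiv ℝ (b : F → ℝ) x)), b.fderiv_symm x (T (fderiv ℝ (a : F → ℝ) x)),
    c.fderiv_symm x (T (fderiv ℝ (b : F → ℝ) x))]
  ring

end SmoothFun

/-! ### Modified Hamiltonians of near-identity families of symplectic maps -/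

namespace SmoothFun

variable {F F' : Type} [NormedAddCommGroup F] [NormedSpace ℝ F] [NormedAddCommGroup F'] [NormedSpace ℝ F']

/-- Composition with a smooth map. -/
def pullback (Ψ : F → F') (hΨ : ContDiff ℝ ∞ Ψ) : SmoothFun F' →ₐ[ℝ] SmoothFun F where
  toFun g := ⟨fun x => (g : F' → ℝ) (Ψ x), g.contDiff.comp hΨ⟩
  map_one' := rfl
  map_mul' _ _ := rfl
  map_zero' := rfl
  map_add' _ _ := rfl
  commutes' _ := rfl

@[simp] theorem pullback_apply (Ψ : F → F') (hΨ : ContDiff ℝ ∞ Ψ) (g : SmoothFun F') (x : F) :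
    (pullback Ψ hΨ g : F → ℝ) x = (g : F' → ℝ) (Ψ x) := rfl

theorem fderiv_pullback (Ψ : F → F') (hΨ : ContDiff ℝ ∞ Ψ) (g : SmoothFun F') (x : F) :
    fderiv ℝ (pullback Ψ hΨ g : F → ℝ) x = (fderiv ℝ (g : F' → ℝ) (Ψ x)).comp (fderiv ℝ Ψ x) :=
  fderiv_comp x (g.differentiable _) (hΨ.differentiable (by simp) x)

theorem pullback_bracket (Ψ : F → F') (hΨ : ContDiff ℝ ∞ Ψ) (T : (F →L[ℝ] ℝ) →L[ℝ] F)
    (T' : (F' →L[ℝ] ℝ) →L[ℝ] F') (h : ∀ x β, fderiv ℝ Ψ x (T (β.comp (fderiv ℝ Ψ x))) = T' β)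
    (a b : SmoothFun F') :
    pullback Ψ hΨ (bracket T' a b) = bracket T (pullback Ψ hΨ a) (pullback Ψ hΨ b) := by
  refine ext_apply fun x => ?_
  rw [pullback_apply, bracket_apply, bracket_apply, fderiv_pullback, fderiv_pullback,
    ContinuousLinearMap.comp_apply, h]

end SmoothFun

section TimeDependent

variable {E : Type} [NormedAddCommGroup E] [NormedSpace ℝ E]

open SmoothFun

/-- The Poisson tensor of phase space, acting on the second factor of `time × phase space`. -/
noncomputable def timeTensor (J : (E →L[ℝ] ℝ) ≃L[ℝ] E) : ((ℝ × E) →L[ℝ] ℝ) →L[ℝ] (ℝ × E) :=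
  (ContinuousLinearMap.inr ℝ ℝ E).comp
    ((J : (E →L[ℝ] ℝ) →L[ℝ] E).comp (ContinuousLinearMap.precomp ℝ (ContinuousLinearMap.inr ℝ ℝ E)))

@[simp] theorem timeTensor_apply (J : (E →L[ℝ] ℝ) ≃L[ℝ] E) (α : (ℝ × E) →L[ℝ] ℝ) :
    timeTensor J α = (0, J (α.comp (ContinuousLinearMap.inr ℝ ℝ E))) := rfl

theorem timeTensor_skew {J : (E →L[ℝ] ℝ) ≃L[ℝ] E} (hJ : ∀ α β : E →L[ℝ] ℝ, α (J β) = -β (J α))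
    (α β : (ℝ × E) →L[ℝ] ℝ) : α (timeTensor J β) = -β (timeTensor J α) :=
  hJ (α.comp (ContinuousLinearMap.inr ℝ ℝ E)) (β.comp (ContinuousLinearMap.inr ℝ ℝ E))

/-- A symplectic linear map preserves the Poisson tensor. -/
theorem symplectic_poisson [FiniteDimensional ℝ E] (J : (E →L[ℝ] ℝ) ≃L[ℝ] E) (M : E →L[ℝ] E)
    (hM : ∀ u v, J.symm (M u) (M v) = J.symm u v) (β : E →L[ℝ] ℝ) : M (J (β.comp M)) = J β := by
  -- Nondegeneracy of the form makes a symplectic map injective, and finite dimension makes it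
  -- bijective; the identity can then be tested against vectors of the form `M w`.
  have hinj : Function.Injective M := by
    refine (injective_iff_map_eq_zero M).mpr fun u hu => ?_
    have : J.symm u = 0 := by
      ext v; rw [← hM, hu]; simp
    simpa using this
  have hsurj : Function.Surjective M := LinearMap.injective_iff_surjective.mp hinj
  rw [← J.symm.injective.eq_iff, J.symm_apply_apply]
  ext v
  obtain ⟨w, rfl⟩ := hsurj v
  rw [hM, J.symm_apply_apply]; rfl

/-- A linear functional on phase space, as a smooth function on `time × phase space`. -/
def linearFun : (E →L[ℝ] ℝ) →ₗ[ℝ] SmoothFun (ℝ × E) where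
  toFun φ := ⟨fun p => φ p.2, show ContDiff ℝ ∞ (fun p : ℝ × E => φ p.2) from φ.contDiff.comp contDiff_snd⟩
  map_add' _ _ := rfl
  map_smul' _ _ := rfl

@[simp] theorem linearFun_apply (φ : E →L[ℝ] ℝ) (p : ℝ × E) :
    (linearFun φ : ℝ × E → ℝ) p = φ p.2 := rfl

theorem fderiv_linearFun (φ : E →L[ℝ] ℝ) (p : ℝ × E) :
    fderiv ℝ (linearFun φ : ℝ × E → ℝ) p = φ.comp (ContinuousLinearMap.snd ℝ ℝ E) :=
  (φ.comp (ContinuousLinearMap.snd ℝ ℝ E)).fderiv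

/-- The projection of `time × phase space` to time zero. -/
def atZero (p : ℝ × E) : ℝ × E := (0, p.2)

theorem contDiff_atZero : ContDiff ℝ ∞ (atZero : ℝ × E → ℝ × E) := contDiff_const.prodMk contDiff_snd

theorem fderiv_atZero (p : ℝ × E) : fderiv ℝ (atZero : ℝ × E → ℝ × E) p =
    (ContinuousLinearMap.inr ℝ ℝ E).comp (ContinuousLinearMap.snd ℝ ℝ E) :=
  ((ContinuousLinearMap.inr ℝ ℝ E).comp (ContinuousLinearMap.snd ℝ ℝ E)).fderiv

/-- Evaluation at time zero. -/
noncomputable def evZero : SmoothFun (ℝ × E) →ₐ[ℝ] SmoothFun (ℝ × E) := pullback atZero contDiff_atZero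

@[simp] theorem evZero_apply (a : SmoothFun (ℝ × E)) (p : ℝ × E) :
    (evZero a : ℝ × E → ℝ) p = (a : ℝ × E → ℝ) (0, p.2) := rfl

theorem evZero_bracket (J : (E →L[ℝ] ℝ) ≃L[ℝ] E) (a b : SmoothFun (ℝ × E)) :
    evZero (bracket (timeTensor J) a b) = bracket (timeTensor J) (evZero a) (evZero b) := by
  refine pullback_bracket _ _ _ _ (fun x β => ?_) a b
  rw [fderiv_atZero]
  simp only [timeTensor_apply, ContinuousLinearMap.comp_apply, ContinuousLinearMap.coe_snd']
  rfl

/-- The time coordinate. -/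
def timeFun : SmoothFun (ℝ × E) := ⟨fun p => p.1, show ContDiff ℝ ∞ (fun p : ℝ × E => p.1) from contDiff_fst⟩

theorem timeFun_dvd [FiniteDimensional ℝ E] {a : SmoothFun (ℝ × E)} (h : ∀ y : E, (a : ℝ × E → ℝ) (0, y) = 0) : timeFun ∣ a := by
  obtain ⟨Q, hQ, h1⟩ := hadamard_lemma a.contDiff (contDiff_atZero (E := E))
  refine ⟨⟨fun p => Q p (1, 0), hQ.clm_apply contDiff_const⟩, ext_apply fun p => ?_⟩
  have h2 := h1 p
  rw [atZero, h, sub_zero] at h2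
  have h3 : p - ((0 : ℝ), p.2) = p.1 • ((1 : ℝ), (0 : E)) := by ext <;> simp
  rw [h2, h3, map_smul]; rfl

/-- Cancellation is immediate away from time zero and extends to time zero by continuity. -/
theorem timeFun_reg {a b : SmoothFun (ℝ × E)} (h : timeFun * a = timeFun * b) : a = b := by
  refine ext_apply fun p => ?_
  have h1 : ∀ q : ℝ × E, q.1 ≠ 0 → (a : ℝ × E → ℝ) q = (b : ℝ × E → ℝ) q := fun q hq =>
    mul_left_cancel₀ hq (congrFun (congrArg Subtype.val h) q)
  have h2 : Filter.Tendsto (fun s : ℝ => (a : ℝ × E → ℝ) (s, p.2) - (b : ℝ × E → ℝ) (s, p.2)) (𝓝[≠] p.1)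
      (𝓝 ((a : ℝ × E → ℝ) (p.1, p.2) - (b : ℝ × E → ℝ) (p.1, p.2))) := by
    refine Filter.Tendsto.mono_left (Continuous.tendsto ?_ _) nhdsWithin_le_nhds
    have ha := a.contDiff.continuous
    have hb := b.contDiff.continuous
    fun_prop
  by_cases hp : p.1 = 0
  · rw [hp] at h2
    have h3 : Filter.Tendsto (fun s : ℝ => (a : ℝ × E → ℝ) (s, p.2) - (b : ℝ × E → ℝ) (s, p.2)) (𝓝[≠] 0)
        (𝓝 0) := by
      refine tendsto_const_nhds.congr' ?_
      filter_upwards [self_mem_nhdsWithin] with s hs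
      rw [h1 (s, p.2) hs, sub_self]
    have h4 := tendsto_nhds_unique h2 h3
    rw [sub_eq_zero, ← hp] at h4
    exact h4
  · exact h1 p hp

/-- A derivation of both the product and the bracket is a Hamiltonian vector field. -/
theorem exists_hamiltonian [FiniteDimensional ℝ E] {J : (E →L[ℝ] ℝ) ≃L[ℝ] E} (hJ : ∀ α β : E →L[ℝ] ℝ, α (J β) = -β (J α))
    (d : SmoothFun (ℝ × E) →ₗ[ℝ] SmoothFun (ℝ × E)) (hd : ∀ a, evZero (d a) = d a)
    (hmul : ∀ a b, evZero a = a → evZero b = b → d (a * b) = a * d b + d a * b)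
    (hbr : ∀ a b, evZero a = a → evZero b = b → d (bracket (timeTensor J) a b) =
      bracket (timeTensor J) a (d b) + bracket (timeTensor J) (d a) b) :
    ∃ h, evZero h = h ∧ ∀ a, evZero a = a → d a = bracket (timeTensor J) a h := by
  have hlin : ∀ φ : E →L[ℝ] ℝ, evZero (linearFun φ) = linearFun φ := fun φ => rfl
  have hd1 : d 1 = 0 := by
    have := hmul 1 1 (map_one _) (map_one _)
    simp only [mul_one, one_mul] at this
    exact left_eq_add.mp this
  -- The candidate for the differential of the Hamiltonian, read off from the values of `d` on
  -- linear functions.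
  let α : E → E →L[ℝ] ℝ := fun y => LinearMap.toContinuousLinearMap
    { toFun := fun u => -((d (linearFun (J.symm u)) : SmoothFun (ℝ × E)) : ℝ × E → ℝ) (0, y)
      map_add' := fun u v => by simp only [map_add, coe_add_apply]; ring
      map_smul' := fun c u => by
        simp only [map_smul, coe_smul_apply, RingHom.id_apply, smul_eq_mul]; ring }
  have hα : ∀ y u, α y u = -((d (linearFun (J.symm u)) : SmoothFun (ℝ × E)) : ℝ × E → ℝ) (0, y) :=
    fun _ _ => rfl
  have hαs : ContDiff ℝ ∞ α := by
    refine contDiff_clm_apply_iff.mpr fun u => ?_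
    simp only [hα]
    exact ((d (linearFun (J.symm u))).contDiff.comp (contDiff_prodMk_right (0 : ℝ))).neg
  have hαd : ∀ y u w, fderiv ℝ α y u w =
      -(bracket (timeTensor J) (d (linearFun (J.symm w))) (linearFun (J.symm u)) : ℝ × E → ℝ) (0, y) := by
    intro y u w
    have h1 : HasFDerivAt (fun y => α y w) ((ContinuousLinearMap.apply ℝ ℝ w).comp (fderiv ℝ α y)) y :=
      (ContinuousLinearMap.apply ℝ ℝ w).hasFDerivAt.comp y (hαs.differentiable (by simp) y).hasFDerivAt
    have h2 : HasFDerivAt (fun y => α y w) (-((fderiv ℝ ((d (linearFun (J.symm w)) : SmoothFun (ℝ × E)) :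
        ℝ × E → ℝ) (0, y)).comp (ContinuousLinearMap.inr ℝ ℝ E))) y :=
      (((d (linearFun (J.symm w))).differentiable (0, y)).hasFDerivAt.comp y
        (hasFDerivAt_prodMk_right (0 : ℝ) y)).neg
    have h3 := congrArg (fun A : E →L[ℝ] ℝ => A u) (h1.unique h2)
    simp only [ContinuousLinearMap.comp_apply, ContinuousLinearMap.apply_apply] at h3
    rw [h3, bracket_apply, fderiv_linearFun, timeTensor_apply]
    have h4 : ((J.symm u).comp (ContinuousLinearMap.snd ℝ ℝ E)).comp (ContinuousLinearMap.inr ℝ ℝ E) =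
        J.symm u := by ext; simp
    rw [h4, J.apply_symm_apply]
    rfl
  -- Closedness of `α`: the bracket of two linear functions is constant and `d` annihilates
  -- constants, so the Leibniz rule for the bracket says exactly that the derivative of `α` is
  -- symmetric. The Poincaré lemma then provides the primitive `h0`.
  have hsymm : ∀ y u w, fderiv ℝ α y u w = fderiv ℝ α y w u := by
    intro y u w
    have hconst : bracket (timeTensor J) (linearFun (J.symm w)) (linearFun (J.symm u)) =
        (J.symm w u) • (1 : SmoothFun (ℝ × E)) := by
      refine ext_apply fun p => ?_
      rw [bracket_apply, fderiv_linearFun, fderiv_linearFun, timeTensor_apply]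
      have h4 : ((J.symm u).comp (ContinuousLinearMap.snd ℝ ℝ E)).comp (ContinuousLinearMap.inr ℝ ℝ E) =
        J.symm u := by ext; simp
      rw [h4, J.apply_symm_apply]
      simp
    have h5 := hbr (linearFun (J.symm w)) (linearFun (J.symm u)) (hlin _) (hlin _)
    rw [hconst, map_smul, hd1, smul_zero, bracket_skew (timeTensor_skew hJ) (linearFun (J.symm w))] at h5
    rw [hαd, hαd, sub_eq_zero.mp (show bracket (timeTensor J) (d (linearFun (J.symm w))) (linearFun (J.symm u)) -
      bracket (timeTensor J) (d (linearFun (J.symm u))) (linearFun (J.symm w)) = 0 by rw [h5]; abel)]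
  obtain ⟨h0, hh0⟩ := convex_univ.exists_forall_hasFDerivAt_of_fderiv_symmetric isOpen_univ
    (hαs.differentiable (by simp)).differentiableOn (fun y _ => hsymm y)
  have hh0' : ∀ y, HasFDerivAt h0 (α y) y := fun y => hh0 y trivial
  have hh0s : ContDiff ℝ ∞ h0 := contDiff_infty_iff_fderiv.mpr
    ⟨fun y => (hh0' y).differentiableAt, by rw [funext fun y => (hh0' y).fderiv]; exact hαs⟩
  let h : SmoothFun (ℝ × E) := ⟨fun p => h0 p.2, hh0s.comp contDiff_snd⟩
  have hdh : ∀ p : ℝ × E, fderiv ℝ (h : ℝ × E → ℝ) p = (α p.2).comp (ContinuousLinearMap.snd ℝ ℝ E) :=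
    fun p => ((hh0' p.2).comp p hasFDerivAt_snd).fderiv
  have hbh : ∀ (a : SmoothFun (ℝ × E)) (p : ℝ × E), (bracket (timeTensor J) a h : ℝ × E → ℝ) p =
      fderiv ℝ (a : ℝ × E → ℝ) p (0, J (α p.2)) := by
    intro a p
    rw [bracket_apply, hdh, timeTensor_apply]
    congr 3
  have hevh : evZero h = h := rfl
  refine ⟨h, hevh, fun a ha => ?_⟩
  -- The difference is a derivation that kills constants and linear functions; it remains to see
  -- that it vanishes.
  let D : SmoothFun (ℝ × E) →ₗ[ℝ] SmoothFun (ℝ × E) := d - (bracket (timeTensor J)).flip h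
  have hDa : ∀ b, D b = d b - bracket (timeTensor J) b h := fun _ => rfl
  have hDmul : ∀ a b, evZero a = a → evZero b = b → D (a * b) = a * D b + D a * b := by
    intro a b ha hb
    have hb' : bracket (timeTensor J) (a * b) h =
        a * bracket (timeTensor J) b h + bracket (timeTensor J) a h * b := by
      refine ext_apply fun p => ?_
      simp only [coe_add_apply, coe_mul_apply, bracket_apply, fderiv_coe_mul, add_apply,
        smul_apply, smul_eq_mul]
      ring
    rw [hDa, hDa, hDa, hmul a b ha hb, hb']; ring
  have hD1 : D 1 = 0 := by
    have := hDmul 1 1 (map_one _) (map_one _)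
    simp only [mul_one, one_mul] at this
    exact left_eq_add.mp this
  have hDlin : ∀ φ p, (D (linearFun φ) : ℝ × E → ℝ) p = 0 := by
    intro φ p
    rw [hDa, coe_sub_apply, hbh, fderiv_linearFun]
    simp only [ContinuousLinearMap.comp_apply, ContinuousLinearMap.coe_snd']
    rw [hJ, hα, J.symm_apply_apply]
    have := congrFun (congrArg Subtype.val (hd (linearFun φ))) p
    rw [evZero_apply] at this
    rw [← this]; ring
  rw [← sub_eq_zero, ← hDa]
  refine ext_apply fun p => ?_
  obtain ⟨Q, hQ, hQ1⟩ := hadamard_lemma (g := fun y : E => (a : ℝ × E → ℝ) (0, y)) (p := fun _ => p.2)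
    (a.contDiff.comp (contDiff_prodMk_right (0 : ℝ))) contDiff_const
  let bs := Module.finBasis ℝ E
  let φ : Fin (Module.finrank ℝ E) → E →L[ℝ] ℝ := fun i => LinearMap.toContinuousLinearMap (bs.coord i)
  let q : Fin (Module.finrank ℝ E) → SmoothFun (ℝ × E) := fun i =>
    ⟨fun p => Q p.2 (bs i), (hQ.comp contDiff_snd).clm_apply contDiff_const⟩
  -- Hadamard's decomposition at the point under consideration. The linear factors vanish there and
  -- `D` kills them, so `D a` vanishes at this point.
  have hdec : a = ((a : ℝ × E → ℝ) (0, p.2)) • (1 : SmoothFun (ℝ × E)) +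
      ∑ i, (linearFun (φ i) - (φ i p.2) • (1 : SmoothFun (ℝ × E))) * q i := by
    refine ext_apply fun x => ?_
    have h1 := hQ1 x.2
    have h2 : x.2 - p.2 = ∑ i, (φ i x.2 - φ i p.2) • bs i := by
      have := bs.sum_repr (x.2 - p.2)
      rw [← this]
      refine Finset.sum_congr rfl fun i _ => ?_
      simp [φ]
    have h3 : (a : ℝ × E → ℝ) x = (a : ℝ × E → ℝ) (0, x.2) := by
      conv_lhs => rw [← ha]
      rfl
    have h4 : ((∑ i, (linearFun (φ i) - (φ i p.2) • (1 : SmoothFun (ℝ × E))) * q i : SmoothFun (ℝ × E)) :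
        ℝ × E → ℝ) x = ∑ i, (φ i x.2 - φ i p.2) * Q x.2 (bs i) := by
      rw [AddSubmonoidClass.coe_finsetSum, Finset.sum_apply]
      refine Finset.sum_congr rfl fun i _ => ?_
      simp [q]
    rw [coe_add_apply, h4, h3]
    rw [h2, map_sum] at h1
    simp only [map_smul, smul_eq_mul] at h1
    simp only [coe_smul_apply, coe_one_apply]
    linarith
  rw [hdec, map_add, map_smul, hD1, smul_zero, zero_add, map_sum,
    AddSubmonoidClass.coe_finsetSum, Finset.sum_apply, coe_zero_apply]
  refine Finset.sum_eq_zero fun i _ => ?_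
  rw [hDmul _ _ rfl rfl, coe_add_apply, coe_mul_apply, coe_mul_apply, map_sub, map_smul, hD1]
  simp [hDlin]

/-- The Poisson deformation defined by a smooth family of symplectic maps near the identity. -/
noncomputable def familyDeformation [FiniteDimensional ℝ E] {J : (E →L[ℝ] ℝ) ≃L[ℝ] E}
    (hJ : ∀ α β : E →L[ℝ] ℝ, α (J β) = -β (J α))
    (Φ : ℝ × E → E) (hΦ : ContDiff ℝ ∞ Φ) (hΦ0 : ∀ y, Φ (0, y) = y)
    (hΦs : ∀ p u v, J.symm (fderiv ℝ Φ p (0, u)) (fderiv ℝ Φ p (0, v)) = J.symm u v) :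
    PoissonDeformation (SmoothFun (ℝ × E)) where
  br := bracket (timeTensor J)
  t := timeFun
  ev := evZero
  σ := pullback (fun p => (p.1, Φ p)) (contDiff_fst.prodMk hΦ)
  br_skew := bracket_skew (timeTensor_skew hJ)
  br_mul a b c := ext_apply fun p => by
    simp only [coe_add_apply, coe_mul_apply, bracket_apply, fderiv_coe_mul, add_apply, smul_apply, smul_eq_mul]
    ring
  br_jacobi := bracket_jacobi (timeTensor_skew hJ)
  br_t c := ext_apply fun p => by
    have : fderiv ℝ ((timeFun : SmoothFun (ℝ × E)) : ℝ × E → ℝ) p = ContinuousLinearMap.fst ℝ ℝ E :=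
      (ContinuousLinearMap.fst ℝ ℝ E).fderiv
    rw [bracket_apply, this]; rfl
  ev_idem _ := rfl
  ev_br := evZero_bracket J
  ev_t := rfl
  dvd_of_ev a ha := timeFun_dvd fun y => congrFun (congrArg Subtype.val ha) (0, y)
  t_reg _ _ := timeFun_reg
  σ_br a b := by
    refine pullback_bracket _ _ _ _ (fun p β => ?_) a b
    have h1 : fderiv ℝ (fun p : ℝ × E => (p.1, Φ p)) p =
        (ContinuousLinearMap.fst ℝ ℝ E).prod (fderiv ℝ Φ p) :=
      (hasFDerivAt_fst.prodMk (hΦ.differentiable (by simp) p).hasFDerivAt).fderiv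
    have h2 := symplectic_poisson J ((fderiv ℝ Φ p).comp (ContinuousLinearMap.inr ℝ ℝ E)) (hΦs p)
      (β.comp (ContinuousLinearMap.inr ℝ ℝ E))
    have h3 : (β.comp ((ContinuousLinearMap.fst ℝ ℝ E).prod (fderiv ℝ Φ p))).comp
        (ContinuousLinearMap.inr ℝ ℝ E) = (β.comp (ContinuousLinearMap.inr ℝ ℝ E)).comp
        ((fderiv ℝ Φ p).comp (ContinuousLinearMap.inr ℝ ℝ E)) := by
      ext v; simp
    rw [h1, timeTensor_apply, timeTensor_apply, h3, ← h2]
    rfl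
  σ_t := rfl
  ev_σ a := ext_apply fun p => by simp [hΦ0]
  hamiltonian := exists_hamiltonian hJ

end TimeDependent

/-! ### The modified Hamiltonian of a symplectic one-step method of order `r` -/

/-- Mean value inequality on the interval of radius `|τ|`, where the derivative is at most `C |τ| ^
n`. -/
theorem isBigO_pow_succ_of_hasDerivAt {F F' : ℝ → ℝ} {n : ℕ}
    (hF : ∀ᶠ t in 𝓝 (0 : ℝ), HasDerivAt F (F' t) t) (h0 : F 0 = 0)
    (hO : F' =O[𝓝 (0 : ℝ)] fun τ => τ ^ n) : F =O[𝓝 (0 : ℝ)] fun τ => τ ^ (n + 1) := by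
  obtain ⟨C, hC, hb⟩ := hO.exists_nonneg
  obtain ⟨ε, hε, h⟩ := Metric.eventually_nhds_iff_ball.mp (hF.and hb.bound)
  refine Asymptotics.IsBigO.of_bound C ?_
  filter_upwards [Metric.ball_mem_nhds (0 : ℝ) hε] with τ hτ
  have hsub : Metric.closedBall (0 : ℝ) |τ| ⊆ Metric.ball 0 ε :=
    Metric.closedBall_subset_ball (by simpa using hτ)
  have := (convex_closedBall (0 : ℝ) |τ|).norm_image_sub_le_of_norm_hasDerivWithin_le
    (f := F) (f' := F') (C := C * |τ| ^ n)
    (fun x hx => (h x (hsub hx)).1.hasDerivWithinAt)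
    (fun x hx => ((h x (hsub hx)).2).trans (by
      rw [norm_pow]
      have hx' : ‖x‖ ≤ |τ| := by simpa using hx
      gcongr))
    (x := 0) (y := τ) (by simp) (by simp)
  rw [h0, sub_zero, sub_zero, Real.norm_eq_abs τ] at this
  rwa [norm_pow, Real.norm_eq_abs τ, pow_succ, ← mul_assoc]

/-- Taylor's formula for a sequence of functions each of which is the derivative of the previous one. -/
theorem isBigO_taylor (n : ℕ) : ∀ g : ℕ → ℝ → ℝ,
    (∀ j, ∀ᶠ t in 𝓝 (0 : ℝ), HasDerivAt (g j) (g (j + 1) t) t) →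
    (fun τ => g 0 τ - ∑ j ∈ Finset.range n, (j.factorial : ℝ)⁻¹ * (τ ^ j * g j 0)) =O[𝓝 (0 : ℝ)]
      fun τ => τ ^ n := by
  induction n with
  | zero =>
    intro g hg
    simpa using (hg 0).self_of_nhds.continuousAt.isBigO_one ℝ
  | succ n ih =>
    intro g hg
    refine isBigO_pow_succ_of_hasDerivAt
      (F' := fun τ => g 1 τ - ∑ j ∈ Finset.range n, (j.factorial : ℝ)⁻¹ * (τ ^ j * g (j + 1) 0)) ?_ ?_
      (ih (fun j => g (j + 1)) fun j => hg (j + 1))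
    · filter_upwards [hg 0] with t ht
      refine ht.sub ?_
      simp only [Finset.sum_range_succ']
      have h1 : ∀ j ∈ Finset.range n, HasDerivAt
          (fun τ : ℝ => ((j + 1).factorial : ℝ)⁻¹ * (τ ^ (j + 1) * g (j + 1) 0))
          ((j.factorial : ℝ)⁻¹ * (t ^ j * g (j + 1) 0)) t := by
        intro j _
        have h2 := ((hasDerivAt_pow (j + 1) t).mul_const (g (j + 1) 0)).const_mul
          (((j + 1).factorial : ℝ)⁻¹)
        refine h2.congr_deriv ?_
        have h3 : (j.factorial : ℝ) ≠ 0 := by positivity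
        have h4 : ((j : ℝ) + 1) ≠ 0 := by positivity
        rw [Nat.factorial_succ]
        push_cast
        field_simp
      have h5 := (HasDerivAt.fun_sum h1).add_const (((0 : ℕ).factorial : ℝ)⁻¹ * (1 * g 0 0))
      simpa using h5
    · simp [Finset.sum_range_succ']

-- The order hypothesis is needed only pointwise in `y₀`: Hadamard division by `t` produces smooth
-- quotients `G` and `R`, from which bounds uniform on compact sets follow by continuity. The last
-- conclusion, that `m` commutes with `K`, is what later makes `K` gauge invariant.
open SmoothFun in
theorem exists_modified_hamiltonian_family {E : Type} [NormedAddCommGroup E] [NormedSpace ℝ E]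
    [FiniteDimensional ℝ E] {J : (E →L[ℝ] ℝ) ≃L[ℝ] E}
    (hJ : ∀ α β : E →L[ℝ] ℝ, α (J β) = -β (J α)) {H : E → ℝ} (hH : ContDiff ℝ ∞ H)
    {Φ : ℝ × E → E} (hΦ : ContDiff ℝ ∞ Φ) (hΦ0 : ∀ y, Φ (0, y) = y)
    (hΦs : ∀ p u v, J.symm (fderiv ℝ Φ p (0, u)) (fderiv ℝ Φ p (0, v)) = J.symm u v)
    {m : E → ℝ} (hm : ContDiff ℝ ∞ m) (hmΦ : ∀ p, m (Φ p) = m p.2)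
    (hmH : ∀ y, fderiv ℝ m y (J (fderiv ℝ H y)) = 0) {r n : ℕ} (hrn : r ≤ n)
    (hord : ∀ y₀, ∃ z : ℝ → E, z 0 = y₀ ∧
      (∀ᶠ t in 𝓝 (0 : ℝ), HasDerivAt z (J (fderiv ℝ H (z t))) t) ∧
      (fun τ => Φ (τ, y₀) - z τ) =O[𝓝 (0 : ℝ)] fun τ => τ ^ (r + 1)) :
    ∃ K G R : ℝ × E → ℝ, ContDiff ℝ ∞ K ∧ ContDiff ℝ ∞ G ∧ ContDiff ℝ ∞ R ∧
      (∀ p, K p - H p.2 = p.1 ^ r * G p) ∧ (∀ p, K (p.1, Φ p) - K p = p.1 ^ (n + 1) * R p) ∧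
      ∀ p, fderiv ℝ m p.2 (J ((fderiv ℝ K p).comp (ContinuousLinearMap.inr ℝ ℝ E))) = 0 := by
  let X := familyDeformation hJ Φ hΦ hΦ0 hΦs
  let lift : ∀ g : E → ℝ, ContDiff ℝ ∞ g → SmoothFun (ℝ × E) := fun g hg =>
    ⟨fun p => g p.2, hg.comp contDiff_snd⟩
  have hlift : ∀ g hg p, fderiv ℝ (lift g hg : ℝ × E → ℝ) p =
      (fderiv ℝ g p.2).comp (ContinuousLinearMap.snd ℝ ℝ E) := fun g hg p =>
    ((hg.differentiable (by simp) p.2).hasFDerivAt.comp p hasFDerivAt_snd).fderiv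
  have hbrm : ∀ (b : SmoothFun (ℝ × E)) p, (X.br (lift m hm) b : ℝ × E → ℝ) p =
      fderiv ℝ m p.2 (J ((fderiv ℝ (b : ℝ × E → ℝ) p).comp (ContinuousLinearMap.inr ℝ ℝ E))) := by
    intro b p
    change (bracket (timeTensor J) (lift m hm) b : ℝ × E → ℝ) p = _
    rw [bracket_apply, hlift m hm]; rfl
  have hcomp : ∀ φ : E →L[ℝ] ℝ, (φ.comp (ContinuousLinearMap.snd ℝ ℝ E)).comp
      (ContinuousLinearMap.inr ℝ ℝ E) = φ := fun φ => by ext; simp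
  have hbrH : ∀ (b : SmoothFun (ℝ × E)) p, (X.br b (lift H hH) : ℝ × E → ℝ) p =
      fderiv ℝ (b : ℝ × E → ℝ) p (0, J (fderiv ℝ H p.2)) := by
    intro b p
    change (bracket (timeTensor J) b (lift H hH) : ℝ × E → ℝ) p = _
    rw [bracket_apply, hlift H hH, timeTensor_apply, hcomp]
  have hevlift : ∀ g hg, X.ev (lift g hg) = lift g hg := fun _ _ => rfl
  have hdvd : ∀ (k : ℕ) (a : SmoothFun (ℝ × E)), X.t ^ k ∣ a →
      ∃ G : ℝ × E → ℝ, ContDiff ℝ ∞ G ∧ ∀ p, (a : ℝ × E → ℝ) p = p.1 ^ k * G p := by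
    rintro k _ ⟨c, rfl⟩
    exact ⟨c, c.contDiff, fun p => rfl⟩
  have hmH' : X.br (lift m hm) (lift H hH) = 0 := ext_apply fun p => by
    rw [hbrm, hlift H hH, hcomp, hmH]; rfl
  have base : ∀ b, X.ev b = b → X.t ^ (r + 1) ∣ X.σ b - X.expTrunc n (X.t * lift H hH) b := by
    intro b hb
    set c : ℕ → SmoothFun (ℝ × E) := fun j => ((X.br.flip (lift H hH)) ^ j) b with hc
    have hcs : ∀ j, c (j + 1) = X.br (c j) (lift H hH) := fun j => by
      simp only [hc]; rw [pow_succ', Module.End.mul_apply, LinearMap.flip_apply]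
    have hcev : ∀ j, X.ev (c j) = c j := by
      intro j
      induction j with
      | zero => simpa [hc] using hb
      | succ j ih => rw [hcs, X.ev_br, ih, hevlift H hH]
    have hcv : ∀ j (p : ℝ × E), (c j : ℝ × E → ℝ) p = (c j : ℝ × E → ℝ) (0, p.2) := fun j p =>
      (congrFun (congrArg Subtype.val (hcev j)) p).symm
    -- On a time-independent `b`, the truncated exponential of `t H` is the Taylor polynomial at
    -- time zero of `b` along the exact flow.
    have hE : ∀ p, (X.expTrunc n (X.t * lift H hH) b : ℝ × E → ℝ) p =
        ∑ j ∈ Finset.range (n + 1), (j.factorial : ℝ)⁻¹ * (p.1 ^ j * (c j : ℝ × E → ℝ) (0, p.2)) := by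
      intro p
      have h1 : ∀ j, ((X.br.flip (X.t * lift H hH)) ^ j) b = X.t ^ j * c j := by
        intro j
        induction j with
        | zero => simp [hc]
        | succ j ih =>
          rw [pow_succ', Module.End.mul_apply, ih, LinearMap.flip_apply, X.br_tmul_right, X.br_tpow, hcs]
          ring
      rw [X.expTrunc_apply, AddSubmonoidClass.coe_finsetSum, Finset.sum_apply]
      refine Finset.sum_congr rfl fun j _ => ?_
      rw [LinearMap.smul_apply, h1, coe_smul_apply, coe_mul_apply, hcv j p]
      rfl
    have hO : ∀ y₀, (fun τ : ℝ => ((X.σ b - X.expTrunc n (X.t * lift H hH) b : SmoothFun (ℝ × E)) :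
        ℝ × E → ℝ) (τ, y₀)) =O[𝓝 (0 : ℝ)] fun τ => τ ^ (r + 1) := by
      intro y₀
      obtain ⟨z, hz0, hz, hzO⟩ := hord y₀
      have hzc : ContinuousAt z 0 := hz.self_of_nhds.continuousAt
      have h1 : (fun τ : ℝ => (b : ℝ × E → ℝ) (0, Φ (τ, y₀)) - (b : ℝ × E → ℝ) (0, z τ)) =O[𝓝 (0 : ℝ)]
          fun τ => τ ^ (r + 1) := by
        have hbs : ContDiff ℝ ∞ fun y : E => (b : ℝ × E → ℝ) (0, y) :=
          b.contDiff.comp (contDiff_prodMk_right (0 : ℝ))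
        have h2 := (hbs.contDiffAt.hasStrictFDerivAt (x := y₀) (by simp)).isBigO_sub
        have h3 : Filter.Tendsto (fun τ : ℝ => (Φ (τ, y₀), z τ)) (𝓝 0) (𝓝 (y₀, y₀)) := by
          refine Filter.Tendsto.prodMk_nhds ?_ (by simpa [ContinuousAt, hz0] using hzc)
          have h4 : Continuous fun τ : ℝ => Φ (τ, y₀) := hΦ.continuous.comp (by fun_prop)
          simpa [hΦ0] using h4.tendsto 0
        exact (h2.comp_tendsto h3).trans hzO
      have h5 := isBigO_taylor (n + 1) (fun j t => (c j : ℝ × E → ℝ) (0, z t)) (fun j => by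
        filter_upwards [hz] with t ht
        have h6 : HasDerivAt (fun t => ((0 : ℝ), z t)) ((0 : ℝ), J (fderiv ℝ H (z t))) t :=
          (hasDerivAt_const t (0 : ℝ)).prodMk ht
        have h7 := ((c j).differentiable (0, z t)).hasFDerivAt.comp_hasDerivAt t h6
        rw [hcs, hbrH]
        exact h7)
      have h8 : (fun τ : ℝ => τ ^ (n + 1)) =O[𝓝 (0 : ℝ)] fun τ => τ ^ (r + 1) := by
        refine Asymptotics.IsBigO.of_bound 1 ?_
        filter_upwards [Metric.ball_mem_nhds (0 : ℝ) one_pos] with τ hτ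
        rw [one_mul, norm_pow, norm_pow]
        exact pow_le_pow_of_le_one (norm_nonneg _) (by simpa using (Metric.mem_ball.mp hτ).le) (by omega)
      have h9 := h1.add (h5.trans h8)
      refine h9.congr_left fun τ => ?_
      rw [coe_sub_apply, hE]
      have h10 : (X.σ b : ℝ × E → ℝ) (τ, y₀) = (b : ℝ × E → ℝ) (0, Φ (τ, y₀)) := hcv 0 (τ, Φ (τ, y₀))
      rw [h10]
      simp only [hz0]
      simp [hc]
    -- As long as `k` is smaller than `r + 1`, the quotient by `t ^ k` is continuous and tends to
    -- zero at time zero, so one more factor `t` splits off.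
    have step : ∀ k ≤ r + 1, X.t ^ k ∣ X.σ b - X.expTrunc n (X.t * lift H hH) b := by
      intro k
      induction k with
      | zero => simp
      | succ k ih =>
        intro hk
        obtain ⟨c, hcc⟩ := ih (by omega)
        rw [hcc, pow_succ]
        refine mul_dvd_mul_left _ (timeFun_dvd fun y => ?_)
        have hO' := hO y
        rw [hcc] at hO'
        have h1 : (fun τ : ℝ => (c : ℝ × E → ℝ) (τ, y)) =O[𝓝[≠] (0 : ℝ)] fun τ => τ ^ (r + 1 - k) := by
          obtain ⟨C, hC⟩ := (hO'.mono (nhdsWithin_le_nhds (s := {0}ᶜ))).bound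
          refine Asymptotics.IsBigO.of_bound C ?_
          filter_upwards [hC, self_mem_nhdsWithin] with τ hτ hne
          have hpos : 0 < ‖τ‖ ^ k := pow_pos (norm_pos_iff.mpr hne) _
          have e1 : ((X.t ^ k * c : SmoothFun (ℝ × E)) : ℝ × E → ℝ) (τ, y) =
            τ ^ k * (c : ℝ × E → ℝ) (τ, y) := rfl
          have e2 : ‖τ ^ (r + 1)‖ = ‖τ‖ ^ k * ‖τ ^ (r + 1 - k)‖ := by
            rw [norm_pow, norm_pow, ← pow_add]; congr 1; omega
          rw [e1, norm_mul, norm_pow, e2, mul_left_comm] at hτ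
          exact le_of_mul_le_mul_left hτ hpos
        have h2 : Filter.Tendsto (fun τ : ℝ => (c : ℝ × E → ℝ) (τ, y)) (𝓝[≠] 0) (𝓝 0) := by
          refine h1.trans_tendsto (Filter.Tendsto.mono_left ?_ nhdsWithin_le_nhds)
          have : Continuous fun τ : ℝ => τ ^ (r + 1 - k) := by fun_prop
          simpa [show r + 1 - k ≠ 0 by omega] using this.tendsto 0
        have h3 : Filter.Tendsto (fun τ : ℝ => (c : ℝ × E → ℝ) (τ, y)) (𝓝[≠] 0)
            (𝓝 ((c : ℝ × E → ℝ) (0, y))) := by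
          have h4 : Continuous fun τ : ℝ => (c : ℝ × E → ℝ) (τ, y) := c.contDiff.continuous.comp (by fun_prop)
          exact (h4.tendsto 0).mono_left nhdsWithin_le_nhds
        exact tendsto_nhds_unique h3 h2
    exact step _ le_rfl
  obtain ⟨K, hK, hmK, hσK⟩ := X.exists_modified_hamiltonian hrn (hevlift m hm)
    (show X.σ (lift m hm) = lift m hm from ext_apply fun p => hmΦ p) hmH' base
  obtain ⟨G, hG, hG'⟩ := hdvd _ _ hK
  obtain ⟨R, hR, hR'⟩ := hdvd _ _ hσK
  refine ⟨K, G, R, K.contDiff, hG, hR, hG', hR', fun p => ?_⟩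
  rw [← hbrm, hmK]; rfl

/-! ### Runge–Kutta methods: solvability, smoothness, symplecticity -/

/-- A smooth map on an open set can be modified outside a neighbourhood of a compact subset to become a
smooth map with compact support on the whole space. -/
theorem exists_contDiff_hasCompactSupport_eventuallyEq {E V : Type} [NormedAddCommGroup E] [NormedSpace ℝ E]
    [FiniteDimensional ℝ E] [NormedAddCommGroup V] [NormedSpace ℝ V] {U K : Set E} (hU : IsOpen U)
    (hK : IsCompact K) (hKU : K ⊆ U) {g : E → V} (hg : ContDiffOn ℝ ∞ g U) :
    ∃ g' : E → V, ContDiff ℝ ∞ g' ∧ HasCompactSupport g' ∧ ∀ᶠ x in 𝓝ˢ K, g' x = g x := by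
  obtain ⟨t, ht, hKt, htU⟩ := exists_compact_between hK hU hKU
  obtain ⟨χ, h1, h0, -⟩ := exists_contMDiffMap_one_nhds_of_subset_interior (modelWithCornersSelf ℝ E) (n := (⊤ : ℕ∞))
    hK.isClosed hKt
  have hχ : ContDiff ℝ ∞ χ := χ.contMDiff.contDiff
  refine ⟨fun x => χ x • g x, ?_, ?_, ?_⟩
  · refine contDiff_iff_contDiffAt.mpr fun x => ?_
    by_cases hx : x ∈ U
    · exact hχ.contDiffAt.smul (hg.contDiffAt (hU.mem_nhds hx))
    · have : (fun x => χ x • g x) =ᶠ[𝓝 x] fun _ => (0 : V) := by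
        filter_upwards [ht.isClosed.isOpen_compl.mem_nhds fun h => hx (htU h)] with y hy
        rw [h0 y hy, zero_smul]
      exact contDiffAt_const.congr_of_eventuallyEq this
  · exact HasCompactSupport.intro ht fun x hx => by rw [h0 x hx, zero_smul]
  · filter_upwards [h1] with x hx
    rw [hx, one_smul]

namespace RKMethod

variable {s : ℕ} (m : RKMethod s) {E : Type} [NormedAddCommGroup E] [NormedSpace ℝ E]

/-- The right-hand side of the stage equations. -/
def stageMap (f : E → E) (p : ℝ × E) (Z : Fin s → E) : Fin s → E :=
  fun i => p.2 + p.1 • ∑ j, m.a i j • f (Z j)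

theorem isStages_univ_iff (f : E → E) (p : ℝ × E) (Z : Fin s → E) :
    m.IsStages f Set.univ p.1 p.2 Z ↔ Z = m.stageMap f p Z := by
  simp [IsStages, stageMap, funext_iff]

/-- The sum of the absolute values of the coefficients. -/
def size : ℝ := ∑ i, ∑ j, |m.a i j| + ∑ j, |m.b j|

theorem sum_a_le_size (i : Fin s) : ∑ j, |m.a i j| ≤ m.size := by
  have h1 : ∑ j, |m.a i j| ≤ ∑ i, ∑ j, |m.a i j| :=
    Finset.single_le_sum (f := fun i => ∑ j, |m.a i j|)
      (fun i _ => Finset.sum_nonneg fun j _ => abs_nonneg _) (Finset.mem_univ i)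
  have h2 : 0 ≤ ∑ j, |m.b j| := Finset.sum_nonneg fun j _ => abs_nonneg _
  rw [size]; linarith

theorem sum_b_le_size : ∑ j, |m.b j| ≤ m.size := by
  have h2 : 0 ≤ ∑ i, ∑ j, |m.a i j| :=
    Finset.sum_nonneg fun i _ => Finset.sum_nonneg fun j _ => abs_nonneg _
  rw [size]; linarith

theorem size_nonneg : 0 ≤ m.size :=
  (Finset.sum_nonneg fun _ _ => abs_nonneg _).trans m.sum_b_le_size

theorem norm_sum_smul_le {c : Fin s → ℝ} {v : Fin s → E} {A M : ℝ} (hc : ∑ j, |c j| ≤ A) (hM : 0 ≤ M)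
    (hv : ∀ j, ‖v j‖ ≤ M) : ‖∑ j, c j • v j‖ ≤ A * M := by
  calc ‖∑ j, c j • v j‖ ≤ ∑ j, |c j| * M := by
        refine norm_sum_le_of_le _ fun j _ => ?_
        rw [norm_smul, Real.norm_eq_abs]
        exact mul_le_mul_of_nonneg_left (hv j) (abs_nonneg _)
    _ = (∑ j, |c j|) * M := by rw [Finset.sum_mul]
    _ ≤ A * M := mul_le_mul_of_nonneg_right hc hM

theorem contDiff_stageMap {f : E → E} (hf : ContDiff ℝ ∞ f) :
    ContDiff ℝ ∞ fun q : (ℝ × E) × (Fin s → E) => m.stageMap f q.1 q.2 := by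
  unfold stageMap
  fun_prop

/-- For a globally Lipschitz, bounded, smooth vector field the stage equations have a unique solution for
small step sizes, which depends smoothly on the step size and the starting value. -/
theorem exists_smooth_stages [FiniteDimensional ℝ E] {f : E → E} (hf : ContDiff ℝ ∞ f) {L : NNReal}
    (hL : LipschitzWith L f) {M : ℝ} (hM : ∀ x, ‖f x‖ ≤ M) :
    ∃ τ₀ > 0, ∃ Y : ℝ × E → Fin s → E, ContDiffOn ℝ ∞ Y {p | |p.1| < τ₀} ∧
      (∀ p : ℝ × E, |p.1| < τ₀ → ∀ Z, m.IsStages f Set.univ p.1 p.2 Z ↔ Z = Y p) ∧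
      ∀ p : ℝ × E, |p.1| < τ₀ → ∀ i, ‖Y p i - p.2‖ ≤ m.size * M * |p.1| := by
  have hs0 := m.size_nonneg
  have hM0 : 0 ≤ M := (norm_nonneg _).trans (hM 0)
  -- Chosen so that the stage map is a contraction with constant 1/2; the summand 1 covers a
  -- vanishing product.
  set τ₀ : ℝ := 1 / (2 * (m.size * L + 1)) with hτ₀
  have hden : 0 < 2 * (m.size * L + 1) := by positivity
  have hτ₀pos : 0 < τ₀ := by positivity
  have hlip : ∀ p : ℝ × E, |p.1| < τ₀ → LipschitzWith (1 / 2) (m.stageMap f p) := by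
    intro p hp
    refine LipschitzWith.of_dist_le_mul fun Z Z' => ?_
    rw [dist_eq_norm, dist_eq_norm]
    refine (pi_norm_le_iff_of_nonneg (by positivity)).mpr fun i => ?_
    have e : (m.stageMap f p Z - m.stageMap f p Z') i = p.1 • ∑ j, m.a i j • (f (Z j) - f (Z' j)) := by
      simp [stageMap, smul_sub]
    rw [e, norm_smul, Real.norm_eq_abs]
    have h1 : ‖∑ j, m.a i j • (f (Z j) - f (Z' j))‖ ≤ m.size * (L * ‖Z - Z'‖) := by
      refine norm_sum_smul_le (m.sum_a_le_size i) (by positivity) fun j => ?_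
      refine (hL.norm_sub_le _ _).trans ?_
      exact mul_le_mul_of_nonneg_left (norm_le_pi_norm (Z - Z') j) L.2
    calc |p.1| * ‖∑ j, m.a i j • (f (Z j) - f (Z' j))‖ ≤ τ₀ * (m.size * (L * ‖Z - Z'‖)) := by gcongr
      _ = (m.size * L) / (2 * (m.size * L + 1)) * ‖Z - Z'‖ := by rw [hτ₀]; ring
      _ ≤ 1 / 2 * ‖Z - Z'‖ := by
        refine mul_le_mul_of_nonneg_right ?_ (norm_nonneg _)
        rw [div_le_div_iff₀ hden two_pos]; linarith
      _ = _ := by simp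
  have hcontr : ∀ p : ℝ × E, |p.1| < τ₀ → ContractingWith (1 / 2) (m.stageMap f p) := fun p hp =>
    ⟨by rw [← NNReal.coe_lt_coe]; norm_num, hlip p hp⟩
  have hex : ∀ p : ℝ × E, ∃ y, |p.1| < τ₀ → ∀ Z, Z = m.stageMap f p Z ↔ Z = y := by
    intro p
    by_cases hp : |p.1| < τ₀
    · refine ⟨(hcontr p hp).fixedPoint, fun _ Z => ⟨fun h => ?_, fun h => ?_⟩⟩
      · exact (hcontr p hp).fixedPoint_unique h.symm
      · rw [h]; exact (hcontr p hp).fixedPoint_isFixedPt.symm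
    · exact ⟨0, fun h => absurd h hp⟩
  choose Y hY using hex
  have hopen : IsOpen {p : ℝ × E | |p.1| < τ₀} :=
    isOpen_lt (continuous_abs.comp continuous_fst) continuous_const
  refine ⟨τ₀, hτ₀pos, Y, ?_, fun p hp Z => (m.isStages_univ_iff f p Z).trans (hY p hp Z), ?_⟩
  · intro p₀ hp₀
    refine ContDiffAt.contDiffWithinAt ?_
    -- The stages are the zeros of `g`. Its partial derivative in the stages is the identity minus a
    -- map of norm at most 1/2, so the implicit function theorem applies; uniqueness of the fixed
    -- point identifies the implicit function with `Y`.
    let g : (ℝ × E) × (Fin s → E) → Fin s → E := fun q => q.2 - m.stageMap f q.1 q.2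
    have hg : ContDiff ℝ ∞ g := contDiff_snd.sub (m.contDiff_stageMap hf)
    have hder : (fderiv ℝ g (p₀, Y p₀)).comp (ContinuousLinearMap.inr ℝ (ℝ × E) (Fin s → E)) =
        1 - fderiv ℝ (m.stageMap f p₀) (Y p₀) := by
      have h1 : HasFDerivAt (fun Z => g (p₀, Z)) ((fderiv ℝ g (p₀, Y p₀)).comp
          (ContinuousLinearMap.inr ℝ (ℝ × E) (Fin s → E))) (Y p₀) :=
        (hg.differentiable (by simp) (p₀, Y p₀)).hasFDerivAt.comp _ (hasFDerivAt_prodMk_right p₀ (Y p₀))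
      have h2 : DifferentiableAt ℝ (m.stageMap f p₀) (Y p₀) :=
        ((m.contDiff_stageMap hf).comp (contDiff_prodMk_right p₀)).differentiable (by simp) (Y p₀)
      exact h1.unique ((hasFDerivAt_id (Y p₀)).sub h2.hasFDerivAt)
    have hinv : ((fderiv ℝ g (p₀, Y p₀)).comp
        (ContinuousLinearMap.inr ℝ (ℝ × E) (Fin s → E))).IsInvertible := by
      rw [hder]
      have hn : ‖fderiv ℝ (m.stageMap f p₀) (Y p₀)‖ < 1 :=
        (norm_fderiv_le_of_lipschitz ℝ (hlip p₀ hp₀)).trans_lt (by norm_num)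
      obtain ⟨u, hu⟩ := isUnit_one_sub_of_norm_lt_one hn
      exact ⟨ContinuousLinearEquiv.unitsEquiv ℝ _ u, hu⟩
    have hg' : ContDiffAt ℝ ∞ g (p₀, Y p₀) := hg.contDiffAt
    have hsm := hg'.contDiffAt_implicitFunction (by simp) hinv
    refine hsm.congr_of_eventuallyEq ?_
    filter_upwards [hg'.eventually_apply_implicitFunction (by simp) hinv, hopen.mem_nhds hp₀] with p h1 h2
    have h3 : g (p₀, Y p₀) = 0 := sub_eq_zero.mpr ((hY p₀ hp₀ _).mpr rfl)
    rw [h3] at h1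
    exact ((hY p h2 _).mp (sub_eq_zero.mp h1)).symm
  · intro p hp i
    have h1 := congrFun ((hY p hp (Y p)).mpr rfl) i
    have h2 : Y p i - p.2 = p.1 • ∑ j, m.a i j • f (Y p j) := by
      conv_lhs => rw [h1]
      simp [stageMap]
    rw [h2, norm_smul, Real.norm_eq_abs, mul_comm]
    exact mul_le_mul_of_nonneg_right (norm_sum_smul_le (m.sum_a_le_size i) hM0 fun j => hM _) (abs_nonneg _)

theorem isStages_iff_of_eqOn {f g : E → E} {D : Set E} (h : ∀ x ∈ D, f x = g x) (τ : ℝ) (y : E)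
    (Z : Fin s → E) : m.IsStages f D τ y Z ↔ (∀ i, Z i ∈ D) ∧ m.IsStages g Set.univ τ y Z := by
  simp only [IsStages, Set.mem_univ, true_and, forall_and]
  refine and_congr_right fun hZ => forall_congr' fun i => ?_
  simp only [fun j => h (Z j) (hZ j)]

theorem update_congr {f g : E → E} {D : Set E} (h : ∀ x ∈ D, f x = g x) (τ : ℝ) (y : E)
    {Z : Fin s → E} (hZ : ∀ i, Z i ∈ D) : m.update f τ y Z = m.update g τ y Z := by
  simp only [update, fun j => h (Z j) (hZ j)]

/-- Local unique solvability of the stage equations, with smooth dependence on the starting value. -/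
theorem exists_local_stages [FiniteDimensional ℝ E] {f : E → E} {D : Set E} (hD : IsOpen D)
    (hf : ContDiffOn ℝ ∞ f D) {y₀ : E} (hy₀ : y₀ ∈ D) :
    ∃ δ > 0, ∃ τ₀ > 0, ∃ U : Set E, IsOpen U ∧ y₀ ∈ U ∧
      ∀ τ : ℝ, |τ| ≤ τ₀ → ∃ Y : E → Fin s → E, ContDiffOn ℝ ∞ Y U ∧
        ∀ y ∈ U, ∀ Z : Fin s → E, m.IsStages f (D ∩ Metric.closedBall y δ) τ y Z ↔ Z = Y y := by
  obtain ⟨g, hg, hgc, hgf⟩ := exists_contDiff_hasCompactSupport_eventuallyEq hD isCompact_singleton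
    (Set.singleton_subset_iff.mpr hy₀) hf
  rw [nhdsSet_singleton] at hgf
  obtain ⟨L, hL⟩ := hg.lipschitzWith_of_hasCompactSupport hgc (by simp)
  obtain ⟨M, hM⟩ := hgc.exists_bound_of_continuous hg.continuous
  obtain ⟨τ₁, hτ₁, Y, hYs, hYu, hYb⟩ := m.exists_smooth_stages hg hL hM
  obtain ⟨ε, hε, hball⟩ := Metric.eventually_nhds_iff_ball.mp (hgf.and (hD.mem_nhds hy₀))
  have hM0 : 0 ≤ M := (norm_nonneg _).trans (hM 0)
  have hsM : 0 ≤ m.size * M := mul_nonneg m.size_nonneg hM0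
  -- The second bound on the step size keeps the stages of the cut-off field within `ε / 2` of the
  -- start, hence in the ball where that field is the original one.
  refine ⟨ε / 2, by positivity, min (τ₁ / 2) (ε / 2 / (m.size * M + 1)), by positivity,
    Metric.ball y₀ (ε / 2), Metric.isOpen_ball, Metric.mem_ball_self (by positivity), fun τ hτ => ?_⟩
  have hτ1 : |τ| < τ₁ := by
    have := hτ.trans (min_le_left _ _)
    linarith
  have hτ2 : m.size * M * |τ| ≤ ε / 2 := by
    have h1 := hτ.trans (min_le_right _ _)
    rw [le_div_iff₀ (by positivity)] at h1
    nlinarith [abs_nonneg τ]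
  refine ⟨fun y => Y (τ, y), hYs.comp (contDiff_prodMk_right τ).contDiffOn fun y _ => hτ1, fun y hy Z => ?_⟩
  have hsub : ∀ x ∈ D ∩ Metric.closedBall y (ε / 2), f x = g x := fun x hx => by
    refine (hball x ?_).1.symm
    rw [Metric.mem_ball] at hy ⊢
    have h1 := Metric.mem_closedBall.mp hx.2
    have h2 := dist_triangle x y y₀
    linarith
  rw [m.isStages_iff_of_eqOn hsub, hYu (τ, y) hτ1]
  refine ⟨fun h => h.2, fun h => ⟨fun i => ?_, h⟩⟩
  have h1 : dist (Z i) y ≤ ε / 2 := by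
    rw [h, dist_eq_norm]; exact (hYb (τ, y) hτ1 i).trans hτ2
  refine ⟨(hball _ ?_).2, Metric.mem_closedBall.mpr h1⟩
  rw [Metric.mem_ball] at hy ⊢
  have h2 := dist_triangle (Z i) y y₀
  linarith

variable {m}

/-- A symplectic method preserves bilinear invariants of the variational equation. -/
theorem IsSymplectic.bilin_eq (hm : m.IsSymplectic) (B : E →L[ℝ] E →L[ℝ] ℝ) (τ : ℝ) (U V : E)
    (k l Us Vs : Fin s → E) (hU : ∀ i, Us i = U + τ • ∑ j, m.a i j • k j)
    (hV : ∀ i, Vs i = V + τ • ∑ j, m.a i j • l j) (h0 : ∀ i, B (Us i) (l i) + B (k i) (Vs i) = 0) :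
    B (U + τ • ∑ j, m.b j • k j) (V + τ • ∑ j, m.b j • l j) = B U V := by
  -- The starting vectors are eliminated in favour of the stages. In the expansion of the left side,
  -- the terms linear in `τ` cancel by `h0`, and the coefficients `b i b j - b i a i j - b j a j i`
  -- left at `τ ^ 2` vanish by symplecticity.
  have e1 : ∑ i, m.b i * B U (l i) = ∑ i, m.b i * B (Us i) (l i) -
      τ * ∑ i, ∑ j, m.b j * m.a j i * B (k i) (l j) := by
    rw [Finset.sum_comm, Finset.mul_sum, ← Finset.sum_sub_distrib]
    refine Finset.sum_congr rfl fun i _ => ?_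
    rw [hU, map_add, map_smul, map_sum, add_apply, smul_apply,
      sum_apply, smul_eq_mul]
    simp only [map_smul, smul_apply, smul_eq_mul, mul_assoc, ← Finset.mul_sum]
    ring
  have e2 : ∑ i, m.b i * B (k i) V = ∑ i, m.b i * B (k i) (Vs i) -
      τ * ∑ i, ∑ j, m.b i * m.a i j * B (k i) (l j) := by
    rw [Finset.mul_sum, ← Finset.sum_sub_distrib]
    refine Finset.sum_congr rfl fun i _ => ?_
    rw [hV, map_add, map_smul, map_sum, smul_eq_mul]
    simp only [map_smul, smul_eq_mul, mul_assoc, ← Finset.mul_sum]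
    ring
  have e3 : ∑ i, ∑ j, m.b i * m.b j * B (k i) (l j) = ∑ i, ∑ j, m.b j * m.a j i * B (k i) (l j) +
      ∑ i, ∑ j, m.b i * m.a i j * B (k i) (l j) := by
    simp only [← Finset.sum_add_distrib]
    refine Finset.sum_congr rfl fun i _ => Finset.sum_congr rfl fun j _ => ?_
    linear_combination -(B (k i) (l j)) * hm i j
  have e4 : ∑ i, m.b i * B (Us i) (l i) + ∑ i, m.b i * B (k i) (Vs i) = 0 := by
    rw [← Finset.sum_add_distrib]
    exact Finset.sum_eq_zero fun i _ => by rw [← mul_add, h0, mul_zero]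
  have e5 : B (U + τ • ∑ j, m.b j • k j) (V + τ • ∑ j, m.b j • l j) = B U V +
      τ * (∑ i, m.b i * B U (l i) + ∑ i, m.b i * B (k i) V) +
      τ ^ 2 * ∑ i, ∑ j, m.b i * m.b j * B (k i) (l j) := by
    have f1 : B U (∑ j, m.b j • l j) = ∑ i, m.b i * B U (l i) := by simp
    have f2 : B (∑ j, m.b j • k j) V = ∑ i, m.b i * B (k i) V := by simp
    have f3 : B (∑ j, m.b j • k j) (∑ j, m.b j • l j) = ∑ i, ∑ j, m.b i * m.b j * B (k i) (l j) := by
      rw [map_sum B, sum_apply]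
      refine Finset.sum_congr rfl fun i _ => ?_
      rw [map_smul, smul_apply, map_sum, smul_eq_mul, Finset.mul_sum]
      refine Finset.sum_congr rfl fun j _ => ?_
      rw [map_smul, smul_eq_mul, mul_assoc]
    rw [← f1, ← f2, ← f3]
    simp only [map_add, map_smul, add_apply, smul_apply, smul_eq_mul]
    ring
  rw [e5, e1, e2, e3]
  linear_combination τ * e4

/-- A step of a symplectic method, applied to a Hamiltonian system, preserves the symplectic form along
differentiable families. -/
theorem IsSymplectic.fderiv_update (hm : m.IsSymplectic) {J : (E →L[ℝ] ℝ) ≃L[ℝ] E}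
    (hJ : ∀ α β : E →L[ℝ] ℝ, α (J β) = -β (J α)) {D : Set E} (hD : IsOpen D) {h : E → ℝ}
    (hh : ContDiffOn ℝ ∞ h D) {f : E → E} (hf : ∀ x ∈ D, f x = J (fderiv ℝ h x))
    {P : Type} [NormedAddCommGroup P] [NormedSpace ℝ P] {e : P} {τ : ℝ} {y y' : P → E}
    {Y : P → Fin s → E} (hy : DifferentiableAt ℝ y e) (hY : DifferentiableAt ℝ Y e)
    (hst : ∀ᶠ x in 𝓝 e, m.IsStages f D τ (y x) (Y x) ∧ y' x = m.update f τ (y x) (Y x)) :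
    DifferentiableAt ℝ y' e ∧ ∀ u v, J.symm (fderiv ℝ y' e u) (fderiv ℝ y' e v) =
      J.symm (fderiv ℝ y e u) (fderiv ℝ y e v) := by
  have hskew : ∀ u v, J.symm u v = -J.symm v u := fun u v => by
    have := hJ (J.symm u) (J.symm v)
    simpa using this
  have hYe : ∀ i, Y e i ∈ D := fun i => (hst.self_of_nhds.1 i).1
  have hdh : ∀ x ∈ D, DifferentiableAt ℝ (fderiv ℝ h) x := fun x hx =>
    (((hh.contDiffAt (hD.mem_nhds hx)).fderiv_right (m := ∞) (by simp)).differentiableAt (by simp))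
  have hdf : ∀ x ∈ D, HasFDerivAt f ((J : (E →L[ℝ] ℝ) →L[ℝ] E).comp (fderiv ℝ (fderiv ℝ h) x)) x := by
    intro x hx
    have h1 := (J : (E →L[ℝ] ℝ) →L[ℝ] E).hasFDerivAt.comp x (hdh x hx).hasFDerivAt
    refine h1.congr_of_eventuallyEq ?_
    filter_upwards [hD.mem_nhds hx] with z hz using hf z hz
  have hYi : ∀ i, HasFDerivAt (fun x => Y x i) ((ContinuousLinearMap.proj i).comp (fderiv ℝ Y e)) e :=
    fun i => (ContinuousLinearMap.proj (R := ℝ) (φ := fun _ : Fin s => E) i).hasFDerivAt.comp e hY.hasFDerivAt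
  set k : Fin s → P →L[ℝ] E := fun i =>
    ((J : (E →L[ℝ] ℝ) →L[ℝ] E).comp (fderiv ℝ (fderiv ℝ h) (Y e i))).comp
      ((ContinuousLinearMap.proj i).comp (fderiv ℝ Y e)) with hk
  have hfY : ∀ i, HasFDerivAt (fun x => f (Y x i)) (k i) e := fun i => (hdf _ (hYe i)).comp e (hYi i)
  have hcomb : ∀ c : Fin s → ℝ, HasFDerivAt (fun x => y x + τ • ∑ j, c j • f (Y x j))
      (fderiv ℝ y e + τ • ∑ j, c j • k j) e := fun c =>
    hy.hasFDerivAt.add ((HasFDerivAt.fun_sum fun j _ => (hfY j).const_smul (c j)).const_smul τ)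
  have hy' : HasFDerivAt y' (fderiv ℝ y e + τ • ∑ j, m.b j • k j) e :=
    (hcomb m.b).congr_of_eventuallyEq (hst.mono fun x hx => hx.2)
  have hYd : ∀ i, (ContinuousLinearMap.proj i).comp (fderiv ℝ Y e) =
      fderiv ℝ y e + τ • ∑ j, m.a i j • k j := fun i =>
    (hYi i).unique ((hcomb (m.a i)).congr_of_eventuallyEq (hst.mono fun x hx => (hx.1 i).2))
  refine ⟨hy'.differentiableAt, fun u v => ?_⟩
  have key := hm.bilin_eq (J.symm : E →L[ℝ] E →L[ℝ] ℝ) τ (fderiv ℝ y e u) (fderiv ℝ y e v)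
    (fun i => k i u) (fun i => k i v) (fun i => fderiv ℝ Y e u i) (fun i => fderiv ℝ Y e v i)
    (fun i => by simpa using congrArg (fun A : P →L[ℝ] E => A u) (hYd i))
    (fun i => by simpa using congrArg (fun A : P →L[ℝ] E => A v) (hYd i))
    (fun i => by
      -- The variational field is `J` composed with the Hessian, so the invariance condition on the
      -- form amounts to symmetry of the Hessian.
      have hsymm : IsSymmSndFDerivAt ℝ h (Y e i) := by
        refine (hh.contDiffAt (hD.mem_nhds (hYe i))).isSymmSndFDerivAt ?_
        rw [minSmoothness_of_isRCLikeNormedField]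
        exact WithTop.coe_le_coe.mpr (le_top : (2 : ℕ∞) ≤ ⊤)
      change J.symm _ _ + J.symm _ _ = 0
      rw [hskew (fderiv ℝ Y e u i)]
      simp only [hk, ContinuousLinearMap.comp_apply, ContinuousLinearEquiv.coe_coe,
        J.symm_apply_apply, ContinuousLinearMap.proj_apply]
      rw [hsymm.eq, neg_add_cancel])
  rw [hy'.fderiv]
  simpa using key

end RKMethod

/-! ### Structure of the Wasserstein–Hamiltonian system -/

section Phase

variable {N : ℕ}

theorem phase_apply_eq_sum (α : Phase N →L[ℝ] ℝ) (v : Phase N) :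
    α v = ∑ i, v.1 i * α (Pi.single i 1, 0) + ∑ i, v.2 i * α (0, Pi.single i 1) := by
  have h1 : α v = (α.comp (ContinuousLinearMap.inl ℝ _ _)) v.1 +
      (α.comp (ContinuousLinearMap.inr ℝ _ _)) v.2 := by
    rw [ContinuousLinearMap.comp_apply, ContinuousLinearMap.comp_apply, ← map_add]; simp
  rw [h1]
  congr 1
  · conv_lhs => rw [pi_eq_sum_univ' v.1]
    simp [map_sum]
  · conv_lhs => rw [pi_eq_sum_univ' v.2]
    simp [map_sum]

/-- The canonical isomorphism of the dual of phase space with phase space. -/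
noncomputable def symplJ (N : ℕ) : (Phase N →L[ℝ] ℝ) ≃L[ℝ] Phase N :=
  LinearEquiv.toContinuousLinearEquiv
    { toFun := fun α => (fun i => α (0, Pi.single i 1), fun i => -α (Pi.single i 1, 0))
      map_add' := fun α β => by ext i <;> simp [add_comm]
      map_smul' := fun c α => by ext i <;> simp
      invFun := fun u => LinearMap.toContinuousLinearMap
        { toFun := fun v => sympForm u v
          map_add' := fun v w => by
            simp only [sympForm, ← Finset.sum_add_distrib]
            exact Finset.sum_congr rfl fun i _ => by simp; ring
          map_smul' := fun c v => by
            simp only [sympForm, smul_eq_mul, Finset.mul_sum, RingHom.id_apply]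
            exact Finset.sum_congr rfl fun i _ => by simp; ring }
      left_inv := fun α => by
        refine ContinuousLinearMap.ext fun v => ?_
        rw [phase_apply_eq_sum α v, ← Finset.sum_add_distrib]
        change sympForm _ v = _
        exact Finset.sum_congr rfl fun i _ => by simp; ring
      right_inv := fun u => by
        ext i <;> simp [sympForm, Pi.single_apply] }

theorem symplJ_apply (α : Phase N →L[ℝ] ℝ) :
    symplJ N α = (fun i => α (0, Pi.single i 1), fun i => -α (Pi.single i 1, 0)) := rfl

theorem symplJ_skew (α β : Phase N →L[ℝ] ℝ) : α (symplJ N β) = -β (symplJ N α) := by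
  rw [phase_apply_eq_sum α, phase_apply_eq_sum β, symplJ_apply, symplJ_apply, ← Finset.sum_add_distrib,
    ← Finset.sum_add_distrib, ← Finset.sum_neg_distrib]
  exact Finset.sum_congr rfl fun i _ => by ring

theorem isOpen_positivePhase : IsOpen (positivePhase N) := by
  have : positivePhase N = ⋂ i, {y : Phase N | 0 < y.1 i} := by
    ext; simp [positivePhase]
  rw [this]
  exact isOpen_iInter_of_finite fun i => isOpen_lt continuous_const (by fun_prop)

/-- The constant shift of the potential. -/
def gaugeShift (N : ℕ) (c : ℝ) : Phase N := (0, fun _ => c)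

theorem add_gaugeShift_mem {y : Phase N} (hy : y ∈ positivePhase N) (c : ℝ) :
    y + gaugeShift N c ∈ positivePhase N := fun i => by
  simpa [gaugeShift] using hy i

theorem smul_gaugeShift (a c : ℝ) : a • gaugeShift N c = gaugeShift N (a * c) := by
  ext <;> simp [gaugeShift]

/-- The total mass. -/
noncomputable def massFun (N : ℕ) : Phase N →L[ℝ] ℝ :=
  ∑ i, (ContinuousLinearMap.proj i).comp (ContinuousLinearMap.fst ℝ (Fin N → ℝ) (Fin N → ℝ))

@[simp] theorem massFun_apply (y : Phase N) : massFun N y = ∑ i, y.1 i := by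
  simp [massFun]

theorem symplJ_massFun (c : ℝ) : symplJ N (c • massFun N) = gaugeShift N (-c) := by
  rw [symplJ_apply]
  ext i <;> simp [gaugeShift]

/-- The mass generates the gauge shift. This is used in both directions: a gauge invariant energy
has a mass-preserving field, and a function commuting with the mass is gauge invariant. -/
theorem massFun_symplJ (α : Phase N →L[ℝ] ℝ) : massFun N (symplJ N α) = α (gaugeShift N 1) := by
  rw [phase_apply_eq_sum α (gaugeShift N 1)]
  simp [symplJ_apply, gaugeShift]

end Phase

/-- Removes the case distinction on the diagonal: on positive densities the Fisher information
becomes a smooth expression, with each factor `(log x - log y)(x - y)` nonnegative. -/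
theorem logWeight_mul {x y : ℝ} (hx : 0 < x) (hy : 0 < y) :
    |Real.log x - Real.log y| ^ 2 * logWeight x y = (Real.log x - Real.log y) * (x - y) := by
  rw [sq_abs, logWeight]
  split_ifs with h
  · simp [h]
  · have : Real.log x - Real.log y ≠ 0 := sub_ne_zero.mpr fun h' => h (Real.log_injOn_pos hx hy h')
    field_simp

namespace WHSystem

variable {N : ℕ} (sys : WHSystem N)

/-- The Hamiltonian as a function on phase space. -/
noncomputable def energy (y : Phase N) : ℝ := sys.ham y.1 y.2

theorem fisher_eq {ρ : Fin N → ℝ} (hρ : ∀ i, 0 < ρ i) : sys.fisher ρ =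
    1 / 2 * ∑ i, ∑ j ∈ sys.nbr i, sys.wF i j * ((Real.log (ρ i) - Real.log (ρ j)) * (ρ i - ρ j)) := by
  rw [fisher]
  congr 1
  exact Finset.sum_congr rfl fun i _ => Finset.sum_congr rfl fun j _ => by
    rw [mul_assoc, logWeight_mul (hρ i) (hρ j)]

theorem contDiffOn_energy : ContDiffOn ℝ ∞ sys.energy (positivePhase N) := by
  have h1 : ContDiff ℝ ∞ fun y : Phase N => sys.kinetic y.1 y.2 := by
    unfold kinetic edgeInner grad averageWeight
    fun_prop
  have h2 : ContDiff ℝ ∞ fun y : Phase N => sys.linPot y.1 := by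
    unfold linPot
    fun_prop
  have h3 : ContDiff ℝ ∞ fun y : Phase N => sys.intPot y.1 := by
    unfold intPot
    fun_prop
  have h4 : ContDiffOn ℝ ∞ (fun y : Phase N => sys.fisher y.1) (positivePhase N) := by
    refine ContDiffOn.congr (f := fun y : Phase N => 1 / 2 * ∑ i, ∑ j ∈ sys.nbr i,
      sys.wF i j * ((Real.log (y.1 i) - Real.log (y.1 j)) * (y.1 i - y.1 j))) ?_ fun y hy => sys.fisher_eq hy
    have hl : ∀ i, ContDiffOn ℝ ∞ (fun y : Phase N => Real.log (y.1 i)) (positivePhase N) := fun i =>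
      ContDiffOn.log (by fun_prop) fun y hy => (hy i).ne'
    refine contDiffOn_const.mul (ContDiffOn.sum fun i _ => ContDiffOn.sum fun j _ => ?_)
    exact contDiffOn_const.mul (((hl i).sub (hl j)).mul (by fun_prop))
  exact h1.contDiffOn.add (((contDiffOn_const.mul h4).add h2.contDiffOn).add h3.contDiffOn)

theorem hasFDerivAt_energy {y : Phase N} (hy : y ∈ positivePhase N) :
    HasFDerivAt sys.energy (fderiv ℝ sys.energy y) y :=
  ((sys.contDiffOn_energy.contDiffAt (isOpen_positivePhase.mem_nhds hy)).differentiableAt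
    (by simp)).hasFDerivAt

theorem field_eq {y : Phase N} (hy : y ∈ positivePhase N) :
    sys.field y = symplJ N (fderiv ℝ sys.energy y) := by
  rw [symplJ_apply]
  have hd := sys.hasFDerivAt_energy hy
  refine Prod.ext (funext fun i => ?_) (funext fun i => ?_)
  · have h1 : HasDerivAt (fun x : ℝ => ((y.1, Function.update y.2 i x) : Phase N)) (0, Pi.single i 1) (y.2 i) :=
      (hasDerivAt_const _ _).prodMk (hasDerivAt_update y.2 i (y.2 i))
    have h2 : HasFDerivAt sys.energy (fderiv ℝ sys.energy y) (y.1, Function.update y.2 i (y.2 i)) := by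
      rwa [Function.update_eq_self]
    exact (h2.comp_hasDerivAt (y.2 i) h1).deriv
  · have h1 : HasDerivAt (fun x : ℝ => ((Function.update y.1 i x, y.2) : Phase N)) (Pi.single i 1, 0) (y.1 i) :=
      (hasDerivAt_update y.1 i (y.1 i)).prodMk (hasDerivAt_const _ _)
    have h2 : HasFDerivAt sys.energy (fderiv ℝ sys.energy y) (Function.update y.1 i (y.1 i), y.2) := by
      rwa [Function.update_eq_self]
    have h3 := (h2.comp_hasDerivAt (f := fun x : ℝ => ((Function.update y.1 i x, y.2) : Phase N))
      (y.1 i) h1).deriv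
    exact congrArg Neg.neg h3

theorem contDiffOn_field : ContDiffOn ℝ ∞ sys.field (positivePhase N) := by
  refine ContDiffOn.congr ?_ fun y hy => sys.field_eq hy
  exact (symplJ N).contDiff.comp_contDiffOn
    (sys.contDiffOn_energy.fderiv_of_isOpen isOpen_positivePhase (by simp))

theorem energy_add_gaugeShift (y : Phase N) (c : ℝ) : sys.energy (y + gaugeShift N c) = sys.energy y := by
  simp [energy, ham, kinetic, edgeInner, grad, gaugeShift]

theorem fderiv_energy_gaugeShift {y : Phase N} (hy : y ∈ positivePhase N) (c : ℝ) :
    fderiv ℝ sys.energy y (gaugeShift N c) = 0 := by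
  have h1 : HasDerivAt (fun t : ℝ => y + t • gaugeShift N c) (gaugeShift N c) 0 := by
    simpa using ((hasDerivAt_id (0 : ℝ)).smul_const (gaugeShift N c)).const_add y
  have h2 : HasFDerivAt sys.energy (fderiv ℝ sys.energy y) (y + (0 : ℝ) • gaugeShift N c) := by
    simpa using sys.hasFDerivAt_energy hy
  have h3 := h2.comp_hasDerivAt (0 : ℝ) h1
  have h4 : (sys.energy ∘ fun t : ℝ => y + t • gaugeShift N c) = fun _ => sys.energy y := by
    funext t
    rw [Function.comp_apply, smul_gaugeShift, energy_add_gaugeShift]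
  rw [h4] at h3
  exact h3.unique (hasDerivAt_const _ _)

theorem field_add_gaugeShift {y : Phase N} (hy : y ∈ positivePhase N) (c : ℝ) :
    sys.field (y + gaugeShift N c) = sys.field y := by
  rw [sys.field_eq hy, sys.field_eq (add_gaugeShift_mem hy c), ← fderiv_comp_add_right]
  simp only [energy_add_gaugeShift]

theorem massFun_field {y : Phase N} (hy : y ∈ positivePhase N) : massFun N (sys.field y) = 0 := by
  rw [sys.field_eq hy, massFun_symplJ, sys.fderiv_energy_gaugeShift hy]

theorem field_shiftPotential {y : Phase N} (hy : y ∈ positivePhase N) (α : ℝ) :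
    (sys.shiftPotential α).field y = sys.field y + gaugeShift N α := by
  have h1 : (sys.shiftPotential α).energy = fun y => sys.energy y - (α • massFun N) y := by
    funext y
    have e : (sys.shiftPotential α).linPot y.1 = sys.linPot y.1 - α * ∑ i, y.1 i := by
      simp only [linPot, shiftPotential, sub_mul, Finset.sum_sub_distrib, ← Finset.mul_sum]
    change sys.kinetic y.1 y.2 + (sys.β * sys.fisher y.1 + (sys.shiftPotential α).linPot y.1 +
      sys.intPot y.1) = _
    rw [e, energy, ham, smul_apply, massFun_apply, smul_eq_mul]
    ring
  rw [field_eq _ hy, field_eq _ hy, h1,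
    ((sys.hasFDerivAt_energy hy).fun_sub (α • massFun N).hasFDerivAt).fderiv, map_sub, symplJ_massFun]
  rw [sub_eq_add_neg]
  congr 1
  ext <;> simp [gaugeShift]

theorem field_neg (ρ S : Fin N → ℝ) :
    sys.field (ρ, -S) = (-(sys.field (ρ, S)).1, (sys.field (ρ, S)).2) := by
  have hk : ∀ ρ S : Fin N → ℝ, sys.ham ρ (-S) = sys.ham ρ S := by
    intro ρ S
    have : ∀ i j, sys.grad (-S) i j = -sys.grad S i j := fun i j => by simp [grad]; ring
    simp [ham, kinetic, edgeInner, this]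
  refine Prod.ext (funext fun i => ?_) (funext fun i => ?_)
  · simp only [field, dHdS, Pi.neg_apply]
    have h1 := deriv_comp_neg (f := fun x => sys.ham ρ (Function.update S i x)) (-S i)
    rw [neg_neg] at h1
    rw [← h1]
    · congr 1
      funext x
      rw [← hk]
      congr 1
      funext j
      by_cases h : j = i
      · subst h; simp
      · simp [h]
  · simp [field, dHdρ, hk]

theorem kinetic_const (ρ : Fin N → ℝ) (c : ℝ) : sys.kinetic ρ (fun _ => c) = 0 := by
  simp [kinetic, edgeInner, grad]

theorem fisher_smul {ρ : Fin N → ℝ} (hρ : ∀ i, 0 < ρ i) {c : ℝ} (hc : 0 < c) :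
    sys.fisher (c • ρ) = c * sys.fisher ρ := by
  rw [sys.fisher_eq hρ, sys.fisher_eq (ρ := c • ρ) fun i => mul_pos hc (hρ i), mul_left_comm]
  congr 1
  rw [Finset.mul_sum]
  refine Finset.sum_congr rfl fun i _ => ?_
  rw [Finset.mul_sum]
  refine Finset.sum_congr rfl fun j _ => ?_
  simp only [Pi.smul_apply, smul_eq_mul, Real.log_mul hc.ne' (hρ _).ne']
  ring

/-- Euler's identity: the energy consists of terms that are homogeneous of degree one and two. -/
theorem fderiv_energy_self {ρ : Fin N → ℝ} (hρ : ∀ i, 0 < ρ i) (c : ℝ) :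
    fderiv ℝ sys.energy (ρ, fun _ => c) (ρ, 0) = sys.ham ρ (fun _ => c) + sys.intPot ρ := by
  have hy : ((ρ, fun _ => c) : Phase N) ∈ positivePhase N := hρ
  have h1 : HasDerivAt (fun t : ℝ => ((ρ, fun _ => c) : Phase N) + (t - 1) • ((ρ, 0) : Phase N)) (ρ, 0) 1 := by
    simpa using (((hasDerivAt_id (1 : ℝ)).sub_const 1).smul_const ((ρ, 0) : Phase N)).const_add
      ((ρ, fun _ => c) : Phase N)
  have h2 : HasFDerivAt sys.energy (fderiv ℝ sys.energy (ρ, fun _ => c))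
      (((ρ, fun _ => c) : Phase N) + ((1 : ℝ) - 1) • ((ρ, 0) : Phase N)) := by
    simpa using sys.hasFDerivAt_energy hy
  have h3 := h2.comp_hasDerivAt (1 : ℝ) h1
  have h4 : HasDerivAt (fun t : ℝ => t * (sys.β * sys.fisher ρ + sys.linPot ρ) + t ^ 2 * sys.intPot ρ)
      (1 * (sys.β * sys.fisher ρ + sys.linPot ρ) + ((2 : ℕ) * 1 ^ (2 - 1)) * sys.intPot ρ) 1 :=
    ((hasDerivAt_id (1 : ℝ)).mul_const _).add ((hasDerivAt_pow 2 (1 : ℝ)).mul_const _)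
  have h5 : (sys.energy ∘ fun t : ℝ => ((ρ, fun _ => c) : Phase N) + (t - 1) • ((ρ, 0) : Phase N))
      =ᶠ[𝓝 1] fun t : ℝ => t * (sys.β * sys.fisher ρ + sys.linPot ρ) + t ^ 2 * sys.intPot ρ := by
    filter_upwards [lt_mem_nhds (zero_lt_one : (0 : ℝ) < 1)] with t ht
    have e : ((ρ, fun _ => c) : Phase N) + (t - 1) • ((ρ, 0) : Phase N) = (t • ρ, fun _ => c) := by
      refine Prod.ext (funext fun i => ?_) (funext fun i => ?_)
      · simp; ring
      · simp
    rw [Function.comp_apply, e, energy, ham, kinetic_const, sys.fisher_smul hρ ht]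
    have e1 : sys.linPot (t • ρ) = t * sys.linPot ρ := by
      simp only [linPot, Finset.mul_sum, Pi.smul_apply, smul_eq_mul]
      exact Finset.sum_congr rfl fun i _ => by ring
    have e2 : sys.intPot (t • ρ) = t ^ 2 * sys.intPot ρ := by
      simp only [intPot, Finset.mul_sum, Pi.smul_apply, smul_eq_mul]
      exact Finset.sum_congr rfl fun i _ => Finset.sum_congr rfl fun j _ => by ring
    rw [e1, e2]; ring
  rw [h3.unique (h4.congr_of_eventuallyEq h5), ham, kinetic_const]
  norm_num
  ring

/-- A density with constant potential is stationary with velocity `v` if and only if it is a critical point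
of the Hamiltonian with the corresponding critical value. -/
theorem stationary_iff {ρ : Fin N → ℝ} (hρ : ρ ∈ interiorSimplex N) (c v : ℝ) :
    (sys.IsCritical (ρ, fun _ => c) ∧ v = sys.ham ρ (fun _ => c) + sys.intPot ρ) ↔
      sys.field (ρ, fun _ => c) = gaugeShift N (-v) := by
  have hy : ((ρ, fun _ => c) : Phase N) ∈ positivePhase N := hρ.1
  have hE := sys.fderiv_energy_self hρ.1 c
  have hcrit : ∀ σ η : Fin N → ℝ,
      HasDerivAt (fun t : ℝ => sys.ham (ρ + t • σ) ((fun _ => c) + t • η))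
        (fderiv ℝ sys.energy (ρ, fun _ => c) (σ, η)) 0 := by
    intro σ η
    have h1 : HasDerivAt (fun t : ℝ => ((ρ, fun _ => c) : Phase N) + t • ((σ, η) : Phase N)) (σ, η) 0 := by
      simpa using ((hasDerivAt_id (0 : ℝ)).smul_const ((σ, η) : Phase N)).const_add ((ρ, fun _ => c) : Phase N)
    have h2 : HasFDerivAt sys.energy (fderiv ℝ sys.energy (ρ, fun _ => c))
        (((ρ, fun _ => c) : Phase N) + (0 : ℝ) • ((σ, η) : Phase N)) := by
      simpa using sys.hasFDerivAt_energy hy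
    exact h2.comp_hasDerivAt (0 : ℝ) h1
  rw [sys.field_eq hy, symplJ_apply]
  constructor
  · rintro ⟨⟨-, hc⟩, hv⟩
    have hz : ∀ σ η : Fin N → ℝ, ∑ i, σ i = 0 → fderiv ℝ sys.energy (ρ, fun _ => c) (σ, η) = 0 :=
      fun σ η hσ => (hcrit σ η).unique (hc σ η hσ)
    refine Prod.ext (funext fun i => ?_) (funext fun i => ?_)
    · exact hz 0 _ (by simp)
    · have h1 := hz (Pi.single i 1 - ρ) 0 (by simp [hρ.2])
      have h2 : ((Pi.single i 1 - ρ, 0) : Phase N) = (Pi.single i 1, 0) - (ρ, 0) := by simp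
      rw [h2, map_sub, hE, ← hv, sub_eq_zero] at h1
      simp [gaugeShift, h1]
  · intro h
    have h1 : ∀ i, fderiv ℝ sys.energy (ρ, fun _ => c) (0, Pi.single i 1) = 0 := fun i =>
      congrFun (congrArg Prod.fst h) i
    have h2 : ∀ i, fderiv ℝ sys.energy (ρ, fun _ => c) (Pi.single i 1, 0) = v := fun i =>
      neg_injective (congrFun (congrArg Prod.snd h) i)
    have h3 : ∀ σ η : Fin N → ℝ, fderiv ℝ sys.energy (ρ, fun _ => c) (σ, η) = (∑ i, σ i) * v := by
      intro σ η
      rw [phase_apply_eq_sum]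
      simp [h1, h2, Finset.sum_mul]
    refine ⟨⟨hρ, fun σ η hσ => ?_⟩, ?_⟩
    · have := hcrit σ η
      rwa [h3, hσ, zero_mul] at this
    · rw [← hE, h3, hρ.2, one_mul]

end WHSystem

/-! ### Invariances of the scheme and its stationary solutions -/

namespace RKMethod

variable {N s : ℕ} {m : RKMethod s} {sys : WHSystem N}

theorem sum_smul_add_const {E : Type*} [AddCommGroup E] [Module ℝ E] (c : Fin s → ℝ) (v : Fin s → E) (w : E) :
    ∑ j, c j • (v j + w) = ∑ j, c j • v j + (∑ j, c j) • w := by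
  simp [smul_add, Finset.sum_add_distrib, Finset.sum_smul]

theorem Step.mass_eq {τ : ℝ} {y z : Phase N} (h : m.Step sys τ y z) : ∑ i, z.1 i = ∑ i, y.1 i := by
  obtain ⟨Y, hY, rfl⟩ := h
  have : massFun N (m.update sys.field τ y Y) = massFun N y := by
    simp only [update, map_add, map_smul, map_sum, fun j => sys.massFun_field (hY j).1]
    simp
  simpa using this

/-- Reversal of the potential. -/
noncomputable def reversal (N : ℕ) : Phase N →L[ℝ] Phase N :=
  (ContinuousLinearMap.id ℝ (Fin N → ℝ)).prodMap (-ContinuousLinearMap.id ℝ (Fin N → ℝ))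

theorem reversal_apply (y : Phase N) : reversal N y = (y.1, -y.2) := rfl

theorem field_reversal (y : Phase N) : sys.field (reversal N y) = -reversal N (sys.field y) := by
  rw [reversal_apply, sys.field_neg]
  ext <;> simp [reversal_apply]

theorem Step.reversal {τ : ℝ} {y z : Phase N} (h : m.Step sys τ y z) :
    m.Step sys (-τ) (RKMethod.reversal N y) (RKMethod.reversal N z) := by
  obtain ⟨Y, hY, rfl⟩ := h
  refine ⟨fun i => RKMethod.reversal N (Y i), fun i => ⟨(hY i).1, ?_⟩, ?_⟩
  · change RKMethod.reversal N (Y i) = _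
    conv_lhs => rw [(hY i).2]
    simp [field_reversal]
  · simp [update, field_reversal]

/-- The shifted potential adds a constant gauge vector to the field. Hence stage `i` is shifted in
proportion to its abscissa `∑ j, a i j`, and the end value in proportion to `∑ j, b j = 1`. -/
theorem Step.gauge (hsum : ∑ i, m.b i = 1) {τ : ℝ} {y z : Phase N} (h : m.Step sys τ y z) (α κ : ℝ) :
    m.Step (sys.shiftPotential α) τ (y + gaugeShift N κ) (z + gaugeShift N (κ + α * τ)) := by
  obtain ⟨Y, hY, rfl⟩ := h
  have hadd : ∀ a b, gaugeShift N (a + b) = gaugeShift N a + gaugeShift N b := fun a b => by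
    ext <;> simp [gaugeShift]
  have hf : ∀ j c, (sys.shiftPotential α).field (Y j + gaugeShift N c) = sys.field (Y j) + gaugeShift N α :=
    fun j c => by rw [sys.field_shiftPotential (add_gaugeShift_mem (hY j).1 c), sys.field_add_gaugeShift (hY j).1]
  refine ⟨fun i => Y i + gaugeShift N (κ + (τ * ∑ j, m.a i j) * α),
    fun i => ⟨add_gaugeShift_mem (hY i).1 _, ?_⟩, ?_⟩
  · simp only [hf]
    rw [sum_smul_add_const, hadd, ← smul_gaugeShift, smul_add, mul_smul]
    conv_lhs => rw [(hY i).2]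
    abel
  · simp only [update, hf]
    rw [sum_smul_add_const, hsum, one_smul, hadd, mul_comm α, ← smul_gaugeShift, smul_add]
    abel

/-- If the vector field is a constant gauge direction at `y`, the scheme moves in this direction. -/
theorem isStages_of_field_eq {y : Phase N} (hy : y ∈ positivePhase N) {v : ℝ}
    (hv : sys.field y = gaugeShift N v) (τ : ℝ) :
    m.IsStages sys.field (positivePhase N) τ y (fun i => y + gaugeShift N ((τ * ∑ j, m.a i j) * v)) := by
  refine fun i => ⟨add_gaugeShift_mem hy _, ?_⟩
  simp only [sys.field_add_gaugeShift hy, hv]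
  rw [← Finset.sum_smul, smul_smul, ← smul_gaugeShift]

theorem update_of_field_eq (hsum : ∑ i, m.b i = 1) {y : Phase N} (hy : y ∈ positivePhase N) {v : ℝ}
    (hv : sys.field y = gaugeShift N v) (τ : ℝ) :
    m.update sys.field τ y (fun i => y + gaugeShift N ((τ * ∑ j, m.a i j) * v)) =
      y + gaugeShift N (τ * v) := by
  simp only [update, sys.field_add_gaugeShift hy, hv]
  rw [← Finset.sum_smul, hsum, one_smul, smul_gaugeShift]

theorem norm_gaugeShift_le (v : ℝ) : ‖gaugeShift N v‖ ≤ |v| := by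
  refine norm_prod_le_iff.mpr ⟨by simp [gaugeShift], ?_⟩
  exact (pi_norm_le_iff_of_nonneg (abs_nonneg v)).mpr fun i => le_rfl

theorem abs_sum_a_le (m : RKMethod s) (i : Fin s) : |∑ j, m.a i j| ≤ m.size :=
  (Finset.abs_sum_le_sum_abs _ _).trans (m.sum_a_le_size i)

/-- Near a given point and for small step sizes, only equilibria (up to the gauge) are fixed by the scheme
up to the gauge. -/
theorem exists_field_eq_of_step (sys : WHSystem N) (hsum : ∑ i, m.b i = 1) {z : Phase N}
    (hz : z ∈ positivePhase N) :
    ∃ δ > 0, ∃ τ₀ > 0, ∀ τ : ℝ, τ ≠ 0 → |τ| ≤ τ₀ → ∀ v : ℝ,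
      m.StepNear sys δ τ z (z + gaugeShift N (τ * v)) → sys.field z = gaugeShift N v := by
  obtain ⟨g, hg, hgc, hgf⟩ := exists_contDiff_hasCompactSupport_eventuallyEq isOpen_positivePhase
    isCompact_singleton (Set.singleton_subset_iff.mpr hz) sys.contDiffOn_field
  rw [nhdsSet_singleton] at hgf
  obtain ⟨L, hL⟩ := hg.lipschitzWith_of_hasCompactSupport hgc (by simp)
  obtain ⟨M, hM⟩ := hgc.exists_bound_of_continuous hg.continuous
  obtain ⟨ε, hε, hball⟩ := Metric.eventually_nhds_iff_ball.mp hgf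
  have hM0 : 0 ≤ M := (norm_nonneg _).trans (hM z)
  have hs0 := m.size_nonneg
  have hL0 : (0 : ℝ) ≤ L := L.2
  -- The first bound keeps the gauge-corrected stages in the ball where `g` is the field; the second
  -- makes the estimate `hGn` below a contraction. Neither involves `v`, because `w` is a
  -- combination of field values and so is bounded by `m.size * M`.
  refine ⟨ε / 3, by positivity, min (ε / 3 / (m.size * (m.size * M) + 1)) (1 / (2 * ((m.size + 1) * (L * m.size) + 1))),
    by positivity, fun τ hτ hτ₀ v hstep => ?_⟩
  have hτ1 : |τ| * (m.size * (m.size * M)) ≤ ε / 3 := by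
    have h1 := hτ₀.trans (min_le_left _ _)
    rw [le_div_iff₀ (by positivity)] at h1
    nlinarith [abs_nonneg τ]
  have hτ2 : (m.size + 1) * (L * m.size * |τ|) ≤ 1 / 2 := by
    have h1 := hτ₀.trans (min_le_right _ _)
    rw [le_div_iff₀ (by positivity)] at h1
    nlinarith [abs_nonneg τ]
  obtain ⟨Y, hY, hup⟩ := hstep
  have hYD : ∀ i, Y i ∈ positivePhase N := fun i => (hY i).1.1
  have hYd : ∀ i, dist (Y i) z ≤ ε / 3 := fun i => (hY i).1.2
  have hfg : ∀ x, dist x z < ε → sys.field x = g x := fun x hx => (hball x hx).symm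
  have hfM : ∀ j, ‖sys.field (Y j)‖ ≤ M := fun j => by
    rw [hfg _ (by linarith [hYd j])]; exact hM _
  set w : Phase N := gaugeShift N v with hw
  have hbw : ∑ j, m.b j • sys.field (Y j) = w := by
    rw [update, add_right_inj, ← smul_gaugeShift] at hup
    exact (smul_right_injective _ hτ hup).symm
  have hwn : ‖w‖ ≤ m.size * M := by
    rw [← hbw]; exact norm_sum_smul_le m.sum_b_le_size hM0 hfM
  -- Deviation of the stage values of the field from the pure gauge vector; its weighted sum is
  -- zero.
  set G : Fin s → Phase N := fun j => sys.field (Y j) - w with hG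
  have hGb : ∑ j, m.b j • G j = 0 := by
    simp only [hG, sub_eq_add_neg]
    rw [sum_smul_add_const, hbw, hsum, one_smul, add_neg_cancel]
  -- Removing the displacement due to `w` changes only the gauge, hence not the field, and leaves a
  -- distance to `z` controlled by `|τ|` times the norm of `G`.
  set Y' : Fin s → Phase N := fun i => Y i + gaugeShift N (-(τ * ∑ j, m.a i j) * v) with hY'
  have hY'e : ∀ i, Y' i - z = τ • ∑ j, m.a i j • G j := by
    intro i
    simp only [hY', hG, sub_eq_add_neg (sys.field _)]
    rw [sum_smul_add_const, ← smul_gaugeShift, ← hw, smul_add, smul_neg, smul_neg, smul_smul, neg_smul]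
    conv_lhs => rw [(hY i).2]
    abel
  have hY'd : ∀ i, dist (Y' i) z < ε := by
    intro i
    have h1 : dist (Y' i) (Y i) ≤ ε / 3 := by
      rw [dist_eq_norm, hY', add_sub_cancel_left, ← smul_gaugeShift, norm_smul, Real.norm_eq_abs, abs_neg,
        abs_mul, mul_assoc]
      refine le_trans ?_ hτ1
      gcongr
      exact m.abs_sum_a_le i
    have := dist_triangle (Y' i) (Y i) z
    linarith [hYd i]
  have hfY' : ∀ i, sys.field (Y i) = g (Y' i) := fun i => by
    rw [← hfg _ (hY'd i), hY', sys.field_add_gaugeShift (hYD i)]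
  have hdiff : ∀ i, ‖G i - (sys.field z - w)‖ ≤ L * m.size * |τ| * ‖G‖ := by
    intro i
    rw [hG, sub_sub_sub_cancel_right, hfY', hfg z (by simpa using hε)]
    refine (hL.norm_sub_le _ _).trans ?_
    rw [hY'e, norm_smul, Real.norm_eq_abs]
    have h1 := norm_sum_smul_le (m.sum_a_le_size i) (norm_nonneg G) (norm_le_pi_norm G)
    calc (L : ℝ) * (|τ| * ‖∑ j, m.a i j • G j‖) ≤ L * (|τ| * (m.size * ‖G‖)) := by gcongr
      _ = _ := by ring
  have h0 : ‖sys.field z - w‖ ≤ m.size * (L * m.size * |τ| * ‖G‖) := by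
    have e : ∑ j, m.b j • (G j - (sys.field z - w)) = -(sys.field z - w) := by
      simp only [sub_eq_add_neg (G _)]
      rw [sum_smul_add_const, hGb, hsum, one_smul, zero_add]
    rw [← norm_neg, ← e]
    exact norm_sum_smul_le m.sum_b_le_size (by positivity) hdiff
  -- Each `G i` is close to `field z - w`, which is itself small because the weighted sum of the `G
  -- i` is zero. Hence `G = 0`, and the field at `z` equals `w`.
  have hGn : ‖G‖ ≤ 1 / 2 * ‖G‖ := by
    refine (pi_norm_le_iff_of_nonneg (by positivity)).mpr fun i => ?_
    have h1 := norm_le_norm_add_norm_sub' (G i) (sys.field z - w)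
    have h2 := hdiff i
    nlinarith [norm_nonneg G]
  have hG0 : ‖G‖ = 0 := le_antisymm (by linarith) (norm_nonneg _)
  rw [hG0, mul_zero, mul_zero] at h0
  exact sub_eq_zero.mp (norm_le_zero_iff.mp h0)

theorem stationaryState_eq (ρ : Fin N → ℝ) (v τ : ℝ) (n : ℕ) :
    stationaryState ρ v τ n = (ρ, fun _ => 0) + gaugeShift N (-(v * n * τ)) := by
  ext <;> simp [stationaryState, gaugeShift]

theorem stationaryState_succ (ρ : Fin N → ℝ) (v τ : ℝ) (n : ℕ) :
    stationaryState ρ v τ (n + 1) = stationaryState ρ v τ n + gaugeShift N (τ * -v) := by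
  ext
  · simp [stationaryState, gaugeShift]
  · simp [stationaryState, gaugeShift]; ring

/-- The states for different `n` differ by a gauge shift, so the condition does not depend on `n`
and reduces to one equation at `S = 0`. -/
theorem stationary_iff_field {ρ : Fin N → ℝ} (hρ : ρ ∈ interiorSimplex N) (v τ : ℝ) :
    (∀ n : ℕ, sys.IsCritical (stationaryState ρ v τ n) ∧
      v = sys.ham ρ (stationaryState ρ v τ n).2 + 1 / 2 * ∑ i, ∑ j, sys.W i j * ρ i * ρ j) ↔
      sys.field (ρ, fun _ => 0) = gaugeShift N (-v) := by
  have h1 : ∀ n : ℕ, (sys.IsCritical (stationaryState ρ v τ n) ∧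
      v = sys.ham ρ (stationaryState ρ v τ n).2 + 1 / 2 * ∑ i, ∑ j, sys.W i j * ρ i * ρ j) ↔
      sys.field (ρ, fun _ => 0) = gaugeShift N (-v) := by
    intro n
    have h2 := sys.stationary_iff hρ (-(v * n * τ)) v
    have h3 : sys.field (ρ, fun _ => -(v * n * τ)) = sys.field (ρ, fun _ => 0) := by
      have h4 := stationaryState_eq ρ v τ n
      change ((ρ, fun _ => -(v * n * τ)) : Phase N) = _ at h4
      rw [h4]
      exact sys.field_add_gaugeShift (y := (ρ, fun _ => 0)) hρ.1 _
    rw [h3] at h2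
    exact h2
  exact ⟨fun h => (h1 0).mp (h 0), fun h n => (h1 n).mpr h⟩

theorem stationary_steps (hsum : ∑ i, m.b i = 1) {ρ : Fin N → ℝ} (hρ : ρ ∈ interiorSimplex N) {v : ℝ}
    (hv : sys.field (ρ, fun _ => 0) = gaugeShift N (-v)) {τ δ : ℝ} (hδ : m.size * (|τ| * |v|) ≤ δ) (n : ℕ) :
    m.StepNear sys δ τ (stationaryState ρ v τ n) (stationaryState ρ v τ (n + 1)) := by
  have hy : stationaryState ρ v τ n ∈ positivePhase N := hρ.1
  have hf : sys.field (stationaryState ρ v τ n) = gaugeShift N (-v) := by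
    rw [stationaryState_eq, sys.field_add_gaugeShift (y := (ρ, fun _ => 0)) hρ.1, hv]
  refine ⟨_, fun i => ⟨⟨(isStages_of_field_eq hy hf τ i).1, ?_⟩, (isStages_of_field_eq hy hf τ i).2⟩, ?_⟩
  · rw [Metric.mem_closedBall, dist_eq_norm, add_sub_cancel_left]
    refine (norm_gaugeShift_le _).trans (le_trans ?_ hδ)
    rw [abs_mul, abs_mul, abs_neg, mul_comm |τ|, mul_assoc]
    exact mul_le_mul_of_nonneg_right (m.abs_sum_a_le i) (by positivity)
  · rw [update_of_field_eq hsum hy hf, stationaryState_succ]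

theorem stationary_solutions (sys : WHSystem N) (hsum : ∑ i, m.b i = 1) {ρ : Fin N → ℝ}
    (hρ : ρ ∈ interiorSimplex N) :
    (∃ δ > 0, ∃ τ₀ > 0, ∀ τ : ℝ, τ ≠ 0 → |τ| ≤ τ₀ → ∀ v : ℝ,
        ((∀ n : ℕ, m.StepNear sys δ τ (stationaryState ρ v τ n) (stationaryState ρ v τ (n + 1))) ↔
          ∀ n : ℕ, sys.IsCritical (stationaryState ρ v τ n) ∧
            v = sys.ham ρ (stationaryState ρ v τ n).2 + 1 / 2 * ∑ i, ∑ j, sys.W i j * ρ i * ρ j)) ∧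
      ∀ τ v : ℝ,
        (∀ n : ℕ, sys.IsCritical (stationaryState ρ v τ n) ∧
          v = sys.ham ρ (stationaryState ρ v τ n).2 + 1 / 2 * ∑ i, ∑ j, sys.W i j * ρ i * ρ j) →
        ∀ n : ℕ, m.Step sys τ (stationaryState ρ v τ n) (stationaryState ρ v τ (n + 1)) := by
  have hs0 := m.size_nonneg
  constructor
  · obtain ⟨δ, hδ, τ₁, hτ₁, h⟩ := exists_field_eq_of_step (m := m) sys hsum (z := (ρ, fun _ => 0)) hρ.1
    set v₀ : ℝ := sys.ham ρ (fun _ => 0) + sys.intPot ρ with hv₀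
    -- The condition forces `v = v₀`, a number determined by `ρ`, so the bound on the step size need
    -- not depend on `v`.
    refine ⟨δ, hδ, min τ₁ (δ / (m.size * |v₀| + 1)), by positivity, fun τ hτ hτ₀ v => ?_⟩
    rw [stationary_iff_field hρ]
    constructor
    · intro hst
      refine h τ hτ (hτ₀.trans (min_le_left _ _)) (-v) ?_
      have h0 := hst 0
      rw [stationaryState_succ] at h0
      have e : stationaryState ρ v τ 0 = (ρ, fun _ => 0) := by simp [stationaryState]
      rwa [e] at h0
    · intro hf
      have hv : v = v₀ := ((sys.stationary_iff hρ 0 v).mpr hf).2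
      refine stationary_steps hsum hρ hf ?_
      have h1 := hτ₀.trans (min_le_right _ _)
      rw [le_div_iff₀ (by positivity)] at h1
      rw [hv]
      nlinarith [abs_nonneg τ]
  · intro τ v hc n
    rw [stationary_iff_field hρ] at hc
    obtain ⟨Y, hY, hup⟩ := stationary_steps (m := m) hsum hρ hc (τ := τ) le_rfl n
    exact ⟨Y, fun i => ⟨(hY i).1.1, (hY i).2⟩, hup⟩

end RKMethod

/-! ### A priori bounds from the excess energy -/

namespace WHSystem

variable {N : ℕ} (sys : WHSystem N)

theorem mem_nbr {i j : Fin N} : j ∈ sys.nbr i ↔ sys.graph.Adj i j := by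
  classical simp [nbr]

theorem sum_edges_nonneg {f : Fin N → Fin N → ℝ} (hf : ∀ i j, sys.graph.Adj i j → 0 ≤ f i j) :
    0 ≤ ∑ i, ∑ j ∈ sys.nbr i, f i j :=
  Finset.sum_nonneg fun i _ => Finset.sum_nonneg fun j hj => hf i j (sys.mem_nbr.mp hj)

theorem edge_le_sum_edges {f : Fin N → Fin N → ℝ} (hf : ∀ i j, sys.graph.Adj i j → 0 ≤ f i j)
    {i j : Fin N} (h : sys.graph.Adj i j) : f i j ≤ ∑ i, ∑ j ∈ sys.nbr i, f i j :=
  (Finset.single_le_sum (f := fun j => f i j) (fun j hj => hf i j (sys.mem_nbr.mp hj))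
    (sys.mem_nbr.mpr h)).trans
    (Finset.single_le_sum (f := fun i => ∑ j ∈ sys.nbr i, f i j)
      (fun i _ => Finset.sum_nonneg fun j hj => hf i j (sys.mem_nbr.mp hj)) (Finset.mem_univ i))

theorem kinetic_eq (ρ S : Fin N → ℝ) : sys.kinetic ρ S =
    1 / 4 * ∑ i, ∑ j ∈ sys.nbr i, sys.w i j * (S i - S j) ^ 2 * ((ρ i + ρ j) / 2) := by
  have : ∀ i, ∀ j ∈ sys.nbr i, sys.grad S i j * sys.grad S i j * averageWeight (ρ i) (ρ j) =
      sys.w i j * (S i - S j) ^ 2 * ((ρ i + ρ j) / 2) := by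
    intro i j hj
    rw [grad, averageWeight]
    linear_combination (S i - S j) ^ 2 * ((ρ i + ρ j) / 2) * Real.mul_self_sqrt (sys.w_pos i j (sys.mem_nbr.mp hj)).le
  rw [kinetic, edgeInner, Finset.sum_congr rfl fun i _ => Finset.sum_congr rfl (this i)]
  ring

theorem kinetic_edge_nonneg {ρ : Fin N → ℝ} (hρ : ∀ i, 0 < ρ i) (S : Fin N → ℝ) (i j : Fin N)
    (h : sys.graph.Adj i j) : 0 ≤ sys.w i j * (S i - S j) ^ 2 * ((ρ i + ρ j) / 2) := by
  have := sys.w_pos i j h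
  have := hρ i
  have := hρ j
  positivity

theorem fisher_edge_nonneg {ρ : Fin N → ℝ} (hρ : ∀ i, 0 < ρ i) (i j : Fin N)
    (h : sys.graph.Adj i j) : 0 ≤ sys.wF i j * ((Real.log (ρ i) - Real.log (ρ j)) * (ρ i - ρ j)) := by
  refine mul_nonneg (sys.wF_pos i j h).le ?_
  rcases le_total (ρ i) (ρ j) with h' | h'
  · exact mul_nonneg_of_nonpos_of_nonpos (by linarith [Real.log_le_log (hρ i) h']) (by linarith)
  · exact mul_nonneg (by linarith [Real.log_le_log (hρ j) h']) (by linarith)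

theorem kinetic_nonneg {ρ : Fin N → ℝ} (hρ : ∀ i, 0 < ρ i) (S : Fin N → ℝ) : 0 ≤ sys.kinetic ρ S := by
  rw [kinetic_eq]
  exact mul_nonneg (by norm_num) (sys.sum_edges_nonneg (sys.kinetic_edge_nonneg hρ S))

theorem fisher_nonneg {ρ : Fin N → ℝ} (hρ : ∀ i, 0 < ρ i) : 0 ≤ sys.fisher ρ := by
  rw [sys.fisher_eq hρ]
  exact mul_nonneg (by norm_num) (sys.sum_edges_nonneg (sys.fisher_edge_nonneg hρ))

theorem kinetic_add_fisher_le_excessEnergy {y : Phase N} (hy : y.1 ∈ interiorSimplex N) :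
    sys.kinetic y.1 y.2 + sys.β * sys.fisher y.1 ≤ sys.excessEnergy y := by
  have hc : Continuous fun ρ => sys.linPot ρ + sys.intPot ρ := by
    unfold linPot intPot
    fun_prop
  have h1 : sInf ((fun ρ => sys.linPot ρ + sys.intPot ρ) '' stdSimplex ℝ (Fin N)) ≤
      sys.linPot y.1 + sys.intPot y.1 :=
    csInf_le ((isCompact_stdSimplex ℝ (Fin N)).image hc).bddBelow ⟨y.1, ⟨fun i => (hy.1 i).le, hy.2⟩, rfl⟩
  rw [excessEnergy, ham]
  linarith

theorem le_one_of_mem_interiorSimplex {ρ : Fin N → ℝ} (hρ : ρ ∈ interiorSimplex N) (i : Fin N) : ρ i ≤ 1 :=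
  hρ.2 ▸ Finset.single_le_sum (fun j _ => (hρ.1 j).le) (Finset.mem_univ i)

theorem exists_inv_card_le [NeZero N] {ρ : Fin N → ℝ} (hρ : ρ ∈ interiorSimplex N) :
    ∃ i, (N : ℝ)⁻¹ ≤ ρ i := by
  by_contra! h
  have h1 : ∑ i, ρ i < ∑ _i : Fin N, (N : ℝ)⁻¹ :=
    Finset.sum_lt_sum_of_nonempty Finset.univ_nonempty fun i _ => h i
  rw [hρ.2, Finset.sum_const, Finset.card_univ, Fintype.card_fin, nsmul_eq_mul,
    mul_inv_cancel₀ (NeZero.ne _)] at h1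
  exact lt_irrefl _ h1

/-- Either `y` is at least `a / 2`, or the factor `x - y` is at least `a / 2`, and then the
difference of logarithms is at most `2 * B / a`. -/
theorem min_le_of_log_sub_log_mul_le {x y a B : ℝ} (hy : 0 < y) (ha : 0 < a) (hx : a ≤ x)
    (h : (Real.log x - Real.log y) * (x - y) ≤ B) : min (a / 2) (a * Real.exp (-(2 * B / a))) ≤ y := by
  rcases le_or_gt (a / 2) y with h1 | h1
  · exact (min_le_left _ _).trans h1
  · refine (min_le_right _ _).trans ?_
    have hl : 0 ≤ Real.log x - Real.log y := by
      linarith [Real.log_le_log hy (by linarith : y ≤ x)]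
    have h2 : (Real.log x - Real.log y) * (a / 2) ≤ B :=
      (mul_le_mul_of_nonneg_left (by linarith) hl).trans h
    have h3 : Real.log x - Real.log y ≤ 2 * B / a := by
      rw [le_div_iff₀ ha]; linarith
    rw [← Real.log_le_log_iff (by positivity) hy, Real.log_mul ha.ne' (Real.exp_pos _).ne', Real.log_exp]
    linarith [Real.log_le_log ha hx]

/-- A bound on the excess energy keeps the densities away from zero. -/
theorem exists_density_lower_bound (ε : ℝ) : ∃ c > 0, ∀ y : Phase N, y.1 ∈ interiorSimplex N →
    sys.excessEnergy y / sys.β ≤ ε → ∀ i, c ≤ y.1 i := by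
  have hN : Nonempty (Fin N) := sys.connected.nonempty
  have : NeZero N := ⟨fun h => by subst h; exact hN.elim fun i => i.elim0⟩
  -- Lower bounds propagate along walks, since the Fisher term of each edge is bounded by the excess
  -- energy. They start at a node of density at least `1 / N`, which varies with the state; finitely
  -- many nodes allow a common constant.
  have hstep : ∀ i j, sys.graph.Reachable i j → ∀ a > 0, ∃ a' > 0, ∀ y : Phase N,
      y.1 ∈ interiorSimplex N → sys.excessEnergy y / sys.β ≤ ε → a ≤ y.1 i → a' ≤ y.1 j := by
    rintro i j ⟨p⟩
    induction p with
    | nil => exact fun a ha => ⟨a, ha, fun y _ _ h => h⟩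
    | @cons i j k hij _ ih =>
      intro a ha
      set B : ℝ := |2 * ε / sys.wF i j|
      obtain ⟨a', ha', h⟩ := ih (min (a / 2) (a * Real.exp (-(2 * B / a)))) (by positivity)
      refine ⟨a', ha', fun y hy hε hya => h y hy hε ?_⟩
      refine min_le_of_log_sub_log_mul_le (hy.1 j) ha hya (le_trans ?_ (le_abs_self _))
      rw [le_div_iff₀ (sys.wF_pos i j hij)]
      have h1 := sys.edge_le_sum_edges (sys.fisher_edge_nonneg hy.1) hij
      have h2 := sys.kinetic_add_fisher_le_excessEnergy hy
      have h3 := sys.kinetic_nonneg hy.1 y.2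
      rw [div_le_iff₀ sys.β_pos] at hε
      have h4 : sys.fisher y.1 ≤ ε :=
        le_of_mul_le_mul_left (by linarith) sys.β_pos
      rw [sys.fisher_eq hy.1] at h4
      linarith
  have hev : ∀ i j, ∀ᶠ c in 𝓝[>] (0 : ℝ), ∀ y : Phase N, y.1 ∈ interiorSimplex N →
      sys.excessEnergy y / sys.β ≤ ε → (N : ℝ)⁻¹ ≤ y.1 i → c ≤ y.1 j := by
    intro i j
    obtain ⟨a', ha', h⟩ := hstep i j (sys.connected.preconnected i j) (N : ℝ)⁻¹
      (inv_pos.mpr (Nat.cast_pos.mpr (NeZero.pos N)))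
    filter_upwards [(eventually_le_nhds ha').filter_mono nhdsWithin_le_nhds] with c hc y hy hε hyi
    exact hc.trans (h y hy hε hyi)
  obtain ⟨c, hc, hc0⟩ := ((Filter.eventually_all.mpr fun i => Filter.eventually_all.mpr (hev i)).and
    self_mem_nhdsWithin).exists
  refine ⟨c, hc0, fun y hy hε j => ?_⟩
  obtain ⟨i, hi⟩ := exists_inv_card_le hy
  exact hc i j y hy hε hi

/-- A bound on the excess energy bounds the oscillation of the potential. -/
theorem exists_potential_bound (ε : ℝ) : ∃ R : ℝ, ∀ y : Phase N, y.1 ∈ interiorSimplex N →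
    sys.excessEnergy y / sys.β ≤ ε → ∀ i j, |y.2 i - y.2 j| ≤ R := by
  obtain ⟨c, hc, hcy⟩ := sys.exists_density_lower_bound ε
  have hstep : ∀ i j, sys.graph.Reachable i j → ∃ R : ℝ, ∀ y : Phase N,
      y.1 ∈ interiorSimplex N → sys.excessEnergy y / sys.β ≤ ε → |y.2 i - y.2 j| ≤ R := by
    rintro i j ⟨p⟩
    induction p with
    | nil => exact ⟨0, fun y _ _ => by simp⟩
    | @cons i j k hij _ ih =>
      obtain ⟨R, h⟩ := ih
      -- One edge contributes at least `w i j * (S i - S j) ^ 2 * c / 4` to the kinetic energy,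
      -- which is at most `ε β`.
      refine ⟨Real.sqrt (4 * (ε * sys.β) / (sys.w i j * c)) + R, fun y hy hε => ?_⟩
      refine (abs_sub_le _ (y.2 j) _).trans (add_le_add ?_ (h y hy hε))
      have hw := sys.w_pos i j hij
      refine Real.abs_le_sqrt ?_
      rw [le_div_iff₀ (by positivity)]
      have h1 := sys.edge_le_sum_edges (sys.kinetic_edge_nonneg hy.1 y.2) hij
      have h2 := sys.kinetic_add_fisher_le_excessEnergy hy
      have h3 := mul_nonneg sys.β_pos.le (sys.fisher_nonneg hy.1)
      have h5 := hcy y hy hε i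
      have h6 := hcy y hy hε j
      have hk := sys.kinetic_eq y.1 y.2
      rw [div_le_iff₀ sys.β_pos] at hε
      have h4 : sys.w i j * (y.2 i - y.2 j) ^ 2 * c ≤
          sys.w i j * (y.2 i - y.2 j) ^ 2 * ((y.1 i + y.1 j) / 2) :=
        mul_le_mul_of_nonneg_left (by linarith) (by positivity)
      linarith
  have hev : ∀ i j, ∀ᶠ R in Filter.atTop, ∀ y : Phase N, y.1 ∈ interiorSimplex N →
      sys.excessEnergy y / sys.β ≤ ε → |y.2 i - y.2 j| ≤ R := by
    intro i j
    obtain ⟨R, h⟩ := hstep i j (sys.connected.preconnected i j)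
    filter_upwards [Filter.eventually_ge_atTop R] with R' hR y hy hε
    exact (h y hy hε).trans hR
  obtain ⟨R, hR⟩ := (Filter.eventually_all.mpr fun i => Filter.eventually_all.mpr (hev i)).exists
  exact ⟨R, fun y hy hε i j => hR i j y hy hε⟩

end WHSystem

/-! ### Nearly conserved quantities of symplectic Runge–Kutta methods with a gauge symmetry -/

/-- Used to reparametrize the step size, so that the step map is smooth and defined for all real
times and unchanged for small ones. -/
theorem exists_smooth_truncation {r : ℝ} (hr : 0 < r) : ∃ η : ℝ → ℝ, ContDiff ℝ ∞ η ∧ (∀ t, |η t| < r) ∧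
    ∀ t, |t| ≤ r / 2 → η t = t := by
  let χ : ContDiffBump (0 : ℝ) := ⟨r / 2, r, by positivity, by linarith⟩
  refine ⟨fun t => t * χ t, contDiff_id.mul χ.contDiff, fun t => ?_, fun t ht => ?_⟩
  · rw [abs_mul, abs_of_nonneg χ.nonneg]
    rcases lt_or_ge |t| r with h | h
    · nlinarith [χ.nonneg (x := t), χ.le_one (x := t), abs_nonneg t]
    · rw [χ.zero_of_le_dist (by simpa using h), mul_zero]
      exact hr
  · have h : χ t = 1 := χ.one_of_mem_closedBall (by simpa using ht)
    simp [h]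

theorem fderiv_gauge_eq_zero {E : Type*} [NormedAddCommGroup E] [NormedSpace ℝ E] {H : E → ℝ} {g : E}
    (hg : ∀ y (c : ℝ), H (y + c • g) = H y) {y : E} (hH : DifferentiableAt ℝ H y) : fderiv ℝ H y g = 0 := by
  have h1 : HasDerivAt (fun t : ℝ => y + t • g) g 0 := by
    simpa using ((hasDerivAt_id (0 : ℝ)).smul_const g).const_add y
  have h2 : HasFDerivAt H (fderiv ℝ H y) (y + (0 : ℝ) • g) := by simpa using hH.hasFDerivAt
  have h3 := h2.comp_hasDerivAt (0 : ℝ) h1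
  have h4 : H ∘ (fun t : ℝ => y + t • g) = fun _ => H y := funext fun t => hg y t
  rw [h4] at h3
  exact h3.unique (hasDerivAt_const _ _)

theorem add_smul_eq_of_fderiv_eq_zero {E : Type*} [NormedAddCommGroup E] [NormedSpace ℝ E] {H : E → ℝ} {g : E}
    (hH : Differentiable ℝ H) (hg : ∀ y, fderiv ℝ H y g = 0) (y : E) (c : ℝ) : H (y + c • g) = H y := by
  have h1 : ∀ t : ℝ, HasDerivAt (fun t : ℝ => H (y + t • g)) 0 t := fun t => by
    have h2 : HasDerivAt (fun t : ℝ => y + t • g) g t := by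
      simpa using ((hasDerivAt_id t).smul_const g).const_add y
    have h3 := (hH (y + t • g)).hasFDerivAt.comp_hasDerivAt t h2
    rw [hg] at h3
    exact h3
  have := is_const_of_deriv_eq_zero (fun t => (h1 t).differentiableAt) (fun t => (h1 t).deriv) c 0
  simpa using this

namespace RKMethod

variable {s : ℕ} {m : RKMethod s}

/-- The point is uniformity along the gauge orbits: `Φ` commutes with the shifts along `g`, and `H`
and `K` are constant along them, so bounds on a compact set `A` hold on all its translates. -/
theorem IsSymplectic.exists_nearly_conserved (hm : m.IsSymplectic) {E : Type} [NormedAddCommGroup E]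
    [NormedSpace ℝ E] [FiniteDimensional ℝ E] {J : (E →L[ℝ] ℝ) ≃L[ℝ] E}
    (hJ : ∀ α β : E →L[ℝ] ℝ, α (J β) = -β (J α)) {g : E} {μ : E →L[ℝ] ℝ} (hμ : ∀ α, μ (J α) = α g)
    {H : E → ℝ} (hH : ContDiff ℝ ∞ H) (hHg : ∀ y (c : ℝ), H (y + c • g) = H y) {f : E → E}
    (hf : ∀ y, f y = J (fderiv ℝ H y)) {L : NNReal} (hL : LipschitzWith L f) {M : ℝ} (hM : ∀ x, ‖f x‖ ≤ M)
    {r n : ℕ} (hr : m.HasOrder r) (hrn : r ≤ n) :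
    ∃ τ₁ > 0, ∃ Φ : ℝ → E → E, ∃ K : ℝ → E → ℝ,
      (∀ τ, |τ| ≤ τ₁ → ∀ y, ∃ Z, (∀ Z', m.IsStages f Set.univ τ y Z' ↔ Z' = Z) ∧
        (∀ i, ‖Z i - y‖ ≤ m.size * M * |τ|) ∧ Φ τ y = m.update f τ y Z) ∧
      ∀ A : Set E, IsCompact A → ∃ C ≥ 0, ∀ y ∈ A, ∀ c τ : ℝ, |τ| ≤ τ₁ →
        |K τ (y + c • g) - H (y + c • g)| ≤ C * |τ| ^ r ∧
        |K τ (Φ τ (y + c • g)) - K τ (y + c • g)| ≤ C * |τ| ^ (n + 1) := by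
  have hfs : ContDiff ℝ ∞ f := by
    rw [funext hf]
    exact J.contDiff.comp (hH.fderiv_right (by simp))
  obtain ⟨τ₀, hτ₀, Y, hYs, hYu, hYb⟩ := m.exists_smooth_stages hfs hL hM
  obtain ⟨η, hηs, hη, hηid⟩ := exists_smooth_truncation hτ₀
  have hη0 : η 0 = 0 := hηid 0 (by simpa using (half_pos hτ₀).le)
  have hYη : ContDiff ℝ ∞ fun p : ℝ × E => Y (η p.1, p.2) := by
    rw [← contDiffOn_univ]
    exact hYs.comp (t := {p : ℝ × E | |p.1| < τ₀}) ((hηs.comp contDiff_fst).prodMk contDiff_snd).contDiffOn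
      fun p _ => hη p.1
  have hst : ∀ τ y, m.IsStages f Set.univ (η τ) y (Y (η τ, y)) := fun τ y =>
    (hYu (η τ, y) (hη τ) _).mpr rfl
  set Φ : ℝ × E → E := fun p => m.update f (η p.1) p.2 (Y (η p.1, p.2)) with hΦdef
  have hΦ : ContDiff ℝ ∞ Φ := by
    have : ∀ j, ContDiff ℝ ∞ fun p : ℝ × E => f (Y (η p.1, p.2) j) := fun j =>
      hfs.comp (contDiff_pi.mp hYη j)
    exact contDiff_snd.add ((hηs.comp contDiff_fst).smul
      (ContDiff.sum fun j _ => contDiff_const.smul (this j)))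
  have hΦ0 : ∀ y, Φ (0, y) = y := fun y => by simp [hΦdef, hη0, update]
  have hfg : ∀ y (c : ℝ), f (y + c • g) = f y := fun y c => by
    rw [hf, hf, ← fderiv_comp_add_right]
    simp only [hHg]
  have hYg : ∀ τ y (c : ℝ), Y (η τ, y + c • g) = fun i => Y (η τ, y) i + c • g := fun τ y c => by
    refine ((hYu (η τ, y + c • g) (hη τ) _).mp fun i => ⟨trivial, ?_⟩).symm
    simp only [hfg]
    rw [add_right_comm, ← (hst τ y i).2]
  have hΦg : ∀ τ y (c : ℝ), Φ (τ, y + c • g) = Φ (τ, y) + c • g := fun τ y c => by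
    simp only [hΦdef, update, hYg, hfg]
    abel
  have hΦs : ∀ p u v, J.symm (fderiv ℝ Φ p (0, u)) (fderiv ℝ Φ p (0, v)) = J.symm u v := by
    intro p u v
    have h1 := (hm.fderiv_update hJ isOpen_univ hH.contDiffOn (fun x _ => hf x) (e := p.2) (τ := η p.1)
      (y := fun y => y) (y' := fun y => Φ (p.1, y)) (Y := fun y => Y (η p.1, y)) differentiableAt_id
      ((hYη.comp (contDiff_const.prodMk contDiff_id)).differentiable (by simp)).differentiableAt
      (Filter.Eventually.of_forall fun y => ⟨hst p.1 y, rfl⟩)).2 u v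
    have h2 : ∀ u, fderiv ℝ (fun y => Φ (p.1, y)) p.2 u = fderiv ℝ Φ p (0, u) := fun u => by
      have h3 : HasFDerivAt Φ (fderiv ℝ Φ p) (p.1, p.2) :=
        (hΦ.differentiable (by simp) p).hasFDerivAt
      have h4 := (h3.comp p.2 (hasFDerivAt_prodMk_right p.1 p.2)).fderiv
      exact congrArg (fun A => A u) h4
    rw [h2, h2] at h1
    simpa using h1
  have hHd : Differentiable ℝ H := hH.differentiable (by simp)
  have hμf : ∀ y, μ (f y) = 0 := fun y => by
    rw [hf, hμ, fderiv_gauge_eq_zero hHg (hHd y)]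
  have hμΦ : ∀ p, μ (Φ p) = μ p.2 := fun p => by
    simp [hΦdef, update, hμf]
  have hμH : ∀ y, fderiv ℝ μ y (J (fderiv ℝ H y)) = 0 := fun y => by
    rw [μ.fderiv, ← hf, hμf]
  have hηev : ∀ᶠ t in 𝓝 (0 : ℝ), η t = t := by
    filter_upwards [Metric.closedBall_mem_nhds (0 : ℝ) (half_pos hτ₀)] with t ht
    exact hηid t (by simpa using ht)
  have hord : ∀ y₀, ∃ z : ℝ → E, z 0 = y₀ ∧ (∀ᶠ t in 𝓝 (0 : ℝ), HasDerivAt z (J (fderiv ℝ H (z t))) t) ∧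
      (fun τ => Φ (τ, y₀) - z τ) =O[𝓝 (0 : ℝ)] fun τ => τ ^ (r + 1) := by
    intro y₀
    obtain ⟨z, hz0, ε, hε, hz⟩ := ((hfs.contDiffAt (x := y₀)).of_le (m := 1)
      (by simp)).exists_forall_mem_closedBall_exists_eq_forall_mem_Ioo_hasDerivAt₀ 0
    have hz' : ∀ᶠ t in 𝓝 (0 : ℝ), HasDerivAt z (f (z t)) t := by
      filter_upwards [Ioo_mem_nhds (by linarith : 0 - ε < 0) (by linarith : 0 < 0 + ε)] using hz
    refine ⟨z, hz0, by simpa only [hf] using hz', ?_⟩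
    have hτev : ∀ᶠ τ in 𝓝 (0 : ℝ), |τ| < τ₀ := by
      filter_upwards [Metric.ball_mem_nhds (0 : ℝ) hτ₀] with t ht
      simpa using ht
    have hlim : Filter.Tendsto (fun τ => Y (τ, y₀)) (𝓝 0) (𝓝 fun _ => y₀) := by
      refine tendsto_pi_nhds.mpr fun i => tendsto_iff_norm_sub_tendsto_zero.mpr ?_
      refine squeeze_zero' (Filter.Eventually.of_forall fun _ => norm_nonneg _)
        (hτev.mono fun τ hτ => hYb (τ, y₀) hτ i) ?_
      have : Continuous fun τ : ℝ => m.size * M * |τ| := by fun_prop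
      simpa using this.tendsto 0
    refine (hr E Set.univ f isOpen_univ hfs.contDiffOn y₀ trivial z hz0 hz' (fun τ => Y (τ, y₀))
      (hτev.mono fun τ hτ => (hYu (τ, y₀) hτ _).mpr rfl) hlim).congr' ?_ Filter.EventuallyEq.rfl
    filter_upwards [hηev] with τ hτ
    simp only [hΦdef, hτ]
  obtain ⟨K, G, R, hK, hG, hR, hKG, hKR, hKμ⟩ := exists_modified_hamiltonian_family hJ hH hΦ hΦ0 hΦs μ.contDiff
    hμΦ hμH hrn hord
  -- The derivative of `K` along `g` is its bracket with `μ`, which vanishes.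
  have hKg : ∀ τ y (c : ℝ), K (τ, y + c • g) = K (τ, y) := by
    intro τ
    have hd : Differentiable ℝ fun y => K (τ, y) :=
      (hK.comp (contDiff_const.prodMk contDiff_id)).differentiable (by simp)
    refine add_smul_eq_of_fderiv_eq_zero hd fun y => ?_
    have h3 : HasFDerivAt K (fderiv ℝ K (τ, y)) (τ, y) := (hK.differentiable (by simp) _).hasFDerivAt
    have h4 := (h3.comp y (hasFDerivAt_prodMk_right τ y)).fderiv
    have h5 := hKμ (τ, y)
    rw [μ.fderiv, hμ] at h5
    exact (congrArg (fun A => A g) h4).trans h5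
  refine ⟨τ₀ / 2, half_pos hτ₀, fun τ y => Φ (τ, y), fun τ y => K (τ, y), fun τ hτ y => ?_, fun A hA => ?_⟩
  · have hlt : |τ| < τ₀ := by linarith
    refine ⟨Y (τ, y), hYu (τ, y) hlt, hYb (τ, y) hlt, ?_⟩
    simp only [hΦdef, hηid τ hτ]
  · have hB : IsCompact (Metric.closedBall (0 : ℝ) (τ₀ / 2) ×ˢ A) := (isCompact_closedBall _ _).prod hA
    obtain ⟨C₁, h1⟩ := hB.exists_bound_of_continuousOn hG.continuous.continuousOn
    obtain ⟨C₂, h2⟩ := hB.exists_bound_of_continuousOn hR.continuous.continuousOn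
    refine ⟨max 0 (max C₁ C₂), le_max_left _ _, fun y hy c τ hτ => ?_⟩
    have hmem : (τ, y) ∈ Metric.closedBall (0 : ℝ) (τ₀ / 2) ×ˢ A := ⟨by simpa using hτ, hy⟩
    dsimp only
    constructor
    · rw [hKg, hHg, hKG (τ, y), abs_mul, abs_pow, mul_comm]
      exact mul_le_mul_of_nonneg_right ((h1 _ hmem).trans ((le_max_left _ _).trans (le_max_right _ _))) (by positivity)
    · rw [hΦg, hKg, hKg, hKR (τ, y), abs_mul, abs_pow, mul_comm]
      exact mul_le_mul_of_nonneg_right ((h2 _ hmem).trans ((le_max_right _ _).trans (le_max_right _ _))) (by positivity)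

end RKMethod

/-! ### Near-conservation of the energy -/

/-- Normalization of the potential to vanish at a given node. -/
noncomputable def gaugeFix {N : ℕ} (i₀ : Fin N) : Phase N →L[ℝ] Phase N :=
  (ContinuousLinearMap.fst ℝ (Fin N → ℝ) (Fin N → ℝ)).prod (ContinuousLinearMap.pi fun i =>
    ((ContinuousLinearMap.proj i : (Fin N → ℝ) →L[ℝ] ℝ) - ContinuousLinearMap.proj i₀).comp
      (ContinuousLinearMap.snd ℝ (Fin N → ℝ) (Fin N → ℝ)))

theorem gaugeFix_apply {N : ℕ} (i₀ : Fin N) (y : Phase N) :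
    gaugeFix i₀ y = (y.1, fun i => y.2 i - y.2 i₀) := rfl

theorem gaugeFix_add_smul {N : ℕ} (i₀ : Fin N) (y : Phase N) : gaugeFix i₀ y + y.2 i₀ • gaugeShift N 1 = y := by
  ext <;> simp [gaugeFix_apply, gaugeShift]

theorem gaugeFix_gaugeShift {N : ℕ} (i₀ : Fin N) (y : Phase N) (c : ℝ) :
    gaugeFix i₀ (y + c • gaugeShift N 1) = gaugeFix i₀ y := by
  ext <;> simp [gaugeFix_apply, gaugeShift]

theorem norm_gaugeFix_le {N : ℕ} (i₀ : Fin N) (y : Phase N) : ‖gaugeFix i₀ y‖ ≤ 2 * ‖y‖ := by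
  rw [gaugeFix_apply]
  refine norm_prod_le_iff.mpr ⟨?_, (pi_norm_le_iff_of_nonneg (by positivity)).mpr fun i => ?_⟩
  · linarith [norm_fst_le y, norm_nonneg y]
  · have h1 := (norm_le_pi_norm y.2 i).trans (norm_snd_le y)
    have h2 := (norm_le_pi_norm y.2 i₀).trans (norm_snd_le y)
    exact (norm_sub_le _ _).trans (by linarith)

namespace WHSystem

variable {N : ℕ} (sys : WHSystem N)

theorem energy_gaugeFix (i₀ : Fin N) (y : Phase N) : sys.energy (gaugeFix i₀ y) = sys.energy y := by
  conv_rhs => rw [← gaugeFix_add_smul i₀ y]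
  rw [smul_gaugeShift, energy_add_gaugeShift]

/-- A gauge invariant Hamiltonian with a bounded and Lipschitz continuous vector field on the whole phase
space, which agrees with the given one on a gauge orbit of a compact set. -/
theorem exists_gauge_invariant_extension (i₀ : Fin N) {A : Set (Phase N)} (hA : IsCompact A)
    (hAp : A ⊆ positivePhase N) : ∃ H : Phase N → ℝ, ContDiff ℝ ∞ H ∧
      (∀ y (c : ℝ), H (y + c • gaugeShift N 1) = H y) ∧
      (∃ L, LipschitzWith L fun y => symplJ N (fderiv ℝ H y)) ∧
      (∃ M, ∀ y, ‖symplJ N (fderiv ℝ H y)‖ ≤ M) ∧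
      ∀ y, gaugeFix i₀ y ∈ A → H y = sys.energy y ∧ symplJ N (fderiv ℝ H y) = sys.field y := by
  obtain ⟨h, hh, hhc, hhe⟩ := exists_contDiff_hasCompactSupport_eventuallyEq isOpen_positivePhase hA hAp
    sys.contDiffOn_energy
  set P := gaugeFix i₀ with hP
  let T : (Phase N →L[ℝ] ℝ) →L[ℝ] Phase N :=
    (symplJ N : (Phase N →L[ℝ] ℝ) →L[ℝ] Phase N).comp ((ContinuousLinearMap.compL ℝ (Phase N) (Phase N) ℝ).flip P)
  have hf : ∀ y, symplJ N (fderiv ℝ (fun y => h (P y)) y) = T (fderiv ℝ h (P y)) := fun y => by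
    have h1 : fderiv ℝ (fun y => h (P y)) y = (fderiv ℝ h (P y)).comp P :=
      ((hh.differentiable (by simp) (P y)).hasFDerivAt.comp y P.hasFDerivAt).fderiv
    rw [h1]
    rfl
  have hdh : ContDiff ℝ ∞ (fderiv ℝ h) := hh.fderiv_right (by simp)
  have hdc : HasCompactSupport (fderiv ℝ h) := hhc.fderiv ℝ
  refine ⟨fun y => h (P y), hh.comp P.contDiff, fun y c => by simp only [hP, gaugeFix_gaugeShift], ?_, ?_, ?_⟩
  · obtain ⟨L, hL⟩ := hdh.lipschitzWith_of_hasCompactSupport hdc (by simp)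
    simp only [hf]
    exact ⟨_, T.lipschitz.comp (hL.comp P.lipschitz)⟩
  · obtain ⟨M, hM⟩ := hdc.exists_bound_of_continuous hdh.continuous
    refine ⟨‖T‖ * M, fun y => ?_⟩
    rw [hf]
    exact T.le_opNorm_of_le (hM _)
  · intro y hy
    -- The cut-off agrees with the energy on a neighbourhood of `A`, so the derivatives agree as
    -- well.
    have hev : ∀ᶠ x in 𝓝 (P y), h x = sys.energy x := hhe.filter_mono (nhds_le_nhdsSet hy)
    have hev' : (fun y => h (P y)) =ᶠ[𝓝 y] sys.energy := by
      filter_upwards [P.continuous.continuousAt.eventually hev] with z hz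
      rw [hz, hP, sys.energy_gaugeFix]
    refine ⟨hev'.self_of_nhds, ?_⟩
    rw [hev'.fderiv_eq]
    exact (sys.field_eq (y := y) fun i => hAp hy i).symm

end WHSystem

namespace RKMethod

variable {N s : ℕ} {m : RKMethod s}

theorem StepNear.step {sys : WHSystem N} {δ τ : ℝ} {y z : Phase N} (h : m.StepNear sys δ τ y z) :
    m.Step sys τ y z :=
  let ⟨Y, hY, hz⟩ := h
  ⟨Y, fun i => ⟨(hY i).1.1, (hY i).2⟩, hz⟩

theorem energy_nearly_conserved (hm : m.IsSymplectic) (sys : WHSystem N) {r : ℕ} (hr1 : 1 ≤ r)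
    (hr : m.HasOrder r) (ε : ℝ) {T₀ : ℝ} (hT₀ : 0 < T₀) :
    ∃ δ > 0, ∃ τ₀ > 0, ∃ C : ℝ, ∀ y₀ : Phase N, y₀.1 ∈ interiorSimplex N →
      sys.excessEnergy y₀ / sys.β ≤ ε → ∀ τ : ℝ, 0 < τ → τ ≤ τ₀ →
        (∃ y : ℕ → Phase N, y 0 = y₀ ∧
          ∀ n : ℕ, ((n + 1 : ℕ) : ℝ) * τ ≤ T₀ / τ ^ r → m.StepNear sys δ τ (y n) (y (n + 1))) ∧
        ∀ (y : ℕ → Phase N) (n : ℕ), y 0 = y₀ →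
          (∀ k < n, m.StepNear sys δ τ (y k) (y (k + 1))) → (n : ℝ) * τ ≤ T₀ / τ ^ r →
            (y n).1 ∈ interiorSimplex N ∧
            |sys.ham (y n).1 (y n).2 - sys.ham y₀.1 y₀.2| ≤ C * τ ^ r := by
  have hβ := sys.β_pos
  obtain ⟨i₀⟩ := sys.connected.nonempty
  -- The threshold `ε + 1` leaves room for an energy drift of at most `β`.
  obtain ⟨c, hc, hcy⟩ := sys.exists_density_lower_bound (ε + 1)
  obtain ⟨R, hR⟩ := sys.exists_potential_bound (ε + 1)
  set A₀ : Set (Phase N) := Set.Icc ((fun _ => c), fun _ => -R) ((fun _ => 1), fun _ => R) with hA₀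
  have hA₀c : IsCompact A₀ := isCompact_Icc
  have hA₀p : A₀ ⊆ positivePhase N := fun y hy i => hc.trans_le (hy.1.1 i)
  have hmemA₀ : ∀ y : Phase N, y.1 ∈ interiorSimplex N → sys.excessEnergy y / sys.β ≤ ε + 1 →
      gaugeFix i₀ y ∈ A₀ := fun y hy hε =>
    ⟨⟨fun i => hcy y hy hε i, fun i => (abs_le.mp (hR y hy hε i i₀)).1⟩,
      ⟨fun i => WHSystem.le_one_of_mem_interiorSimplex hy i, fun i => (abs_le.mp (hR y hy hε i i₀)).2⟩⟩
  obtain ⟨δ₀, hδ₀, hAp⟩ := hA₀c.exists_cthickening_subset_open isOpen_positivePhase hA₀p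
  set A : Set (Phase N) := Metric.cthickening δ₀ A₀ with hAdef
  have hA : IsCompact A := hA₀c.cthickening
  -- The radius is halved because normalizing the potential can double distances.
  have hnear : ∀ y z : Phase N, gaugeFix i₀ y ∈ A₀ → ‖z - y‖ ≤ δ₀ / 2 → gaugeFix i₀ z ∈ A := by
    intro y z hy hz
    refine Metric.mem_cthickening_of_dist_le _ _ _ _ hy ?_
    rw [dist_eq_norm, ← map_sub]
    linarith [norm_gaugeFix_le i₀ (z - y)]
  obtain ⟨H, hH, hHg, ⟨L, hL⟩, ⟨M, hM⟩, hHA⟩ := sys.exists_gauge_invariant_extension i₀ hA hAp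
  set f : Phase N → Phase N := fun y => symplJ N (fderiv ℝ H y) with hf
  -- Order `2 * r` balances the errors: about `τ ^ (-r - 1)` steps, each changing `K` by `τ ^ (2 * r
  -- + 1)`, accumulate to `τ ^ r`.
  obtain ⟨τ₁, hτ₁, Φ, K, hΦ, hK⟩ := hm.exists_nearly_conserved symplJ_skew
    (fun α => massFun_symplJ α) hH hHg (f := f) (fun _ => rfl) hL hM hr (n := 2 * r) (by omega)
  obtain ⟨C, hC0, hKC⟩ := hK A hA
  have hKH : ∀ y τ, gaugeFix i₀ y ∈ A → |τ| ≤ τ₁ →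
      |K τ y - sys.energy y| ≤ C * |τ| ^ r ∧ |K τ (Φ τ y) - K τ y| ≤ C * |τ| ^ (2 * r + 1) := by
    intro y τ hy hτ
    have := hKC _ hy (y.2 i₀) τ hτ
    rwa [gaugeFix_add_smul, (hHA y hy).1] at this
  have hM0 : 0 ≤ M := (norm_nonneg _).trans (hM 0)
  have hs0 := m.size_nonneg
  -- Twice the distance between `K` and the energy, at the two ends, plus the accumulated change of
  -- `K`.
  set C' : ℝ := 2 * C + C * T₀ with hC'
  have hC'0 : 0 ≤ C' := by positivity
  refine ⟨δ₀ / 2, by positivity, min (min τ₁ 1) (min (δ₀ / 2 / (m.size * M + 1)) (sys.β / (C' + 1))),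
    by positivity, C', fun y₀ hy₀ hε τ hτ hττ => ?_⟩
  have hτ1 : |τ| ≤ τ₁ := by
    rw [abs_of_pos hτ]; exact hττ.trans ((min_le_left _ _).trans (min_le_left _ _))
  have hτ2 : τ ≤ 1 := hττ.trans ((min_le_left _ _).trans (min_le_right _ _))
  have hτ3 : m.size * M * |τ| ≤ δ₀ / 2 := by
    have h := hττ.trans ((min_le_right _ _).trans (min_le_left _ _))
    rw [le_div_iff₀ (by positivity)] at h
    rw [abs_of_pos hτ]
    linarith
  have hτ4 : C' * τ ^ r ≤ sys.β := by
    have h := hττ.trans ((min_le_right _ _).trans (min_le_right _ _))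
    rw [le_div_iff₀ (by positivity)] at h
    have h2 : τ ^ r ≤ τ := pow_le_of_le_one hτ.le hτ2 (by omega)
    nlinarith
  have hupd : ∀ y Z, ‖m.update f τ y Z - y‖ ≤ δ₀ / 2 := by
    intro y Z
    rw [update, add_sub_cancel_left, norm_smul, Real.norm_eq_abs, mul_comm]
    refine le_trans ?_ hτ3
    exact mul_le_mul_of_nonneg_right (norm_sum_smul_le m.sum_b_le_size hM0 fun j => hM _) (abs_nonneg _)
  -- The stages of a step near `y` stay where the field is that of the cut-off Hamiltonian, so
  -- uniqueness there identifies the step with `Φ`.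
  have hstep : ∀ y z, gaugeFix i₀ y ∈ A₀ → m.StepNear sys (δ₀ / 2) τ y z → z = Φ τ y := by
    rintro y z hy ⟨Z, hZ, rfl⟩
    have hfeq : ∀ x ∈ positivePhase N ∩ Metric.closedBall y (δ₀ / 2), sys.field x = f x := fun x hx =>
      ((hHA x (hnear y x hy (mem_closedBall_iff_norm.mp hx.2))).2).symm
    obtain ⟨hZD, hZf⟩ := (m.isStages_iff_of_eqOn hfeq τ y Z).mp hZ
    obtain ⟨Z', hZ', -, hup⟩ := hΦ τ hτ1 y
    rw [hup, ← (hZ' Z).mp hZf, m.update_congr hfeq τ y hZD]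
  have hex : ∀ y, gaugeFix i₀ y ∈ A₀ → m.StepNear sys (δ₀ / 2) τ y (Φ τ y) := by
    intro y hy
    obtain ⟨Z, hZ, hZb, hup⟩ := hΦ τ hτ1 y
    have hZA : ∀ i, gaugeFix i₀ (Z i) ∈ A := fun i => hnear y _ hy ((hZb i).trans hτ3)
    have hZD : ∀ i, Z i ∈ positivePhase N ∩ Metric.closedBall y (δ₀ / 2) := fun i =>
      ⟨fun k => hAp (hZA i) k, mem_closedBall_iff_norm.mpr ((hZb i).trans hτ3)⟩
    have hfeq : ∀ x ∈ positivePhase N ∩ Metric.closedBall y (δ₀ / 2), sys.field x = f x := fun x hx =>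
      ((hHA x (hnear y x hy (mem_closedBall_iff_norm.mp hx.2))).2).symm
    refine ⟨Z, (m.isStages_iff_of_eqOn hfeq τ y Z).mpr ⟨hZD, (hZ Z).mpr rfl⟩, ?_⟩
    rw [hup, m.update_congr hfeq τ y hZD]
  have hy₀A : gaugeFix i₀ y₀ ∈ A₀ := hmemA₀ y₀ hy₀ (by linarith)
  have hA₀A : A₀ ⊆ A := Metric.self_subset_cthickening _
  -- Bootstrap: membership in `A₀` makes the next step legitimate and puts its end in the larger set
  -- `A`. There the bounds on `K` control the energy, and the energy bound returns the point to
  -- `A₀`.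
  have hmain : ∀ (y : ℕ → Phase N) (n : ℕ), y 0 = y₀ →
      (∀ k < n, m.StepNear sys (δ₀ / 2) τ (y k) (y (k + 1))) → (n : ℝ) * τ ≤ T₀ / τ ^ r →
      ((y n).1 ∈ interiorSimplex N ∧ gaugeFix i₀ (y n) ∈ A₀ ∧
        |K τ (y n) - K τ y₀| ≤ n * (C * τ ^ (2 * r + 1))) ∧
        |sys.energy (y n) - sys.energy y₀| ≤ C' * τ ^ r := by
    intro y n hy0
    induction n with
    | zero =>
      intro _ _
      rw [hy0]
      exact ⟨⟨hy₀, hy₀A, by simp⟩, by simpa using by positivity⟩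
    | succ n ih =>
      intro hst hn
      have hn' : (n : ℝ) * τ ≤ T₀ / τ ^ r := le_trans (by push_cast; nlinarith) hn
      obtain ⟨⟨hyn, hynA, hyK⟩, -⟩ := ih (fun k hk => hst k (by omega)) hn'
      have hs := hst n (by omega)
      have hΦn := hstep _ _ hynA hs
      have hzA : gaugeFix i₀ (y (n + 1)) ∈ A := by
        obtain ⟨Z, -, -, hup⟩ := hΦ τ hτ1 (y n)
        refine hnear (y n) _ hynA ?_
        rw [hΦn, hup]
        exact hupd _ _
      have hz : (y (n + 1)).1 ∈ interiorSimplex N := ⟨fun i => hAp hzA i, hs.step.mass_eq.trans hyn.2⟩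
      have hK1 : |K τ (y (n + 1)) - K τ y₀| ≤ (n + 1 : ℕ) * (C * τ ^ (2 * r + 1)) := by
        have h1 := (hKH (y n) τ (hA₀A hynA) hτ1).2
        rw [← hΦn, abs_of_pos hτ] at h1
        push_cast
        linarith [abs_sub_le (K τ (y (n + 1))) (K τ (y n)) (K τ y₀)]
      have hE : |sys.energy (y (n + 1)) - sys.energy y₀| ≤ C' * τ ^ r := by
        have h1 := (hKH _ τ hzA hτ1).1
        have h2 := (hKH _ τ (hA₀A hy₀A) hτ1).1
        rw [abs_of_pos hτ] at h1 h2
        have h3 : ((n + 1 : ℕ) : ℝ) * (C * τ ^ (2 * r + 1)) ≤ C * T₀ * τ ^ r := by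
          rw [le_div_iff₀ (by positivity)] at hn
          calc ((n + 1 : ℕ) : ℝ) * (C * τ ^ (2 * r + 1))
              = C * τ ^ r * (((n + 1 : ℕ) : ℝ) * τ * τ ^ r) := by ring
            _ ≤ C * τ ^ r * T₀ := mul_le_mul_of_nonneg_left hn (by positivity)
            _ = _ := by ring
        rw [abs_le] at h1 h2 hK1 ⊢
        constructor <;> simp only [hC'] <;> linarith [h1.1, h1.2, h2.1, h2.2, hK1.1, hK1.2]
      refine ⟨⟨hz, hmemA₀ _ hz ?_, hK1⟩, hE⟩
      rw [div_le_iff₀ hβ] at hε ⊢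
      have : sys.excessEnergy (y (n + 1)) = sys.excessEnergy y₀ + (sys.energy (y (n + 1)) - sys.energy y₀) := by
        simp only [WHSystem.excessEnergy, WHSystem.energy]; ring
      linarith [(abs_le.mp hE).2]
  refine ⟨⟨fun n => (Φ τ)^[n] y₀, rfl, fun n => ?_⟩, fun y n hy0 hst hn => ?_⟩
  -- The iterates of `Φ` form a solution only as long as they remain in `A₀`; this follows from
  -- `hmain` once all earlier iterates are known to be steps.
  · induction n using Nat.strong_induction_on with
    | _ n ih =>
      intro hn
      have hle : ∀ k ≤ n + 1, (k : ℝ) * τ ≤ T₀ / τ ^ r := fun k hk =>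
        (mul_le_mul_of_nonneg_right (Nat.cast_le.mpr hk) hτ.le).trans hn
      have h := (hmain (fun n => (Φ τ)^[n] y₀) n rfl (fun k hk => ih k hk (hle _ (by omega))) (hle n (by omega))).1.2.1
      have := hex _ h
      rwa [← Function.iterate_succ_apply' (Φ τ)] at this
  · have h := hmain y n hy0 hst hn
    exact ⟨h.1.1, h.2⟩

end RKMethod

/-! ### The structure-preservation theorem -/

theorem theorem4p1 {N s : ℕ} (sys : WHSystem N) (m : RKMethod s)
    (hsymp : m.IsSymplectic) (hsum : ∑ i, m.b i = 1) :
    -- the scheme is locally uniquely solvable and its stages depend smoothly on the starting value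
    (∀ y₀ ∈ positivePhase N, ∃ δ > 0, ∃ τ₀ > 0, ∃ U : Set (Phase N), IsOpen U ∧ y₀ ∈ U ∧
      ∀ τ : ℝ, |τ| ≤ τ₀ → ∃ Y : Phase N → Fin s → Phase N, ContDiffOn ℝ ∞ Y U ∧
        ∀ y ∈ U, ∀ Z : Fin s → Phase N,
          m.IsStages sys.field (positivePhase N ∩ Metric.closedBall y δ) τ y Z ↔ Z = Y y) ∧
    -- preservation of mass
    (∀ (τ : ℝ) (y : ℕ → Phase N) (n : ℕ), (∀ k < n, m.Step sys τ (y k) (y (k + 1))) →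
      ∑ i, (y n).1 i = ∑ i, (y 0).1 i) ∧
    -- preservation of the symplectic form along every differentiable family of solutions
    (∀ (E : Type) [NormedAddCommGroup E] [NormedSpace ℝ E] (e : E) (τ : ℝ) (n : ℕ)
      (y : ℕ → E → Phase N) (Y : ℕ → E → Fin s → Phase N),
      DifferentiableAt ℝ (y 0) e → (∀ k < n, DifferentiableAt ℝ (Y k) e) →
      (∀ k < n, ∀ᶠ x in 𝓝 e, m.IsStages sys.field (positivePhase N) τ (y k x) (Y k x) ∧
        y (k + 1) x = m.update sys.field τ (y k x) (Y k x)) →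
      DifferentiableAt ℝ (y n) e ∧ ∀ u v : E,
        sympForm (fderiv ℝ (y n) e u) (fderiv ℝ (y n) e v) =
          sympForm (fderiv ℝ (y 0) e u) (fderiv ℝ (y 0) e v)) ∧
    -- time reversibility of symmetric schemes
    (m.IsSymmetric sys.field (positivePhase N) →
      ∀ (τ : ℝ) (y : ℤ → Phase N) (n₁ n₂ : ℤ),
        (∀ n, n₁ ≤ n → n < n₂ → m.Step sys τ (y n) (y (n + 1))) →
        ∀ n, -n₂ ≤ n → n < -n₁ →
          m.Step sys τ ((y (-n)).1, -(y (-n)).2) ((y (-(n + 1))).1, -(y (-(n + 1))).2)) ∧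
    -- gauge invariance
    (∀ (α τ : ℝ) (y : ℕ → Phase N) (n : ℕ), (∀ k < n, m.Step sys τ (y k) (y (k + 1))) →
      ∀ k < n, m.Step (sys.shiftPotential α) τ
        ((y k).1, fun i => (y k).2 i + α * (k * τ))
        ((y (k + 1)).1, fun i => (y (k + 1)).2 i + α * ((k + 1 : ℕ) * τ))) ∧
    -- interior stationary solutions
    (∀ ρ ∈ interiorSimplex N,
      (∃ δ > 0, ∃ τ₀ > 0, ∀ τ : ℝ, τ ≠ 0 → |τ| ≤ τ₀ → ∀ v : ℝ,
        ((∀ n : ℕ, m.StepNear sys δ τ (stationaryState ρ v τ n) (stationaryState ρ v τ (n + 1))) ↔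
          ∀ n : ℕ, sys.IsCritical (stationaryState ρ v τ n) ∧
            v = sys.ham ρ (stationaryState ρ v τ n).2 + 1 / 2 * ∑ i, ∑ j, sys.W i j * ρ i * ρ j)) ∧
      ∀ τ v : ℝ,
        (∀ n : ℕ, sys.IsCritical (stationaryState ρ v τ n) ∧
          v = sys.ham ρ (stationaryState ρ v τ n).2 + 1 / 2 * ∑ i, ∑ j, sys.W i j * ρ i * ρ j) →
        ∀ n : ℕ, m.Step sys τ (stationaryState ρ v τ n) (stationaryState ρ v τ (n + 1))) ∧
    -- near-preservation of the Hamiltonian for times of order `τ ^ (-r)`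
    (∀ r : ℕ, 1 ≤ r → m.HasOrder r → ∀ ε > 0, ∀ T₀ > 0,
      ∃ δ > 0, ∃ τ₀ > 0, ∃ C : ℝ, ∀ y₀ : Phase N, y₀.1 ∈ interiorSimplex N →
        sys.excessEnergy y₀ / sys.β ≤ ε → ∀ τ : ℝ, 0 < τ → τ ≤ τ₀ →
          (∃ y : ℕ → Phase N, y 0 = y₀ ∧
            ∀ n : ℕ, ((n + 1 : ℕ) : ℝ) * τ ≤ T₀ / τ ^ r → m.StepNear sys δ τ (y n) (y (n + 1))) ∧
          ∀ (y : ℕ → Phase N) (n : ℕ), y 0 = y₀ →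
            (∀ k < n, m.StepNear sys δ τ (y k) (y (k + 1))) → (n : ℝ) * τ ≤ T₀ / τ ^ r →
              (y n).1 ∈ interiorSimplex N ∧
              |sys.ham (y n).1 (y n).2 - sys.ham y₀.1 y₀.2| ≤ C * τ ^ r) := by
  refine ⟨fun y₀ hy₀ => m.exists_local_stages isOpen_positivePhase sys.contDiffOn_field hy₀, ?_, ?_, ?_, ?_,
    fun ρ hρ => RKMethod.stationary_solutions sys hsum hρ,
    fun r hr1 hr ε _ T₀ hT₀ => RKMethod.energy_nearly_conserved hsymp sys hr1 hr ε hT₀⟩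
  · intro τ y n h
    induction n with
    | zero => rfl
    | succ n ih => exact (h n n.lt_succ_self).mass_eq.trans (ih fun k hk => h k (hk.trans n.lt_succ_self))
  · intro E _ _ e τ n y Y hy hY hst
    induction n with
    | zero => exact ⟨hy, fun _ _ => rfl⟩
    | succ n ih =>
      obtain ⟨hd, hs⟩ := ih (fun k hk => hY k (hk.trans n.lt_succ_self)) fun k hk => hst k (hk.trans n.lt_succ_self)
      obtain ⟨hd', hs'⟩ := hsymp.fderiv_update symplJ_skew isOpen_positivePhase sys.contDiffOn_energy
        (fun x hx => sys.field_eq hx) hd (hY n n.lt_succ_self) (hst n n.lt_succ_self)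
      exact ⟨hd', fun u v => (hs' u v).trans (hs u v)⟩
  · intro hsym τ y n₁ n₂ h n hn₁ hn₂
    have h1 := h (-(n + 1)) (by omega) (by omega)
    rw [show -(n + 1) + 1 = -n by ring] at h1
    -- Reversing the potential turns the step into one of size `-τ`; symmetry of the method
    -- exchanges its end points and restores the size `τ`.
    have h2 := RKMethod.Step.reversal h1
    exact (hsym _ _ _).mpr h2
  · intro α τ y n h k hk
    have h1 := (h k hk).gauge hsum α (α * (k * τ))
    have e : ∀ (z : Phase N) (c : ℝ), (z.1, fun i => z.2 i + c) = z + gaugeShift N c := fun z c => by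
      ext <;> simp [gaugeShift]
    rw [e, e]
    convert h1 using 3
    push_cast
    ring
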